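/- Setting. Let $U\subset\mathbb R^d$ be convex with non-empty interior, let $f\in C^2(U,\mathbb R^d)$, and let $(\eta,q)$ be an entropy/entropy-flux pair: $\eta\in C^2(U,\mathbb R)$ strictly convex, $q\in C^1(U,\mathbb R)$, $Dq=D\eta\,Df$ on $U$. Let $\mathfrak D\subset U$ be compact and convex, and let $C_{\bar f}\ge 0$ and $0<C_{\underline\eta}\le C_{\bar\eta}$ be constants with $$|v^{T}D^2f(z)v|\le C_{\bar f}|v|^2,\qquad C_{\underline\eta}|v|^2\le v^{T}D^2\eta(z)v\le C_{\bar\eta}|v|^2\qquad(z\in\mathfrak D,\ v\in\mathbb R^d).$$ Entropy solution. Write $I=(0,1)$. Let $u\in L_\infty(I\times(0,\infty),U)$, with values in $\mathfrak D$ almost everywhere, be an entropy solution of $\partial_tu+\partial_xf(u)=0$ with periodic boundary conditions and initial datum $u_0\in L_\infty(I,U)$, i.e. $$\int_0^\infty\!\!\int_0^1 u\cdot\partial_t\phi+f(u)\cdot\partial_x\phi\,dx\,dt+\int_0^1u_0\cdot\phi(\cdot,0)\,dx=0\quad\forall\phi\in C_c^\infty(S^1\times[0,\infty),\mathbb R^d),$$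 $$\int_0^\infty\!\!\int_0^1\eta(u)\,\partial_t\phi+q(u)\,\partial_x\phi\,dx\,dt+\int_0^1\eta(u_0)\,\phi(\cdot,0)\,dx\ge0\quad\forall\phi\in C_c^\infty(S^1\times[0,\infty),[0,\infty)).$$ Scheme. Let $0=x_0<\dots<x_N=1$, $I_n=[x_n,x_{n+1}]$, $h_n=x_{n+1}-x_n$, $p\ge0$, $T>0$, and let $\mathbb V_k$ be the space of $\mathbb R^d$-valued functions that are polynomial of degree $\le k$ on every $I_n$, two-valued at the nodes ($\mathbb V_{-1}=\{0\}$). Put $[[g]]_n=g(x_n^-)-g(x_n^+)$ with the periodic convention $g(x_0^-)=g(x_N^-)$, $g(x_N^+)=g(x_0^+)$. Let $F$ be a numerical flux with $F(a,b)=f(w(a,b))$ for $a,b\in U$, where $w:U\times U\to U$ satisfies $|w(a,b)-a|\le L|a-b|$ and $|w(a,b)-b|\le L|a-b|$ for all $a,b\in U$, for some $L>0$. Let $u_h\in C^1([0,T],\mathbb V_p)$ take values in $U$ (one-sided limits at the nodes included) and satisfy, for all $t\in[0,T]$ and all $\phi\in\mathbb V_p$, $$\sum_{n=0}^{N-1}\int_{I_n}\big(\partial_tu_h\cdot\phi+\partial_xf(u_h)\cdot\phi\big)\,dx+\sum_{n=0}^{N-1}\Big(F(u_h(x_n^-),u_h(x_n^+))\cdot[[\phi]]_n-[[f(u_h)\cdot\phi]]_n\Big)=0.$$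 Reconstruction. For each $t\in[0,T]$ let $\hat u(\cdot,t)\in\mathbb V_{p+1}$ be the function with $\int_I\hat u\cdot\phi\,dx=\int_Iu_h\cdot\phi\,dx$ for all $\phi\in\mathbb V_{p-1}$ and $\hat u(x_n^+)=w(u_h(x_n^-),u_h(x_n^+))$, $\hat u(x_{n+1}^-)=w(u_h(x_{n+1}^-),u_h(x_{n+1}^+))$ for $n=0,\dots,N-1$. Assume that $\hat u$ is Lipschitz continuous on $[0,1]\times[0,T]$ and takes values in $\mathfrak D$. Let $R:=\partial_t\hat u+\partial_xf(\hat u)$ and $\hat u_0:=\hat u(\cdot,0)$. **Theorem 5.5.** The function $u$ has a representative for which $u(\cdot,t)\in L_\infty(I)$ for every $t\ge0$ and $t\mapsto u(\cdot,t)$ is weak-$*$ continuous from $[0,\infty)$ to $L_\infty(I)$. For every such representative and every $t\in[0,T]$ (and, for an arbitrary representative of $u$, for almost every $t\in[0,T]$), $$\|u(\cdot,t)-u_h(\cdot,t)\|_{L_2(I)}^2\le2L^2\sum_{n=0}^{N-1}h_n\Big(\big|[[u_h(\cdot,t)]]_n\big|^2+\big|[[u_h(\cdot,t)]]_{n+1}\big|^2\Big)$$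 $$\qquad+\;2C_{\underline\eta}^{-1}\Big(\|R\|_{L_2(I\times(0,t))}^2+C_{\bar\eta}\|u_0-\hat u_0\|_{L_2(I)}^2\Big)\exp\left(\int_0^t\frac{C_{\bar\eta}C_{\bar f}\|\partial_x\hat u(\cdot,s)\|_{L_\infty(I)}+C_{\bar\eta}^2}{C_{\underline\eta}}\,ds\right).$$ -/

import Mathlib

open MeasureTheory Set
open scoped ContDiff

noncomputable section

/-- The Euclidean space `ℝ^d`. -/
abbrev Vec (d : ℕ) : Type := EuclideanSpace ℝ (Fin d)

/-! ### Conservation law, entropy pair, entropy solutions.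
Functions of space and time are written `u x t`. The spatial interval is `(0,1)`. -/

/-- `(η, q)` is an entropy / entropy-flux pair on the state space `U` for the flux `f`:
`η` is `C²` and strictly convex, `q` is `C¹`, and `Dq = Dη Df` on `U`. -/
structure IsEntropyPair {d : ℕ} (U : Set (Vec d)) (f : Vec d → Vec d) (η q : Vec d → ℝ) :
    Prop where
  contDiff_entropy : ContDiffOn ℝ 2 η U
  strictConvex : StrictConvexOn ℝ U η
  contDiff_flux : ContDiffOn ℝ 1 q U
  compat : ∀ z ∈ U, fderivWithin ℝ q U z = (fderivWithin ℝ η U z).comp (fderivWithin ℝ f U z)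

/-- Smooth, compactly supported functions on `S¹ × [0,∞)`: smooth functions of `(x,t)`, 1-periodic
in `x`, vanishing for all large `t` (only the values for `t ≥ 0` are ever used). -/
structure IsTestFunction {F : Type*} [NormedAddCommGroup F] [NormedSpace ℝ F] (φ : ℝ → ℝ → F) :
    Prop where
  smooth : ContDiff ℝ ∞ (fun z : ℝ × ℝ => φ z.1 z.2)
  periodic : ∀ x t, φ (x + 1) t = φ x t
  support : ∃ b : ℝ, ∀ x t, b ≤ t → φ x t = 0

/-- `u` is an entropy solution, with respect to the entropy pair `(η, q)`, of
`∂ₜu + ∂ₓf(u) = 0` on `(0,1) × (0,∞)` with periodic boundary conditions and initial datum `u₀`. -/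
structure IsEntropySolution {d : ℕ} (U : Set (Vec d)) (f : Vec d → Vec d) (η q : Vec d → ℝ)
    (u₀ : ℝ → Vec d) (u : ℝ → ℝ → Vec d) : Prop where
  memLp_init : MemLp u₀ ⊤ (volume.restrict (Ioo (0 : ℝ) 1))
  init_mem : ∀ᵐ x ∂(volume.restrict (Ioo (0 : ℝ) 1)), u₀ x ∈ U
  memLp : MemLp (fun z : ℝ × ℝ => u z.1 z.2) ⊤
    (volume.restrict (Ioo (0 : ℝ) 1 ×ˢ Ioi (0 : ℝ)))
  mem : ∀ᵐ z : ℝ × ℝ ∂(volume.restrict (Ioo (0 : ℝ) 1 ×ˢ Ioi (0 : ℝ))), u z.1 z.2 ∈ U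
  weak : ∀ φ : ℝ → ℝ → Vec d, IsTestFunction φ →
    (∫ t in Ioi (0 : ℝ), ∫ x in Ioo (0 : ℝ) 1,
        (inner ℝ (u x t) (deriv (fun s => φ x s) t)
          + inner ℝ (f (u x t)) (deriv (fun y => φ y t) x)))
      + ∫ x in Ioo (0 : ℝ) 1, inner ℝ (u₀ x) (φ x 0) = 0
  entropy : ∀ φ : ℝ → ℝ → ℝ, IsTestFunction φ → (∀ x t, 0 ≤ t → 0 ≤ φ x t) →
    0 ≤ (∫ t in Ioi (0 : ℝ), ∫ x in Ioo (0 : ℝ) 1,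
        (η (u x t) * deriv (fun s => φ x s) t + q (u x t) * deriv (fun y => φ y t) x))
      + ∫ x in Ioo (0 : ℝ) 1, η (u₀ x) * φ x 0

/-- `v` is a representative of `u ∈ L∞((0,1) × (0,∞))` with `v(·,t) ∈ L∞(0,1)` for every `t ≥ 0`
and `t ↦ v(·,t)` weak-* continuous on `[0,∞)`. It gives a meaning to `u(·,t)` for every `t`. -/
structure IsWeakStarContRep {d : ℕ} (u v : ℝ → ℝ → Vec d) : Prop where
  ae_eq : (fun z : ℝ × ℝ => v z.1 z.2)
    =ᵐ[volume.restrict (Ioo (0 : ℝ) 1 ×ˢ Ioi (0 : ℝ))] (fun z : ℝ × ℝ => u z.1 z.2)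
  memLp : ∀ t, 0 ≤ t → MemLp (fun x => v x t) ⊤ (volume.restrict (Ioo (0 : ℝ) 1))
  weakStar_cont : ∀ ψ : ℝ → Vec d, Integrable ψ (volume.restrict (Ioo (0 : ℝ) 1)) →
    ContinuousOn (fun t => ∫ x in Ioo (0 : ℝ) 1, inner ℝ (v x t) (ψ x)) (Ici 0)

/-- The constants `Cf`, `Clo`, `Chi` bound the second derivatives of the flux and of the entropy
on `D`: `|vᵀ D²f(z) v| ≤ Cf |v|²` and `Clo |v|² ≤ vᵀ D²η(z) v ≤ Chi |v|²` for `z ∈ D`. -/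
structure IsHessianBound {d : ℕ} (U D : Set (Vec d)) (f : Vec d → Vec d) (η : Vec d → ℝ)
    (Cf Clo Chi : ℝ) : Prop where
  flux_nonneg : 0 ≤ Cf
  lower_pos : 0 < Clo
  lower_le_upper : Clo ≤ Chi
  flux_bound : ∀ z ∈ D, ∀ v : Vec d,
    ‖fderivWithin ℝ (fderivWithin ℝ f U) U z v v‖ ≤ Cf * ‖v‖ ^ 2
  lower_bound : ∀ z ∈ D, ∀ v : Vec d,
    Clo * ‖v‖ ^ 2 ≤ fderivWithin ℝ (fderivWithin ℝ η U) U z v v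
  upper_bound : ∀ z ∈ D, ∀ v : Vec d,
    fderivWithin ℝ (fderivWithin ℝ η U) U z v v ≤ Chi * ‖v‖ ^ 2

/-! ### The semi-discrete discontinuous Galerkin scheme -/

/-- A mesh `0 = x₀ < x₁ < ⋯ < x_N = 1`. -/
structure Mesh (N : ℕ) where
  node : Fin (N + 1) → ℝ
  strictMono : StrictMono node
  node_zero : node 0 = 0
  node_last : node (Fin.last N) = 1

namespace Mesh

variable {N : ℕ} (M : Mesh N)

/-- The size `hₙ = xₙ₊₁ - xₙ` of the `n`-th cell. -/
def size (n : Fin N) : ℝ := M.node n.succ - M.node n.castSucc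

/-- The interior of the `n`-th cell. -/
def cell (n : Fin N) : Set ℝ := Ioo (M.node n.castSucc) (M.node n.succ)

/-- `g(xⱼ⁻)`, with the periodic convention `g(x₀⁻) = g(x_N⁻)`. -/
def leftTrace {F : Type*} [TopologicalSpace F] (g : ℝ → F) (j : Fin (N + 1)) : F :=
  if j = 0 then Function.leftLim g (M.node (Fin.last N)) else Function.leftLim g (M.node j)

/-- `g(xⱼ⁺)`, with the periodic convention `g(x_N⁺) = g(x₀⁺)`. -/
def rightTrace {F : Type*} [TopologicalSpace F] (g : ℝ → F) (j : Fin (N + 1)) : F :=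
  if j = Fin.last N then Function.rightLim g (M.node 0) else Function.rightLim g (M.node j)

/-- The jump `g(xⱼ⁻) - g(xⱼ⁺)`. -/
def jump {F : Type*} [TopologicalSpace F] [Sub F] (g : ℝ → F) (j : Fin (N + 1)) : F :=
  M.leftTrace g j - M.rightTrace g j

/-- Vector-valued functions whose components are, on each open cell, polynomials of degree
`< k`; the values at the nodes are immaterial. The space of piecewise polynomials of degree at
most `p` is `M.dgSpace (p + 1)`; `M.dgSpace 0` consists of the functions vanishing on all cells. -/
def dgSpace {d : ℕ} (k : ℕ) : Set (ℝ → Vec d) :=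
  {g | ∀ n : Fin N, ∃ P : Fin d → Polynomial ℝ, (∀ i, (P i).degree < (k : WithBot ℕ)) ∧
    ∀ x ∈ M.cell n, ∀ i, g x i = (P i).eval x}

end Mesh

/-- The numerical flux has the form `F(a,b) = f(w(a,b))` with `w : U × U → U` and
`|w(a,b) - a|, |w(a,b) - b| ≤ L |a - b|`. -/
structure IsAdmissibleFlux {d : ℕ} (U : Set (Vec d)) (f : Vec d → Vec d)
    (F w : Vec d → Vec d → Vec d) (L : ℝ) : Prop where
  pos : 0 < L
  maps : ∀ a ∈ U, ∀ b ∈ U, w a b ∈ U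
  flux_eq : ∀ a ∈ U, ∀ b ∈ U, F a b = f (w a b)
  dist_left : ∀ a ∈ U, ∀ b ∈ U, ‖w a b - a‖ ≤ L * ‖a - b‖
  dist_right : ∀ a ∈ U, ∀ b ∈ U, ‖w a b - b‖ ≤ L * ‖a - b‖

/-- `uh ∈ C¹([0,T], V_p)` takes values in `U` (its one-sided limits at the nodes included) and
solves the semi-discrete discontinuous Galerkin scheme with numerical flux `F`. -/
structure IsDGSolution {d N : ℕ} (M : Mesh N) (p : ℕ) (U : Set (Vec d)) (f : Vec d → Vec d)
    (F : Vec d → Vec d → Vec d) (T : ℝ) (uh : ℝ → ℝ → Vec d) : Prop where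
  mem_space : ∀ t ∈ Icc 0 T, (fun x => uh x t) ∈ M.dgSpace (p + 1)
  contDiff : ∀ n, ∀ x ∈ M.cell n, ContDiffOn ℝ 1 (fun t => uh x t) (Icc 0 T)
  mem : ∀ t ∈ Icc 0 T, ∀ n, ∀ x ∈ M.cell n, uh x t ∈ U
  leftTrace_mem : ∀ t ∈ Icc 0 T, ∀ j, M.leftTrace (fun x => uh x t) j ∈ U
  rightTrace_mem : ∀ t ∈ Icc 0 T, ∀ j, M.rightTrace (fun x => uh x t) j ∈ U
  scheme : ∀ t ∈ Icc 0 T, ∀ φ ∈ M.dgSpace (d := d) (p + 1),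
    (∑ n : Fin N, ∫ x in M.cell n,
        (inner ℝ (derivWithin (fun s => uh x s) (Icc 0 T) t) (φ x)
          + inner ℝ (deriv (fun y => f (uh y t)) x) (φ x)))
      + ∑ n : Fin N,
        (inner ℝ (F (M.leftTrace (fun x => uh x t) n.castSucc)
              (M.rightTrace (fun x => uh x t) n.castSucc)) (M.jump φ n.castSucc)
          - M.jump (fun x => (inner ℝ (f (uh x t)) (φ x) : ℝ)) n.castSucc) = 0

/-- `ghat` is the reconstruction of `g ∈ V_p`: the element of `V_{p+1}` with the same moments as `g`
against `V_{p-1}` and with the one-sided limits `w(g(xⱼ⁻), g(xⱼ⁺))` at the nodes. -/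
structure IsReconstruction {d N : ℕ} (M : Mesh N) (p : ℕ) (w : Vec d → Vec d → Vec d)
    (g ghat : ℝ → Vec d) : Prop where
  mem_space : ghat ∈ M.dgSpace (p + 2)
  moments : ∀ φ ∈ M.dgSpace (d := d) p,
    ∑ n : Fin N, ∫ x in M.cell n, (inner ℝ (ghat x) (φ x) : ℝ)
      = ∑ n : Fin N, ∫ x in M.cell n, inner ℝ (g x) (φ x)
  right : ∀ n : Fin N, M.rightTrace ghat n.castSucc
    = w (M.leftTrace g n.castSucc) (M.rightTrace g n.castSucc)
  left : ∀ n : Fin N, M.leftTrace ghat n.succ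
    = w (M.leftTrace g n.succ) (M.rightTrace g n.succ)

/-! ### The estimator -/

/-- The residual `R = ∂ₜû + ∂ₓf(û)`. -/
def recResidual {d : ℕ} (f : Vec d → Vec d) (uhat : ℝ → ℝ → Vec d) (x t : ℝ) : Vec d :=
  deriv (fun s => uhat x s) t + deriv (fun y => f (uhat y t)) x

/-- The squared `L₂(0,1)` norm. -/
def l2NormSq {d : ℕ} (g : ℝ → Vec d) : ℝ := ∫ x in Ioo (0 : ℝ) 1, ‖g x‖ ^ 2

/-- The `L∞(0,1)` norm of `∂ₓû(·,s)`. -/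
def supNormDx {d : ℕ} (uhat : ℝ → ℝ → Vec d) (s : ℝ) : ℝ :=
  (eLpNorm (fun x => deriv (fun y => uhat y s) x) ⊤ (volume.restrict (Ioo (0 : ℝ) 1))).toReal

/-- The right-hand side of the error estimate at time `t`. -/
def errorBound {d N : ℕ} (M : Mesh N) (f : Vec d → Vec d) (L Cf Clo Chi : ℝ)
    (u₀ : ℝ → Vec d) (uh uhat : ℝ → ℝ → Vec d) (t : ℝ) : ℝ :=
  2 * L ^ 2 * ∑ n : Fin N, M.size n *
      (‖M.jump (fun x => uh x t) n.castSucc‖ ^ 2 + ‖M.jump (fun x => uh x t) n.succ‖ ^ 2)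
    + 2 * Clo⁻¹ *
      ((∫ s in Ioo (0 : ℝ) t, l2NormSq (fun x => recResidual f uhat x s))
        + Chi * l2NormSq (fun x => u₀ x - uhat x 0)) *
      Real.exp (∫ s in Ioo (0 : ℝ) t, (Chi * Cf * supNormDx uhat s + Chi ^ 2) / Clo)

end

/-! The proof is the relative entropy method, with the reconstruction in the role of the regular
solution. Let `g` be `uhat` extended periodically in space and constantly in time; it is Lipschitz
with values in `D`. The relative entropy η(u) - η(g) - Dη(g)(u - g) is comparable to |u - g|² by the
Hessian bounds. Combine the entropy inequality tested with a time cutoff θ, the weak formulation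
tested with θ∇η(g), and the integrated derivatives of θ(η - Dη·id)(g) and θ(q - Dη·f)(g). The
first-order terms cancel because Dq = Dη Df, which leaves the balance `relEntropy_balance`.

The entropy Hessian symmetrizes Df, so the production of relative entropy equals -D²η(g)(R, u - g) -
D²η(g)(∂ₓg, ρ), where R is the residual and ρ the quadratic Taylor remainder of f. Young's
inequality (`relEntropyProduction_le`), localization in time by cutoffs and Grönwall's inequality
give the estimate for u - g at almost every time (`IsEntropySolution.ae_stability`).

Three gaps remain. First, θ∇η(g) is merely Lipschitz, so the weak formulations are extended to
Lipschitz test functions by mollification. Second, u(·,t) needs a meaning at every t: the potential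
W(x,t) = ∫₀ˣ u(y,t) dy has a jointly Lipschitz version (`IsEntropySolution.exists_potential`), and
∂ₓW is the weak-* continuous representative. The same potential carries the membership in `D` over
to the initial datum, since difference quotients of W are averages of u. Weak-* lower semicontinuity
of the L² distance then extends the estimate to every time (`IsWeakStarContRep.stability`). Third,
`uhat - uh` is on each cell a polynomial of degree at most p + 1, orthogonal to degrees below p,
with endpoint values bounded by L times the jumps; `intervalIntegral_sq_le_of_orthogonal` bounds its
L² norm by these values. The triangle inequality, squared, joins the two estimates and produces the
factors 2. -/

/-! ### Mollification of Lipschitz functions on the plane -/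

section Mollification

open ContinuousLinearMap Filter
open scoped Convolution NNReal Topology

/-- The derivative is put on Φ and not on the bump, so bounds and a.e. limits of `fderiv ℝ Φ` pass
to the mollified function. Differentiation under the integral is legitimate because the Lipschitz
bound dominates the difference quotients and Φ is differentiable almost everywhere by Rademacher's
theorem. -/
theorem hasFDerivAt_bump_convolution {E F : Type*} [NormedAddCommGroup E] [NormedSpace ℝ E]
    [FiniteDimensional ℝ E] [MeasurableSpace E] [BorelSpace E] [HasContDiffBump E]
    [NormedAddCommGroup F] [NormedSpace ℝ F] [FiniteDimensional ℝ F]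
    (μ : Measure E) [μ.IsAddHaarMeasure]
    (φ : ContDiffBump (0 : E)) {Φ : E → F} {K : ℝ≥0} (hΦ : LipschitzWith K Φ) (z : E) :
    HasFDerivAt (φ.normed μ ⋆[lsmul ℝ ℝ, μ] Φ) ((φ.normed μ ⋆[lsmul ℝ ℝ, μ] fderiv ℝ Φ) z) z := by
  have hcont : ∀ w : E, Continuous fun y => φ.normed μ y • Φ (w - y) := fun w =>
    φ.contDiff_normed (n := 0) |>.continuous.smul (hΦ.continuous.comp (by fun_prop))
  have hmeas : Measurable (fderiv ℝ Φ) := measurable_fderiv ℝ Φ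
  have hnc : Continuous (φ.normed μ) := (φ.contDiff_normed (n := 0)).continuous
  refine (hasFDerivAt_integral_of_dominated_loc_of_lip
    (F := fun w y => φ.normed μ y • Φ (w - y)) (F' := fun y => φ.normed μ y • fderiv ℝ Φ (z - y))
    (bound := fun y => φ.normed μ y * K) (s := univ) univ_mem
    (Eventually.of_forall fun w => (hcont w).aestronglyMeasurable)
    ((hcont z).integrable_of_hasCompactSupport (φ.hasCompactSupport_normed.smul_right))
    ?_ ?_ (φ.integrable_normed.mul_const _) ?_).2
  · have : Measurable fun y => fderiv ℝ Φ (z - y) := hmeas.comp (by fun_prop)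
    exact (hnc.measurable.smul this).aestronglyMeasurable
  · refine Eventually.of_forall fun y => LipschitzOnWith.of_dist_le_mul fun a _ b _ => ?_
    have hn := φ.nonneg_normed (μ := μ) y
    rw [dist_eq_norm, ← smul_sub, norm_smul, Real.norm_of_nonneg hn]
    have := hΦ.dist_le_mul (a - y) (b - y)
    rw [dist_sub_right, dist_eq_norm] at this
    have h2 : (Real.nnabs (φ.normed μ y * K) : ℝ) = φ.normed μ y * K := by
      simp [abs_of_nonneg hn]
    rw [h2, mul_assoc]
    exact mul_le_mul_of_nonneg_left this hn
  · have h1 : ∀ᵐ w ∂μ, DifferentiableAt ℝ Φ w := hΦ.ae_differentiableAt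
    have h2 := (quasiMeasurePreserving_sub_left μ z).ae h1
    filter_upwards [h2] with y hy
    have h3 : HasFDerivAt (fun w => Φ (w - y)) (fderiv ℝ Φ (z - y)) z :=
      hy.hasFDerivAt.comp z ((hasFDerivAt_id z).sub_const y)
    exact h3.const_smul _

/-- A sequence of bump functions at the origin of the plane, with radii at most `1`. -/
noncomputable def bumpSeq (k : ℕ) : ContDiffBump (0 : ℝ × ℝ) where
  rIn := 1 / (2 * ((k : ℝ) + 1))
  rOut := 1 / ((k : ℝ) + 1)
  rIn_pos := by positivity
  rIn_lt_rOut := by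
    apply one_div_lt_one_div_of_lt (by positivity)
    have : (0 : ℝ) ≤ k := by positivity
    linarith

/-- Smooth approximations of a function on the plane. -/
noncomputable def mollify {F : Type*} [NormedAddCommGroup F] [NormedSpace ℝ F] (k : ℕ)
    (Φ : ℝ × ℝ → F) : ℝ × ℝ → F :=
  (bumpSeq k).normed volume ⋆[lsmul ℝ ℝ, volume] Φ

theorem tendsto_bumpSeq_rOut : Tendsto (fun k => (bumpSeq k).rOut) atTop (𝓝 0) :=
  tendsto_one_div_add_atTop_nhds_zero_nat

theorem bumpSeq_rOut_le_one (k : ℕ) : (bumpSeq k).rOut ≤ 1 := by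
  have : (0 : ℝ) ≤ k := by positivity
  exact (div_le_one (by positivity)).2 (by linarith)

variable {F : Type*} [NormedAddCommGroup F] [NormedSpace ℝ F]

theorem mollify_apply (k : ℕ) (Φ : ℝ × ℝ → F) (z : ℝ × ℝ) :
    mollify k Φ z = ∫ y, (bumpSeq k).normed volume y • Φ (z - y) := rfl

theorem norm_mollify_le {k : ℕ} {Φ : ℝ × ℝ → F} {C : ℝ} (hC : ∀ z, ‖Φ z‖ ≤ C) (z : ℝ × ℝ) :
    ‖mollify k Φ z‖ ≤ C := by
  rw [mollify_apply]
  have h : ∫ y, (bumpSeq k).normed volume y * C = C := by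
    rw [integral_mul_const, (bumpSeq k).integral_normed, one_mul]
  refine (norm_integral_le_of_norm_le ((bumpSeq k).integrable_normed.mul_const C)
    (Eventually.of_forall fun y => ?_)).trans h.le
  rw [norm_smul, Real.norm_of_nonneg ((bumpSeq k).nonneg_normed y)]
  exact mul_le_mul_of_nonneg_left (hC _) ((bumpSeq k).nonneg_normed y)

theorem mollify_nonneg {k : ℕ} {Φ : ℝ × ℝ → ℝ} (h : ∀ z, 0 ≤ Φ z) (z : ℝ × ℝ) :
    0 ≤ mollify k Φ z :=
  integral_nonneg fun y => mul_nonneg ((bumpSeq k).nonneg_normed y) (h _)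

theorem dist_mollify_le [FiniteDimensional ℝ F] {k : ℕ} {Φ : ℝ × ℝ → F} {K : ℝ≥0}
    (hΦ : LipschitzWith K Φ) (z : ℝ × ℝ) :
    dist (mollify k Φ z) (Φ z) ≤ K * (bumpSeq k).rOut := by
  refine (bumpSeq k).dist_normed_convolution_le hΦ.continuous.aestronglyMeasurable fun x hx => ?_
  exact (hΦ.dist_le_mul x z).trans (mul_le_mul_of_nonneg_left (le_of_lt hx) K.2)

theorem mollify_eq_zero {k : ℕ} {Φ : ℝ × ℝ → F} {b : ℝ} (h : ∀ x t, b ≤ t → Φ (x, t) = 0)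
    {x t : ℝ} (ht : b + 1 ≤ t) : mollify k Φ (x, t) = 0 := by
  rw [mollify_apply]
  refine integral_eq_zero_of_ae (Eventually.of_forall fun y => ?_)
  by_cases hy : (bumpSeq k).normed volume y = 0
  · simp [hy]
  · have : y ∈ Metric.ball (0 : ℝ × ℝ) (bumpSeq k).rOut := by
      rw [← (bumpSeq k).support_normed_eq (μ := volume)]; exact hy
    rw [mem_ball_zero_iff] at this
    have h2 : |y.2| ≤ ‖y‖ := by simpa using norm_snd_le y
    have h3 := bumpSeq_rOut_le_one k
    have h4 := abs_le.1 (h2.trans (this.le.trans h3))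
    have h5 : Φ ((x, t) - y) = 0 := h (x - y.1) (t - y.2) (by linarith [h4.2])
    simp [h5]

theorem mollify_periodic {k : ℕ} {Φ : ℝ × ℝ → F} (h : ∀ x t, Φ (x + 1, t) = Φ (x, t))
    (x t : ℝ) : mollify k Φ (x + 1, t) = mollify k Φ (x, t) := by
  simp only [mollify_apply]
  congr 1
  ext y
  have : Φ ((x + 1, t) - y) = Φ ((x, t) - y) := by
    rw [show (x + 1, t) - y = (x - y.1 + 1, t - y.2) by ext <;> simp; ring, h]
    rfl
  rw [this]

theorem HasFDerivAt.hasDerivAt_snd {Φ : ℝ × ℝ → F} {Φ' : ℝ × ℝ →L[ℝ] F} {x t : ℝ}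
    (h : HasFDerivAt Φ Φ' (x, t)) : HasDerivAt (fun s => Φ (x, s)) (Φ' (0, 1)) t :=
  h.comp_hasDerivAt t ((hasDerivAt_const t x).prodMk (hasDerivAt_id t))

theorem HasFDerivAt.hasDerivAt_fst {Φ : ℝ × ℝ → F} {Φ' : ℝ × ℝ →L[ℝ] F} {x t : ℝ}
    (h : HasFDerivAt Φ Φ' (x, t)) : HasDerivAt (fun y => Φ (y, t)) (Φ' (1, 0)) x :=
  h.comp_hasDerivAt x ((hasDerivAt_id x).prodMk (hasDerivAt_const x t))

variable [FiniteDimensional ℝ F]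

theorem hasFDerivAt_mollify {k : ℕ} {Φ : ℝ × ℝ → F} {K : ℝ≥0} (hΦ : LipschitzWith K Φ)
    (z : ℝ × ℝ) : HasFDerivAt (mollify k Φ) (mollify k (fderiv ℝ Φ) z) z :=
  hasFDerivAt_bump_convolution volume (bumpSeq k) hΦ z

theorem ae_tendsto_mollify_fderiv {Φ : ℝ × ℝ → F} {K : ℝ≥0} (hΦ : LipschitzWith K Φ) :
    ∀ᵐ z : ℝ × ℝ, Tendsto (fun k => mollify k (fderiv ℝ Φ) z) atTop (𝓝 (fderiv ℝ Φ z)) := by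
  -- Convergence at Lebesgue points requires the ratio of outer to inner radius to stay bounded;
  -- here it is always 2.
  refine ContDiffBump.ae_convolution_tendsto_right_of_locallyIntegrable tendsto_bumpSeq_rOut
    (K := 2) (Eventually.of_forall fun k => ?_) ?_
  · have : (bumpSeq k).rOut = 2 * (bumpSeq k).rIn := by
      simp only [bumpSeq]; field_simp
    exact this.le
  · have : MemLp (fderiv ℝ Φ) ⊤ (volume : Measure (ℝ × ℝ)) :=
      memLp_top_of_bound (measurable_fderiv ℝ Φ).aestronglyMeasurable K
        (Eventually.of_forall fun z => norm_fderiv_le_of_lipschitz ℝ hΦ)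
    exact this.locallyIntegrable le_top

theorem isTestFunction_mollify {k : ℕ} {Φ : ℝ × ℝ → F} {K : ℝ≥0} (hΦ : LipschitzWith K Φ)
    (hper : ∀ x t, Φ (x + 1, t) = Φ (x, t)) {b : ℝ} (hb : ∀ x t, b ≤ t → Φ (x, t) = 0) :
    IsTestFunction fun x t => mollify k Φ (x, t) where
  smooth := (bumpSeq k).hasCompactSupport_normed.contDiff_convolution_left _
    (bumpSeq k).contDiff_normed hΦ.continuous.locallyIntegrable
  periodic := mollify_periodic hper
  support := ⟨b + 1, fun _ _ ht => mollify_eq_zero hb ht⟩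

end Mollification

/-! ### Passing to the limit from smooth to Lipschitz test functions -/

section LipschitzTest

open Filter
open scoped NNReal Topology

/-- Lebesgue measure on the space-time cylinder `(0,1) × (0,∞)`. -/
noncomputable abbrev cylMeasure : Measure (ℝ × ℝ) :=
  (volume.restrict (Ioo (0 : ℝ) 1)).prod (volume.restrict (Ioi (0 : ℝ)))

theorem cylMeasure_eq :
    cylMeasure = volume.restrict (Ioo (0 : ℝ) 1 ×ˢ Ioi (0 : ℝ)) :=
  Measure.prod_restrict _ _

theorem cylMeasure_absolutelyContinuous : cylMeasure ≪ (volume : Measure (ℝ × ℝ)) := by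
  rw [cylMeasure_eq]
  exact Measure.restrict_le_self.absolutelyContinuous

theorem integrable_cyl_of_bound {G : Type*} [NormedAddCommGroup G] {h : ℝ × ℝ → G}
    (hm : AEStronglyMeasurable h cylMeasure) {C b : ℝ} (hC : ∀ᵐ z ∂cylMeasure, ‖h z‖ ≤ C)
    (hb : ∀ x t, b ≤ t → h (x, t) = 0) : Integrable h cylMeasure := by
  have h1 : Integrable ((univ ×ˢ Iio b).indicator fun _ : ℝ × ℝ => C) cylMeasure := by
    rw [integrable_indicator_iff (MeasurableSet.univ.prod measurableSet_Iio)]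
    refine integrableOn_const ?_ (by simp)
    rw [Measure.prod_prod, Measure.restrict_apply measurableSet_Iio]
    refine ENNReal.mul_ne_top (by simp) ?_
    rw [show Iio b ∩ Ioi 0 = Ioo 0 b by ext; simp [and_comm]]
    simp
  refine h1.mono' hm ?_
  filter_upwards [hC] with z hz
  by_cases hzb : z.2 < b
  · rwa [indicator_of_mem (by simpa using hzb)]
  · rw [indicator_of_notMem (by simpa using hzb), show h z = 0 from hb z.1 z.2 (not_lt.1 hzb)]
    simp

variable {F : Type*} [NormedAddCommGroup F] [InnerProductSpace ℝ F]

/-- The distributional pairing of the balance law with densities `A`, `B` and initial value `A₀`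
with a test function `Φ`. -/
noncomputable def pairing (A B : ℝ × ℝ → F) (A₀ : ℝ → F) (Φ : ℝ × ℝ → F) : ℝ :=
  (∫ z, (inner ℝ (A z) (fderiv ℝ Φ z (0, 1)) + inner ℝ (B z) (fderiv ℝ Φ z (1, 0))) ∂cylMeasure)
    + ∫ x in Ioo (0 : ℝ) 1, inner ℝ (A₀ x) (Φ (x, 0))

theorem norm_unit_fst : ‖((1, 0) : ℝ × ℝ)‖ = 1 := by simp [Prod.norm_def]

theorem norm_unit_snd : ‖((0, 1) : ℝ × ℝ)‖ = 1 := by simp [Prod.norm_def]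

theorem fderiv_eq_zero_of_le {Φ : ℝ × ℝ → F} {b : ℝ} (hb : ∀ x t, b ≤ t → Φ (x, t) = 0)
    (x t : ℝ) (ht : b + 1 ≤ t) : fderiv ℝ Φ (x, t) = 0 := by
  have : Φ =ᶠ[𝓝 (x, t)] fun _ => 0 := by
    have : ∀ᶠ z : ℝ × ℝ in 𝓝 (x, t), b < z.2 :=
      continuous_snd.continuousAt.eventually (lt_mem_nhds (by simpa using by linarith))
    filter_upwards [this] with z hz using hb z.1 z.2 hz.le
  rw [this.fderiv_eq]; simp

theorem abs_pairing_integrand_le {a b : F} {T : ℝ × ℝ →L[ℝ] F} {CA CB K : ℝ}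
    (ha : ‖a‖ ≤ CA) (hb : ‖b‖ ≤ CB) (hT : ‖T‖ ≤ K) :
    ‖inner ℝ a (T (0, 1)) + inner ℝ b (T (1, 0))‖ ≤ CA * K + CB * K := by
  have h1 : ‖T (0, 1)‖ ≤ K := (T.le_opNorm _).trans (by rwa [norm_unit_snd, mul_one])
  have h2 : ‖T (1, 0)‖ ≤ K := (T.le_opNorm _).trans (by rwa [norm_unit_fst, mul_one])
  refine (norm_add_le _ _).trans (add_le_add ?_ ?_)
  · exact (norm_inner_le_norm _ _).trans
      (mul_le_mul ha h1 (norm_nonneg _) ((norm_nonneg _).trans ha))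
  · exact (norm_inner_le_norm _ _).trans
      (mul_le_mul hb h2 (norm_nonneg _) ((norm_nonneg _).trans hb))

variable {A B : ℝ × ℝ → F} {A₀ : ℝ → F} {CA CB C₀ : ℝ}

theorem aestronglyMeasurable_pairing_integrand (hA : AEStronglyMeasurable A cylMeasure)
    (hB : AEStronglyMeasurable B cylMeasure) {T : ℝ × ℝ → ℝ × ℝ →L[ℝ] F}
    (hT : AEStronglyMeasurable T cylMeasure) :
    AEStronglyMeasurable (fun z => (inner ℝ (A z) (T z (0, 1)) + inner ℝ (B z) (T z (1, 0)) : ℝ))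
      cylMeasure := by
  have h (v : ℝ × ℝ) : AEStronglyMeasurable (fun z => T z v) cylMeasure :=
    (ContinuousLinearMap.apply ℝ F v).continuous.comp_aestronglyMeasurable hT
  exact (hA.inner (h _)).add (hB.inner (h _))

variable [FiniteDimensional ℝ F]

theorem integrable_pairing_integrand (hA : AEStronglyMeasurable A cylMeasure)
    (hB : AEStronglyMeasurable B cylMeasure) (hCA : ∀ᵐ z ∂cylMeasure, ‖A z‖ ≤ CA)
    (hCB : ∀ᵐ z ∂cylMeasure, ‖B z‖ ≤ CB) {Φ : ℝ × ℝ → F} {K : ℝ≥0} (hΦ : LipschitzWith K Φ)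
    {b : ℝ} (hb : ∀ x t, b ≤ t → Φ (x, t) = 0) :
    Integrable (fun z => (inner ℝ (A z) (fderiv ℝ Φ z (0, 1))
      + inner ℝ (B z) (fderiv ℝ Φ z (1, 0)) : ℝ)) cylMeasure := by
  refine integrable_cyl_of_bound (C := CA * K + CB * K) (b := b + 1)
    (aestronglyMeasurable_pairing_integrand hA hB (measurable_fderiv ℝ Φ).aestronglyMeasurable)
    ?_ fun x t ht => ?_
  · filter_upwards [hCA, hCB] with z h1 h2
    exact abs_pairing_integrand_le h1 h2 (norm_fderiv_le_of_lipschitz ℝ hΦ)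
  · simp [fderiv_eq_zero_of_le hb x t ht]

/-- Since A and B are merely bounded, the derivatives of the test functions must converge almost
everywhere under a uniform bound; Lipschitz continuity of Φ supplies both. -/
theorem tendsto_pairing_mollify (hA : AEStronglyMeasurable A cylMeasure)
    (hB : AEStronglyMeasurable B cylMeasure) (hCA : ∀ᵐ z ∂cylMeasure, ‖A z‖ ≤ CA)
    (hCB : ∀ᵐ z ∂cylMeasure, ‖B z‖ ≤ CB)
    (hA₀ : AEStronglyMeasurable A₀ (volume.restrict (Ioo (0 : ℝ) 1)))
    (hC₀ : ∀ᵐ x ∂(volume.restrict (Ioo (0 : ℝ) 1)), ‖A₀ x‖ ≤ C₀)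
    {Φ : ℝ × ℝ → F} {K : ℝ≥0} (hΦ : LipschitzWith K Φ)
    {b : ℝ} (hb : ∀ x t, b ≤ t → Φ (x, t) = 0) :
    Tendsto (fun k => pairing A B A₀ (mollify k Φ)) atTop (𝓝 (pairing A B A₀ Φ)) := by
  have hCA0 : ∀ k z, ‖fderiv ℝ (mollify k Φ) z‖ ≤ K := fun k z => by
    rw [(hasFDerivAt_mollify hΦ z).fderiv]
    exact norm_mollify_le (fun z => norm_fderiv_le_of_lipschitz ℝ hΦ) z
  refine Tendsto.add ?_ ?_
  -- Mollification may lengthen the time support by 1, and `fderiv_eq_zero_of_le` gives up another 1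
  -- in order to have a neighbourhood on which the function vanishes.
  · have hbound : Integrable (fun z : ℝ × ℝ => if z.2 < b + 2 then CA * K + CB * K else 0)
        cylMeasure := by
      refine integrable_cyl_of_bound (C := |CA * K + CB * K|) (b := b + 2) ?_ ?_ ?_
      · exact (Measurable.ite (measurableSet_lt measurable_snd measurable_const)
          measurable_const measurable_const).aestronglyMeasurable
      · refine Eventually.of_forall fun z => ?_
        split_ifs <;> simp
      · intro x t ht
        simp [not_lt.2 ht]
    refine tendsto_integral_of_dominated_convergence _ (fun k => ?_) hbound (fun k => ?_) ?_
    · exact aestronglyMeasurable_pairing_integrand hA hB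
        (measurable_fderiv ℝ _).aestronglyMeasurable
    · filter_upwards [hCA, hCB] with z h1 h2
      split_ifs with hz
      · exact abs_pairing_integrand_le h1 h2 (hCA0 k z)
      · have : fderiv ℝ (mollify k Φ) z = 0 :=
          fderiv_eq_zero_of_le (b := b + 1) (fun x t ht => mollify_eq_zero hb ht) z.1 z.2
            (by linarith)
        simp [this]
    · filter_upwards [cylMeasure_absolutelyContinuous.ae_le (ae_tendsto_mollify_fderiv hΦ)]
        with z hz
      have h (v : ℝ × ℝ) : Tendsto (fun k => fderiv ℝ (mollify k Φ) z v) atTop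
          (𝓝 (fderiv ℝ Φ z v)) := by
        simp only [fun k => (hasFDerivAt_mollify (k := k) hΦ z).fderiv]
        exact ((ContinuousLinearMap.apply ℝ F v).continuous.tendsto _).comp hz
      exact (tendsto_const_nhds.inner (h _)).add (tendsto_const_nhds.inner (h _))
  · obtain ⟨C, hC⟩ : ∃ C, ∀ x ∈ Icc (0 : ℝ) 1, ‖Φ (x, 0)‖ ≤ C :=
      isCompact_Icc.exists_bound_of_continuousOn
        (hΦ.continuous.comp (by fun_prop : Continuous fun x : ℝ => (x, (0 : ℝ)))).continuousOn
    refine tendsto_integral_of_dominated_convergence (fun _ => C₀ * (C + K)) (fun k => ?_)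
      (integrable_const _) (fun k => ?_) ?_
    · refine hA₀.inner ?_
      have : Continuous (mollify k Φ) :=
        continuous_iff_continuousAt.2 fun z => (hasFDerivAt_mollify hΦ z).continuousAt
      exact (this.comp (by fun_prop : Continuous fun x : ℝ => (x, (0 : ℝ)))).aestronglyMeasurable
    · filter_upwards [hC₀, ae_restrict_mem measurableSet_Ioo] with x hx hx'
      refine (norm_inner_le_norm _ _).trans
        (mul_le_mul hx ?_ (norm_nonneg _) ((norm_nonneg _).trans hx))
      have h1 := (dist_mollify_le (k := k) hΦ (x, 0)).trans
        (mul_le_of_le_one_right K.2 (bumpSeq_rOut_le_one k))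
      have h2 := hC x (Ioo_subset_Icc_self hx')
      rw [dist_eq_norm] at h1
      calc ‖mollify k Φ (x, 0)‖ = ‖Φ (x, 0) + (mollify k Φ (x, 0) - Φ (x, 0))‖ := by congr 1; abel
        _ ≤ _ := (norm_add_le _ _).trans (add_le_add h2 h1)
    · refine Eventually.of_forall fun x => tendsto_const_nhds.inner ?_
      rw [tendsto_iff_dist_tendsto_zero]
      refine squeeze_zero (fun _ => dist_nonneg) (fun k => dist_mollify_le (k := k) hΦ (x, 0)) ?_
      simpa using tendsto_bumpSeq_rOut.const_mul (K : ℝ)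

/-- Fubini and the passage from total to partial derivatives bring the pairing into the iterated
form used in `IsEntropySolution`. -/
theorem pairing_mollify_eq (hA : AEStronglyMeasurable A cylMeasure)
    (hB : AEStronglyMeasurable B cylMeasure) (hCA : ∀ᵐ z ∂cylMeasure, ‖A z‖ ≤ CA)
    (hCB : ∀ᵐ z ∂cylMeasure, ‖B z‖ ≤ CB)
    {Φ : ℝ × ℝ → F} {K : ℝ≥0} (hΦ : LipschitzWith K Φ)
    {b : ℝ} (hb : ∀ x t, b ≤ t → Φ (x, t) = 0) (k : ℕ) :
    pairing A B A₀ (mollify k Φ) =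
      (∫ t in Ioi (0 : ℝ), ∫ x in Ioo (0 : ℝ) 1,
        (inner ℝ (A (x, t)) (deriv (fun s => mollify k Φ (x, s)) t)
          + inner ℝ (B (x, t)) (deriv (fun y => mollify k Φ (y, t)) x)))
      + ∫ x in Ioo (0 : ℝ) 1, inner ℝ (A₀ x) (mollify k Φ (x, 0)) := by
  have hL : LipschitzWith K (mollify k Φ) :=
    lipschitzWith_of_nnnorm_fderiv_le (𝕜 := ℝ)
      (fun z => (hasFDerivAt_mollify hΦ z).differentiableAt) fun z => by
        rw [(hasFDerivAt_mollify hΦ z).fderiv]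
        exact norm_mollify_le (fun z => norm_fderiv_le_of_lipschitz ℝ hΦ) z
  unfold pairing
  rw [integral_prod_symm _ (integrable_pairing_integrand hA hB hCA hCB hL
    (b := b + 1) fun x t ht => mollify_eq_zero hb ht)]
  congr 2
  ext t
  congr 1
  ext x
  have h := (hasFDerivAt_mollify (k := k) hΦ (x, t)).differentiableAt.hasFDerivAt
  rw [h.hasDerivAt_snd.deriv, h.hasDerivAt_fst.deriv]

end LipschitzTest

/-! ### The weak formulation and the entropy inequality for Lipschitz test functions -/

section SolutionLipschitzTest

open Filter
open scoped NNReal Topology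

/-- Outside D nothing is known about h; it is replaced there by 0, which makes it Borel and changes
the composition only on a null set. -/
theorem aestronglyMeasurable_comp_of_continuousOn {α E G : Type*} [MeasurableSpace α]
    [NormedAddCommGroup E] [MeasurableSpace E] [BorelSpace E] [SecondCountableTopology E]
    [NormedAddCommGroup G] [SecondCountableTopology G]
    {μ : Measure α} {w : α → E} {h : E → G} {D : Set E}
    (hw : AEStronglyMeasurable w μ) (hh : ContinuousOn h D) (hD : IsClosed D)
    (hwD : ∀ᵐ z ∂μ, w z ∈ D) : AEStronglyMeasurable (fun z => h (w z)) μ := by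
  borelize G
  have h1 : Measurable (D.indicator h) := by
    classical
    rw [← piecewise_eq_indicator]
    exact hh.measurable_piecewise continuousOn_const hD.measurableSet
  refine ((h1.comp_aemeasurable hw.aemeasurable).aestronglyMeasurable).congr ?_
  filter_upwards [hwD] with z hz
  simp [hz]

theorem MeasureTheory.MemLp.exists_ae_norm_le {α G : Type*} [MeasurableSpace α]
    [NormedAddCommGroup G] {μ : Measure α} {g : α → G} (hg : MemLp g ⊤ μ) :
    ∃ C, 0 ≤ C ∧ ∀ᵐ z ∂μ, ‖g z‖ ≤ C := by
  refine ⟨(eLpNormEssSup g μ).toReal, ENNReal.toReal_nonneg, ?_⟩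
  have hfin : eLpNormEssSup g μ ≠ ⊤ := by
    simpa using hg.eLpNorm_ne_top
  filter_upwards [enorm_ae_le_eLpNormEssSup g μ] with z hz
  rw [← toReal_enorm]
  exact ENNReal.toReal_mono hfin hz

theorem ae_norm_comp_le {α E G : Type*} [MeasurableSpace α] [NormedAddCommGroup E]
    [NormedAddCommGroup G] {μ : Measure α} {w : α → E} {h : E → G} {D : Set E} {C : ℝ}
    (hC : ∀ z ∈ D, ‖h z‖ ≤ C) (hwD : ∀ᵐ z ∂μ, w z ∈ D) : ∀ᵐ z ∂μ, ‖h (w z)‖ ≤ C :=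
  hwD.mono fun _ hz => hC _ hz

variable {d : ℕ} {U D : Set (Vec d)} {f : Vec d → Vec d} {η q : Vec d → ℝ} {u₀ : ℝ → Vec d}
  {u : ℝ → ℝ → Vec d}

theorem IsEntropySolution.aestronglyMeasurable (hu : IsEntropySolution U f η q u₀ u) :
    AEStronglyMeasurable (fun z : ℝ × ℝ => u z.1 z.2) cylMeasure := by
  rw [cylMeasure_eq]; exact hu.memLp.1

theorem IsEntropySolution.pairing_eq_zero (hu : IsEntropySolution U f η q u₀ u)
    (hD : IsCompact D) (hf : ContinuousOn f D) (huD : ∀ᵐ z ∂cylMeasure, u z.1 z.2 ∈ D)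
    {Φ : ℝ × ℝ → Vec d} {K : ℝ≥0} (hΦ : LipschitzWith K Φ)
    {b : ℝ} (hb : ∀ x t, b ≤ t → Φ (x, t) = 0) (hper : ∀ x t, Φ (x + 1, t) = Φ (x, t)) :
    pairing (fun z => u z.1 z.2) (fun z => f (u z.1 z.2)) u₀ Φ = 0 := by
  obtain ⟨CA, hCA⟩ := hD.exists_bound_of_continuousOn (f := id) continuousOn_id
  obtain ⟨CB, hCB⟩ := hD.exists_bound_of_continuousOn hf
  obtain ⟨C₀, -, hC₀⟩ := hu.memLp_init.exists_ae_norm_le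
  have hm := hu.aestronglyMeasurable
  have hm' := aestronglyMeasurable_comp_of_continuousOn hm hf hD.isClosed huD
  have h1 := ae_norm_comp_le hCA huD
  have h2 := ae_norm_comp_le hCB huD
  have ht := tendsto_pairing_mollify hm hm' h1 h2 hu.memLp_init.1 hC₀ hΦ hb
  refine tendsto_nhds_unique ht (tendsto_const_nhds.congr fun k => ?_)
  rw [pairing_mollify_eq hm hm' h1 h2 hΦ hb]
  exact (hu.weak _ (isTestFunction_mollify hΦ hper hb)).symm

theorem IsEntropySolution.pairing_entropy_nonneg (hu : IsEntropySolution U f η q u₀ u)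
    (hD : IsCompact D) (hη : ContinuousOn η D) (hq : ContinuousOn q D)
    (huD : ∀ᵐ z ∂cylMeasure, u z.1 z.2 ∈ D)
    (hu₀D : ∀ᵐ x ∂(volume.restrict (Ioo (0 : ℝ) 1)), u₀ x ∈ D)
    {Φ : ℝ × ℝ → ℝ} {K : ℝ≥0} (hΦ : LipschitzWith K Φ) (hΦ0 : ∀ z, 0 ≤ Φ z)
    {b : ℝ} (hb : ∀ x t, b ≤ t → Φ (x, t) = 0) (hper : ∀ x t, Φ (x + 1, t) = Φ (x, t)) :
    0 ≤ pairing (fun z => η (u z.1 z.2)) (fun z => q (u z.1 z.2)) (fun x => η (u₀ x)) Φ := by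
  obtain ⟨CA, hCA⟩ := hD.exists_bound_of_continuousOn hη
  obtain ⟨CB, hCB⟩ := hD.exists_bound_of_continuousOn hq
  have hm := hu.aestronglyMeasurable
  have hmη := aestronglyMeasurable_comp_of_continuousOn hm hη hD.isClosed huD
  have hmq := aestronglyMeasurable_comp_of_continuousOn hm hq hD.isClosed huD
  have hm₀ := aestronglyMeasurable_comp_of_continuousOn hu.memLp_init.1 hη hD.isClosed hu₀D
  have h1 := ae_norm_comp_le hCA huD
  have h2 := ae_norm_comp_le hCB huD
  refine ge_of_tendsto' (tendsto_pairing_mollify hmη hmq h1 h2 hm₀ (ae_norm_comp_le hCA hu₀D)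
    hΦ hb) fun k => ?_
  rw [pairing_mollify_eq hmη hmq h1 h2 hΦ hb]
  have := hu.entropy _ (isTestFunction_mollify (k := k) hΦ hper hb)
    fun x t _ => mollify_nonneg hΦ0 _
  simpa [mul_comm] using this

end SolutionLipschitzTest

/-! ### Time cutoffs and localization at Lebesgue points -/

section Cutoff

open Filter
open scoped NNReal Topology

/-- The piecewise linear cutoff: `1` up to time `τ`, `0` after time `τ + δ`. -/
noncomputable def timeCutoff (τ δ t : ℝ) : ℝ := max 0 (min 1 (1 - (t - τ) / δ))

variable {τ δ : ℝ}

theorem timeCutoff_nonneg (t : ℝ) : 0 ≤ timeCutoff τ δ t := le_max_left _ _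

theorem timeCutoff_le_one (t : ℝ) : timeCutoff τ δ t ≤ 1 :=
  max_le zero_le_one (min_le_left _ _)

theorem timeCutoff_of_le (hδ : 0 < δ) {t : ℝ} (ht : t ≤ τ) : timeCutoff τ δ t = 1 := by
  have : (t - τ) / δ ≤ 0 := div_nonpos_of_nonpos_of_nonneg (by linarith) hδ.le
  rw [timeCutoff, min_eq_left (by linarith), max_eq_right zero_le_one]

theorem timeCutoff_of_ge (hδ : 0 < δ) {t : ℝ} (ht : τ + δ ≤ t) : timeCutoff τ δ t = 0 := by
  have : 1 ≤ (t - τ) / δ := (one_le_div hδ).2 (by linarith)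
  rw [timeCutoff, max_eq_left ((min_le_right _ _).trans (by linarith))]

theorem lipschitzWith_timeCutoff : LipschitzWith (Real.nnabs δ⁻¹) (timeCutoff τ δ) := by
  have h : LipschitzWith (Real.nnabs δ⁻¹) fun t : ℝ => 1 - (t - τ) / δ := by
    refine LipschitzWith.of_dist_le_mul fun s t => ?_
    rw [Real.dist_eq, Real.dist_eq, Real.coe_nnabs, ← abs_mul,
      show 1 - (s - τ) / δ - (1 - (t - τ) / δ) = -(δ⁻¹ * (s - t)) by ring, abs_neg]
  exact (h.const_min 1).const_max 0

theorem deriv_timeCutoff_of_lt (hδ : 0 < δ) {t : ℝ} (ht : t < τ) :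
    deriv (timeCutoff τ δ) t = 0 := by
  have : timeCutoff τ δ =ᶠ[𝓝 t] fun _ => 1 := by
    filter_upwards [gt_mem_nhds ht] with s hs using timeCutoff_of_le hδ hs.le
  rw [this.deriv_eq]; simp

theorem deriv_timeCutoff_of_gt (hδ : 0 < δ) {t : ℝ} (ht : τ + δ < t) :
    deriv (timeCutoff τ δ) t = 0 := by
  have : timeCutoff τ δ =ᶠ[𝓝 t] fun _ => 0 := by
    filter_upwards [lt_mem_nhds ht] with s hs using timeCutoff_of_ge hδ hs.le
  rw [this.deriv_eq]; simp

theorem deriv_timeCutoff_of_mem (hδ : 0 < δ) {t : ℝ} (ht : t ∈ Ioo τ (τ + δ)) :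
    deriv (timeCutoff τ δ) t = -δ⁻¹ := by
  have : timeCutoff τ δ =ᶠ[𝓝 t] fun s => 1 - (s - τ) / δ := by
    filter_upwards [isOpen_Ioo.mem_nhds ht] with s hs
    have h1 : 0 ≤ (s - τ) / δ := div_nonneg (by linarith [hs.1]) hδ.le
    have h2 : (s - τ) / δ ≤ 1 := (div_le_one hδ).2 (by linarith [hs.2])
    rw [timeCutoff, min_eq_right (by linarith), max_eq_right (by linarith)]
  rw [this.deriv_eq]
  have h : HasDerivAt (fun s : ℝ => 1 - (s - τ) / δ) (-(1 / δ)) t :=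
    (((hasDerivAt_id t).sub_const τ).div_const δ).const_sub 1
  rw [h.deriv, one_div]

/-- A weak differential inequality, tested with cutoffs, holds in integrated form at almost every
time. -/
theorem ae_le_add_setIntegral_of_forall_timeCutoff {E H : ℝ → ℝ} {E₀ CE CH : ℝ}
    (hE : AEStronglyMeasurable E (volume.restrict (Ioi 0)))
    (hH : AEStronglyMeasurable H (volume.restrict (Ioi 0)))
    (hCE : ∀ᵐ t ∂(volume.restrict (Ioi (0 : ℝ))), ‖E t‖ ≤ CE)
    (hCH : ∀ᵐ t ∂(volume.restrict (Ioi (0 : ℝ))), ‖H t‖ ≤ CH)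
    (h : ∀ τ > 0, ∀ δ > 0, 0 ≤ (∫ t in Ioi (0 : ℝ),
      (deriv (timeCutoff τ δ) t * E t + timeCutoff τ δ t * H t)) + E₀) :
    ∀ᵐ τ ∂(volume.restrict (Ioi (0 : ℝ))), E τ ≤ E₀ + ∫ t in Ioo 0 τ, H t := by
  have hloc {G : ℝ → ℝ} {C : ℝ} (hG : AEStronglyMeasurable G (volume.restrict (Ioi 0)))
      (hC : ∀ᵐ t ∂(volume.restrict (Ioi (0 : ℝ))), ‖G t‖ ≤ C) :
      LocallyIntegrable ((Ioi (0 : ℝ)).indicator G) volume := by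
    have : MemLp ((Ioi (0 : ℝ)).indicator G) ⊤ volume := by
      rw [memLp_indicator_iff_restrict measurableSet_Ioi]
      exact memLp_top_of_bound hG C hC
    exact this.locallyIntegrable le_top
  have hloc' {G : ℝ → ℝ} {C : ℝ} (hG : AEStronglyMeasurable G (volume.restrict (Ioi 0)))
      (hC : ∀ᵐ t ∂(volume.restrict (Ioi (0 : ℝ))), ‖G t‖ ≤ C) {a b : ℝ} (ha : 0 ≤ a) :
      IntegrableOn G (Ioo a b) := by
    have hs : Ioo a b ⊆ Ioi 0 := fun t ht => lt_of_le_of_lt ha ht.1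
    refine IntegrableOn.of_bound (by simp) (hG.mono_set hs) C
      (ae_mono (Measure.restrict_mono hs le_rfl) hC)
  -- The exceptional times are those that are not Lebesgue differentiation points of E.
  have hder := LocallyIntegrable.ae_hasDerivAt_integral (hloc hE hCE)
  rw [ae_restrict_iff' measurableSet_Ioi]
  filter_upwards [hder] with τ hτ hτ0
  rw [mem_Ioi] at hτ0
  -- The slope -1/δ of the cutoff turns E into its mean over (τ, τ + δ), while H contributes at most
  -- δ·CH on that layer.
  have hmain : ∀ δ > 0, δ⁻¹ * (∫ t in Ioo τ (τ + δ), E t) ≤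
      E₀ + (∫ t in Ioo 0 τ, H t) + δ * CH := by
    intro δ hδ
    have h0 := h τ hτ0 δ hδ
    have hE' := hloc' hE hCE (a := τ) (b := τ + δ) hτ0.le
    have hH' := hloc' hH hCH (a := 0) (b := τ) le_rfl
    have hH'' := hloc' hH hCH (a := τ) (b := τ + δ) hτ0.le
    have hcut : Continuous (timeCutoff τ δ) := lipschitzWith_timeCutoff.continuous
    have hH3 : IntegrableOn (fun t => timeCutoff τ δ t * H t) (Ioo τ (τ + δ)) := by
      refine hH''.norm.mono' (hcut.aestronglyMeasurable.mul hH''.1) (Eventually.of_forall fun t => ?_)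
      rw [norm_mul, Real.norm_of_nonneg (timeCutoff_nonneg t)]
      exact mul_le_of_le_one_left (norm_nonneg _) (timeCutoff_le_one t)
    have hsplit : ∀ᵐ t, t ∈ Ioi (0 : ℝ) →
        deriv (timeCutoff τ δ) t * E t + timeCutoff τ δ t * H t =
        (Ioo 0 τ).indicator H t + (Ioo τ (τ + δ)).indicator
          (fun t => -δ⁻¹ * E t + timeCutoff τ δ t * H t) t := by
      have h1 : ∀ᵐ t : ℝ, t ≠ τ := by simp [ae_iff, measure_singleton]
      have h2 : ∀ᵐ t : ℝ, t ≠ τ + δ := by simp [ae_iff, measure_singleton]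
      filter_upwards [h1, h2] with t ht1 ht2 ht0
      rw [mem_Ioi] at ht0
      rcases lt_or_gt_of_ne ht1 with hlt | hgt
      · rw [indicator_of_mem (show t ∈ Ioo 0 τ from ⟨ht0, hlt⟩),
          indicator_of_notMem (fun hm => by linarith [hm.1]),
          deriv_timeCutoff_of_lt hδ hlt, timeCutoff_of_le hδ hlt.le]
        ring
      · rw [indicator_of_notMem (fun hm => by linarith [hm.2])]
        rcases lt_or_gt_of_ne ht2 with hlt2 | hgt2
        · rw [indicator_of_mem (show t ∈ Ioo τ (τ + δ) from ⟨hgt, hlt2⟩),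
            deriv_timeCutoff_of_mem hδ ⟨hgt, hlt2⟩]
          ring
        · rw [indicator_of_notMem (fun hm => by linarith [hm.2]),
            deriv_timeCutoff_of_gt hδ hgt2, timeCutoff_of_ge hδ hgt2.le]
          ring
    have hs1 : Ioo 0 τ ⊆ Ioi (0 : ℝ) := fun t ht => ht.1
    have hs2 : Ioo τ (τ + δ) ⊆ Ioi (0 : ℝ) := fun t ht => hτ0.trans ht.1
    rw [setIntegral_congr_ae measurableSet_Ioi hsplit, integral_add, setIntegral_indicator
      measurableSet_Ioo, setIntegral_indicator measurableSet_Ioo, inter_eq_right.2 hs1,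
      inter_eq_right.2 hs2, integral_add (hE'.const_mul _) hH3, integral_const_mul] at h0
    · have hlast : ∫ t in Ioo τ (τ + δ), timeCutoff τ δ t * H t ≤ δ * CH := by
        have : ‖∫ t in Ioo τ (τ + δ), timeCutoff τ δ t * H t‖ ≤
            CH * volume.real (Ioo τ (τ + δ)) := by
          refine norm_setIntegral_le_of_norm_le_const_ae (by simp) ?_
          filter_upwards [ae_mono (Measure.restrict_mono hs2 le_rfl) hCH] with t ht
          rw [norm_mul, Real.norm_of_nonneg (timeCutoff_nonneg t)]
          exact (mul_le_of_le_one_left (norm_nonneg _) (timeCutoff_le_one t)).trans ht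
        rw [Real.volume_real_Ioo_of_le (by linarith), add_sub_cancel_left, mul_comm] at this
        exact (le_abs_self _).trans this
      linarith
    · exact ((integrable_indicator_iff measurableSet_Ioo).2 hH').integrableOn
    · exact ((integrable_indicator_iff measurableSet_Ioo).2
        ((hE'.const_mul _).add hH3)).integrableOn
  have hlim1 : Tendsto (fun δ : ℝ => δ⁻¹ * (∫ t in Ioo τ (τ + δ), E t)) (𝓝[>] 0) (𝓝 (E τ)) := by
    have h1 := (hasDerivAt_iff_tendsto_slope_zero.1 (hτ 0)).mono_left
      (nhdsWithin_mono (0 : ℝ) (fun x (hx : 0 < x) => hx.ne') : 𝓝[>] (0 : ℝ) ≤ 𝓝[≠] 0)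
    rw [indicator_of_mem (show τ ∈ Ioi (0 : ℝ) from hτ0)] at h1
    refine h1.congr' ?_
    filter_upwards [self_mem_nhdsWithin] with δ hδ
    rw [mem_Ioi] at hδ
    have hi (a b : ℝ) : IntervalIntegrable ((Ioi (0 : ℝ)).indicator E) volume a b :=
      intervalIntegrable_iff.mpr <|
        ((hloc hE hCE).integrableOn_isCompact isCompact_uIcc).mono_set uIoc_subset_uIcc
    rw [intervalIntegral.integral_interval_sub_left (hi _ _) (hi _ _),
      intervalIntegral.integral_of_le (by linarith), integral_Ioc_eq_integral_Ioo, smul_eq_mul]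
    congr 1
    refine setIntegral_congr_fun measurableSet_Ioo fun t ht => ?_
    exact indicator_of_mem (show t ∈ Ioi (0 : ℝ) from hτ0.trans ht.1) _
  have hlim2 : Tendsto (fun δ : ℝ => E₀ + (∫ t in Ioo 0 τ, H t) + δ * CH) (𝓝[>] 0)
      (𝓝 (E₀ + ∫ t in Ioo 0 τ, H t)) := by
    have : Tendsto (fun δ : ℝ => E₀ + (∫ t in Ioo 0 τ, H t) + δ * CH) (𝓝 0)
      (𝓝 (E₀ + (∫ t in Ioo 0 τ, H t) + 0 * CH)) := (Continuous.tendsto (by fun_prop) _)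
    simpa using this.mono_left nhdsWithin_le_nhds
  exact le_of_tendsto_of_tendsto hlim1 hlim2
    (by filter_upwards [self_mem_nhdsWithin] with δ hδ using hmain δ hδ)

end Cutoff

/-! ### Second-order Taylor estimates along segments -/

section Taylor

open scoped NNReal Topology

/-- Monotonicity is used twice: φ' - Cs is nonincreasing, hence so is φ - sφ'(0) - Cs²/2.
Derivatives within [0,1] suffice, as is needed for segments that touch the boundary of U. -/
theorem le_taylor_two_of_deriv_two_le {φ φ' φ'' : ℝ → ℝ} {C : ℝ}
    (h1 : ∀ s ∈ Icc (0 : ℝ) 1, HasDerivWithinAt φ (φ' s) (Icc 0 1) s)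
    (h2 : ∀ s ∈ Icc (0 : ℝ) 1, HasDerivWithinAt φ' (φ'' s) (Icc 0 1) s)
    (hC : ∀ s ∈ Icc (0 : ℝ) 1, φ'' s ≤ C) : φ 1 - φ 0 - φ' 0 ≤ C / 2 := by
  have key (ψ ψ' : ℝ → ℝ) (h : ∀ s ∈ Icc (0 : ℝ) 1, HasDerivWithinAt ψ (ψ' s) (Icc 0 1) s)
      (h0 : ∀ s ∈ Icc (0 : ℝ) 1, ψ' s ≤ 0) : ∀ s ∈ Icc (0 : ℝ) 1, ψ s ≤ ψ 0 := by
    intro s hs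
    have hmono : AntitoneOn ψ (Icc 0 1) := by
      refine antitoneOn_of_hasDerivWithinAt_nonpos (convex_Icc 0 1)
        (fun s hs => (h s hs).continuousWithinAt) (f' := ψ') (fun s hs => ?_) (fun s hs => ?_)
      · exact (h s (interior_subset hs)).mono interior_subset
      · exact h0 s (interior_subset hs)
    exact hmono (left_mem_Icc.2 zero_le_one) hs hs.1
  have k1 := key (fun s => φ' s - C * s) (fun s => φ'' s - C * 1)
    (fun s hs => (h2 s hs).sub ((hasDerivWithinAt_id s _).const_mul C))
    (fun s hs => by linarith [hC s hs])
  have k2 := key (fun s => φ s - s * φ' 0 - C / 2 * s ^ 2)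
    (fun s => φ' s - 1 * φ' 0 - C / 2 * ((2 : ℕ) * s ^ (2 - 1) * 1))
    (fun s hs => ((h1 s hs).sub ((hasDerivWithinAt_id s _).mul_const _)).sub
      (((hasDerivWithinAt_id s _).pow 2).const_mul _))
    (fun s hs => by have := k1 s hs; norm_num at this ⊢; linarith)
  have := k2 1 (right_mem_Icc.2 zero_le_one)
  norm_num at this
  linarith

variable {E G : Type*} [NormedAddCommGroup E] [NormedSpace ℝ E] [NormedAddCommGroup G]
  [NormedSpace ℝ G] {U D : Set E}

theorem hasDerivWithinAt_comp_segment {h : E → G} (hU : Convex ℝ U) (hd : DifferentiableOn ℝ h U)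
    {a b : E} (ha : a ∈ U) (hb : b ∈ U) {s : ℝ} (hs : s ∈ Icc (0 : ℝ) 1) :
    HasDerivWithinAt (fun s : ℝ => h (a + s • (b - a)))
      (fderivWithin ℝ h U (a + s • (b - a)) (b - a)) (Icc 0 1) s := by
  have hmem : ∀ s ∈ Icc (0 : ℝ) 1, a + s • (b - a) ∈ U := fun s hs =>
    hU.add_smul_sub_mem ha hb hs
  have h1 : HasDerivWithinAt (fun s : ℝ => a + s • (b - a)) (b - a) (Icc 0 1) s := by
    simpa using (((hasDerivAt_id s).smul_const (b - a)).const_add a).hasDerivWithinAt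
  exact (hd _ (hmem s hs)).hasFDerivWithinAt.comp_hasDerivWithinAt s h1 hmem

theorem differentiableOn_fderivWithin {h : E → G} (hU : UniqueDiffOn ℝ U)
    (hh : ContDiffOn ℝ 2 h U) : DifferentiableOn ℝ (fderivWithin ℝ h U) U :=
  (hh.fderivWithin hU (m := 1) (by norm_num)).differentiableOn (by norm_num)

theorem ContDiffOn.exists_lipschitzOnWith_of_isCompact {h : E → G} (hU : UniqueDiffOn ℝ U)
    (hh : ContDiffOn ℝ 1 h U) (hD : IsCompact D) (hDc : Convex ℝ D) (hDU : D ⊆ U) :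
    ∃ K, LipschitzOnWith K h D := by
  have hc : ContinuousOn (fderivWithin ℝ h U) U :=
    hh.continuousOn_fderivWithin hU (by norm_num)
  obtain ⟨C, hC⟩ := hD.exists_bound_of_continuousOn (hc.mono hDU)
  refine ⟨Real.toNNReal C, hDc.lipschitzOnWith_of_nnnorm_hasFDerivWithin_le
    (f' := fderivWithin ℝ h U) (fun z hz => ?_) fun z hz => ?_⟩
  · exact ((hh.differentiableOn (by norm_num)) z (hDU hz)).hasFDerivWithinAt.mono hDU
  · rw [← NNReal.coe_le_coe, coe_nnnorm]
    exact (hC z hz).trans (Real.le_coe_toNNReal C)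

/-- The second Taylor remainder of a scalar function along a segment is bounded above by any upper
bound of its Hessian. -/
theorem taylor_remainder_le {h : E → ℝ} (hU : Convex ℝ U) (hUd : UniqueDiffOn ℝ U)
    (hh : ContDiffOn ℝ 2 h U) (hDc : Convex ℝ D) (hDU : D ⊆ U) {a b : E} (ha : a ∈ D)
    (hb : b ∈ D) {C : ℝ} (hC : ∀ z ∈ D,
      fderivWithin ℝ (fderivWithin ℝ h U) U z (b - a) (b - a) ≤ C) :
    h b - h a - fderivWithin ℝ h U a (b - a) ≤ C / 2 := by
  have h2 := le_taylor_two_of_deriv_two_le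
    (fun s hs => hasDerivWithinAt_comp_segment hU (hh.differentiableOn (by norm_num)) (hDU ha)
      (hDU hb) hs)
    (fun s hs => (ContinuousLinearMap.apply ℝ ℝ (b - a)).hasFDerivAt.comp_hasDerivWithinAt s
      (hasDerivWithinAt_comp_segment hU (differentiableOn_fderivWithin hUd hh) (hDU ha)
      (hDU hb) hs))
    (fun s hs => hC _ (hDc.add_smul_sub_mem ha hb hs))
  simpa using h2

end Taylor

/-! ### Pointwise estimates on the state space -/

section StateSpace

variable {d : ℕ} {U D : Set (Vec d)} {f : Vec d → Vec d} {η q : Vec d → ℝ} {Cf Clo Chi : ℝ}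

/-- The entropy of `b` relative to `a`. -/
noncomputable def relEntropy (U : Set (Vec d)) (η : Vec d → ℝ) (b a : Vec d) : ℝ :=
  η b - η a - fderivWithin ℝ η U a (b - a)

theorem relEntropy_le (hU : Convex ℝ U) (hUd : UniqueDiffOn ℝ U) (hη : ContDiffOn ℝ 2 η U)
    (hDc : Convex ℝ D) (hDU : D ⊆ U) (hC : IsHessianBound U D f η Cf Clo Chi)
    {a b : Vec d} (ha : a ∈ D) (hb : b ∈ D) :
    relEntropy U η b a ≤ Chi / 2 * ‖b - a‖ ^ 2 := by
  have := taylor_remainder_le hU hUd hη hDc hDU ha hb fun z hz => hC.upper_bound z hz (b - a)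
  unfold relEntropy
  linarith

/-- The upper Taylor estimate applied to -η. -/
theorem le_relEntropy (hU : Convex ℝ U) (hUd : UniqueDiffOn ℝ U) (hη : ContDiffOn ℝ 2 η U)
    (hDc : Convex ℝ D) (hDU : D ⊆ U) (hC : IsHessianBound U D f η Cf Clo Chi)
    {a b : Vec d} (ha : a ∈ D) (hb : b ∈ D) :
    Clo / 2 * ‖b - a‖ ^ 2 ≤ relEntropy U η b a := by
  have h2 := le_taylor_two_of_deriv_two_le (C := -(Clo * ‖b - a‖ ^ 2))
    (fun s hs => (hasDerivWithinAt_comp_segment hU (hη.differentiableOn (by norm_num)) (hDU ha)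
      (hDU hb) hs).fun_neg)
    (fun s hs => ((ContinuousLinearMap.apply ℝ ℝ (b - a)).hasFDerivAt.comp_hasDerivWithinAt s
      (hasDerivWithinAt_comp_segment hU (differentiableOn_fderivWithin hUd hη) (hDU ha)
      (hDU hb) hs)).fun_neg)
    (fun s hs => neg_le_neg (hC.lower_bound _ (hDc.add_smul_sub_mem ha hb hs) _))
  simp only [one_smul, zero_smul, add_zero, add_sub_cancel] at h2
  unfold relEntropy
  linarith

/-- The remainder e is paired with itself: the scalar Taylor estimate for ⟨e, f⟩ gives ‖e‖² ≤
‖e‖·(Cf/2)‖b - a‖², and ‖e‖ cancels. No dimensional constant is lost in passing from scalars to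
vectors. -/
theorem norm_flux_remainder_le (hU : Convex ℝ U) (hUd : UniqueDiffOn ℝ U)
    (hf : ContDiffOn ℝ 2 f U)
    (hDc : Convex ℝ D) (hDU : D ⊆ U) (hC : IsHessianBound U D f η Cf Clo Chi)
    {a b : Vec d} (ha : a ∈ D) (hb : b ∈ D) :
    ‖f b - f a - fderivWithin ℝ f U a (b - a)‖ ≤ Cf / 2 * ‖b - a‖ ^ 2 := by
  set e := f b - f a - fderivWithin ℝ f U a (b - a) with he
  have hd1 : DifferentiableOn ℝ f U := hf.differentiableOn (by norm_num)
  have hd2 := differentiableOn_fderivWithin hUd hf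
  have h2 := le_taylor_two_of_deriv_two_le (C := ‖e‖ * (Cf * ‖b - a‖ ^ 2))
    (fun s hs => (innerSL ℝ e).hasFDerivAt.comp_hasDerivWithinAt s
      (hasDerivWithinAt_comp_segment hU hd1 (hDU ha) (hDU hb) hs))
    (fun s hs => (innerSL ℝ e ∘L ContinuousLinearMap.apply ℝ (Vec d)
      (b - a)).hasFDerivAt.comp_hasDerivWithinAt s
      (hasDerivWithinAt_comp_segment hU hd2 (hDU ha) (hDU hb) hs))
    (fun s hs => by
      refine (real_inner_le_norm e _).trans (mul_le_mul_of_nonneg_left ?_ (norm_nonneg e))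
      exact hC.flux_bound _ (hDc.add_smul_sub_mem ha hb hs) _)
  simp only [Function.comp, one_smul, zero_smul, add_zero, add_sub_cancel,
    innerSL_apply_apply, ← inner_sub_right, ← he, real_inner_self_eq_norm_sq] at h2
  rcases (norm_nonneg e).eq_or_lt with h0 | h0
  · rw [← h0]
    have := hC.flux_nonneg
    positivity
  · nlinarith

/-- Schwarz's theorem reaches boundary points because a convex set with nonempty interior lies in
the closure of its interior. -/
theorem fderivWithin_fderivWithin_symm {G : Type*} [NormedAddCommGroup G] [NormedSpace ℝ G]
    {h : Vec d → G} (hU : Convex ℝ U) (hU_int : (interior U).Nonempty)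
    (hh : ContDiffOn ℝ 2 h U) {z : Vec d} (hz : z ∈ U) (v w : Vec d) :
    fderivWithin ℝ (fderivWithin ℝ h U) U z v w = fderivWithin ℝ (fderivWithin ℝ h U) U z w v :=
  ((hh z hz).isSymmSndFDerivWithinAt (by simp) (uniqueDiffOn_convex hU hU_int)
    (hU.closure_interior_eq_closure_of_nonempty_interior hU_int ▸ subset_closure hz) hz) v w

/-- The Hessian of the entropy symmetrizes the Jacobian of the flux. -/
theorem IsEntropyPair.hessian_symmetrizes (hηq : IsEntropyPair U f η q) (hU : Convex ℝ U)
    (hU_int : (interior U).Nonempty) (hf : ContDiffOn ℝ 2 f U) {z : Vec d} (hz : z ∈ U)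
    (v w : Vec d) :
    fderivWithin ℝ (fderivWithin ℝ η U) U z (fderivWithin ℝ f U z v) w =
      fderivWithin ℝ (fderivWithin ℝ η U) U z v (fderivWithin ℝ f U z w) := by
  have hUd := uniqueDiffOn_convex hU hU_int
  have hη := hηq.contDiff_entropy
  have hη1 : ContDiffOn ℝ 1 (fderivWithin ℝ η U) U := hη.fderivWithin hUd (by norm_num)
  have hf1 : ContDiffOn ℝ 1 (fderivWithin ℝ f U) U := hf.fderivWithin hUd (by norm_num)
  -- The compatibility relation writes Dq as a product of C¹ maps, so q is in fact C² and D²q is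
  -- symmetric.
  have hq : ContDiffOn ℝ 2 q U := by
    rw [show (2 : WithTop ℕ∞) = 1 + 1 by norm_num, contDiffOn_succ_iff_fderivWithin hUd]
    exact ⟨hηq.contDiff_flux.differentiableOn (by norm_num), by simp,
      (hη1.clm_comp hf1).congr hηq.compat⟩
  have hsecond (v w : Vec d) : fderivWithin ℝ (fderivWithin ℝ q U) U z v w =
      fderivWithin ℝ η U z (fderivWithin ℝ (fderivWithin ℝ f U) U z v w) +
        fderivWithin ℝ (fderivWithin ℝ η U) U z v (fderivWithin ℝ f U z w) := by
    have h1 : HasFDerivWithinAt (fun z => (fderivWithin ℝ η U z).comp (fderivWithin ℝ f U z)) _ U z :=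
      ((hη1.differentiableOn (by norm_num)) z hz).hasFDerivWithinAt.clm_comp
        ((hf1.differentiableOn (by norm_num)) z hz).hasFDerivWithinAt
    rw [fderivWithin_congr hηq.compat (hηq.compat z hz), h1.fderivWithin (hUd z hz)]
    simp
  -- In D²q(v,w) = Dη D²f(v,w) + D²η(v, Df w) the left side and the first term on the right are
  -- symmetric; hence so is the last term.
  have h1 := fderivWithin_fderivWithin_symm hU hU_int hq hz v w
  rw [hsecond, hsecond, fderivWithin_fderivWithin_symm hU hU_int hf hz v w] at h1
  rw [fderivWithin_fderivWithin_symm hU hU_int hη hz _ w]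
  linarith

/-- Cauchy–Schwarz for the positive semidefinite form H: the discriminant of s ↦ H(v + sw, v + sw)
is nonpositive. This turns the bound on the diagonal into a bilinear bound with the same constant.
-/
theorem abs_hessian_le (hU : Convex ℝ U) (hU_int : (interior U).Nonempty)
    (hη : ContDiffOn ℝ 2 η U) (hDU : D ⊆ U) (hC : IsHessianBound U D f η Cf Clo Chi)
    {z : Vec d} (hz : z ∈ D) (v w : Vec d) :
    |fderivWithin ℝ (fderivWithin ℝ η U) U z v w| ≤ Chi * ‖v‖ * ‖w‖ := by
  set H := fderivWithin ℝ (fderivWithin ℝ η U) U z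
  have hsymm : H v w = H w v := fderivWithin_fderivWithin_symm hU hU_int hη (hDU hz) v w
  have hpos (y : Vec d) : 0 ≤ H y y :=
    (mul_nonneg hC.lower_pos.le (sq_nonneg _)).trans (hC.lower_bound z hz y)
  have hcs : H v w ^ 2 ≤ H v v * H w w := by
    have h1 (s : ℝ) : 0 ≤ H w w * (s * s) + 2 * H v w * s + H v v := by
      have := hpos (v + s • w)
      simp only [map_add, map_smul, add_apply,
        smul_apply, smul_eq_mul, ← hsymm] at this
      linarith
    have := discrim_le_zero h1
    unfold discrim at this
    linarith
  have hv := hC.upper_bound z hz v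
  have hw := hC.upper_bound z hz w
  have hChi : 0 ≤ Chi := hC.lower_pos.le.trans hC.lower_le_upper
  refine abs_le_of_sq_le_sq ?_ (by positivity)
  calc H v w ^ 2 ≤ H v v * H w w := hcs
    _ ≤ (Chi * ‖v‖ ^ 2) * (Chi * ‖w‖ ^ 2) := mul_le_mul hv hw (hpos w) (by positivity)
    _ = (Chi * ‖v‖ * ‖w‖) ^ 2 := by ring

end StateSpace

/-! ### Integrals of derivatives of Lipschitz functions on the cylinder -/

section LipschitzCalculus

open Filter
open scoped NNReal Topology

theorem LipschitzWith.integral_deriv_eq_sub {φ : ℝ → ℝ} {K : ℝ≥0} (h : LipschitzWith K φ)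
    (a b : ℝ) : ∫ x in a..b, deriv φ x = φ b - φ a :=
  (h.lipschitzOnWith (s := uIcc a b)).absolutelyContinuousOnInterval.integral_deriv_eq_sub

theorem LipschitzWith.comp_prodMk_left {G : Type*} [PseudoEMetricSpace G] {Ψ : ℝ × ℝ → G} {K : ℝ≥0}
    (h : LipschitzWith K Ψ) (x : ℝ) : LipschitzWith K fun t => Ψ (x, t) := by
  simpa [Function.comp_def] using h.comp (LipschitzWith.prodMk_left x)

theorem LipschitzWith.comp_prodMk_right {G : Type*} [PseudoEMetricSpace G] {Ψ : ℝ × ℝ → G} {K : ℝ≥0}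
    (h : LipschitzWith K Ψ) (t : ℝ) : LipschitzWith K fun x => Ψ (x, t) := by
  simpa [Function.comp_def] using h.comp (LipschitzWith.prodMk_right t)

theorem integrable_cyl_fderiv {Ψ : ℝ × ℝ → ℝ} {K : ℝ≥0} (h : LipschitzWith K Ψ) {b : ℝ}
    (hb : ∀ x t, b ≤ t → Ψ (x, t) = 0) (v : ℝ × ℝ) :
    Integrable (fun z => fderiv ℝ Ψ z v) cylMeasure := by
  refine integrable_cyl_of_bound (C := K * ‖v‖) (b := b + 1)
    (measurable_fderiv_apply_const ℝ Ψ v).aestronglyMeasurable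
    (Eventually.of_forall fun z => ?_) fun x t ht => ?_
  · exact ((fderiv ℝ Ψ z).le_opNorm v).trans
      (mul_le_mul_of_nonneg_right (norm_fderiv_le_of_lipschitz ℝ h) (norm_nonneg v))
  · simp [fderiv_eq_zero_of_le hb x t ht]

/-- Fubini and the fundamental theorem of calculus on each line x = const; only the boundary value
at t = 0 survives. -/
theorem integral_cyl_fderiv_snd {Ψ : ℝ × ℝ → ℝ} {K : ℝ≥0} (h : LipschitzWith K Ψ) {b : ℝ}
    (hb : ∀ x t, b ≤ t → Ψ (x, t) = 0) :
    ∫ z, fderiv ℝ Ψ z (0, 1) ∂cylMeasure = -∫ x in Ioo (0 : ℝ) 1, Ψ (x, 0) := by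
  rw [integral_prod _ (integrable_cyl_fderiv h hb _), ← integral_neg]
  refine integral_congr_ae ?_
  have hd : ∀ᵐ z ∂cylMeasure, DifferentiableAt ℝ Ψ z :=
    cylMeasure_absolutelyContinuous.ae_le h.ae_differentiableAt
  filter_upwards [Measure.ae_ae_of_ae_prod hd] with x hx
  have h1 : ∫ t in Ioi (0 : ℝ), fderiv ℝ Ψ (x, t) (0, 1) =
      ∫ t in Ioi (0 : ℝ), deriv (fun s => Ψ (x, s)) t :=
    integral_congr_ae (hx.mono fun t ht => ht.hasFDerivAt.hasDerivAt_snd.deriv.symm)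
  set B := max (b + 1) 0
  have hsub : Ioc 0 B ⊆ Ioi (0 : ℝ) := fun t ht => ht.1
  rw [h1, setIntegral_eq_of_subset_of_forall_sdiff_eq_zero measurableSet_Ioi hsub,
    ← intervalIntegral.integral_of_le (le_max_right _ _),
    (h.comp_prodMk_left x).integral_deriv_eq_sub,
    hb x B ((by linarith : b ≤ b + 1).trans (le_max_left _ _)), zero_sub]
  intro t ht
  have htB : B < t := by
    by_contra hcon
    exact ht.2 ⟨ht.1, not_lt.1 hcon⟩
  have : (fun s => Ψ (x, s)) =ᶠ[𝓝 t] fun _ => 0 := by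
    filter_upwards [lt_mem_nhds htB] with s hs
    exact hb x s (by linarith [le_max_left (b + 1) 0])
  rw [this.deriv_eq]; simp

theorem ae_ae_of_ae_cylMeasure {P : ℝ × ℝ → Prop} (h : ∀ᵐ z ∂cylMeasure, P z) :
    ∀ᵐ t ∂(volume.restrict (Ioi (0 : ℝ))), ∀ᵐ x ∂(volume.restrict (Ioo (0 : ℝ) 1)), P (x, t) := by
  have h' : ∀ᵐ z ∂((volume.restrict (Ioi (0 : ℝ))).prod (volume.restrict (Ioo (0 : ℝ) 1))),
      P z.swap := by
    refine ae_of_ae_map measurable_swap.aemeasurable ?_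
    rwa [Measure.prod_swap]
  exact Measure.ae_ae_of_ae_prod h'

theorem integral_cyl_fderiv_fst {Ψ : ℝ × ℝ → ℝ} {K : ℝ≥0} (h : LipschitzWith K Ψ) {b : ℝ}
    (hb : ∀ x t, b ≤ t → Ψ (x, t) = 0) (hper : ∀ x t, Ψ (x + 1, t) = Ψ (x, t)) :
    ∫ z, fderiv ℝ Ψ z (1, 0) ∂cylMeasure = 0 := by
  rw [integral_prod_symm _ (integrable_cyl_fderiv h hb _)]
  refine integral_eq_zero_of_ae ?_
  have hd : ∀ᵐ z ∂cylMeasure, DifferentiableAt ℝ Ψ z :=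
    cylMeasure_absolutelyContinuous.ae_le h.ae_differentiableAt
  filter_upwards [ae_ae_of_ae_cylMeasure hd] with t ht
  have h1 : ∫ x in Ioo (0 : ℝ) 1, fderiv ℝ Ψ (x, t) (1, 0) =
      ∫ x in Ioo (0 : ℝ) 1, deriv (fun y => Ψ (y, t)) x :=
    integral_congr_ae (ht.mono fun x hx => hx.hasFDerivAt.hasDerivAt_fst.deriv.symm)
  rw [h1, ← integral_Ioc_eq_integral_Ioo, ← intervalIntegral.integral_of_le zero_le_one,
    (h.comp_prodMk_right t).integral_deriv_eq_sub]
  have := hper 0 t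
  rw [zero_add] at this
  simp [this]

theorem LipschitzWith.smul_of_bounded {α G : Type*} [PseudoMetricSpace α] [NormedAddCommGroup G]
    [NormedSpace ℝ G] {θ : α → ℝ} {ψ : α → G} {K₁ K₂ C₁ C₂ : ℝ≥0} (h₁ : LipschitzWith K₁ θ)
    (h₂ : LipschitzWith K₂ ψ) (hC₁ : ∀ a, ‖θ a‖ ≤ C₁) (hC₂ : ∀ a, ‖ψ a‖ ≤ C₂) :
    LipschitzWith (C₁ * K₂ + K₁ * C₂) fun a => θ a • ψ a := by
  refine LipschitzWith.of_dist_le_mul fun a b => ?_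
  have e : θ a • ψ a - θ b • ψ b = θ a • (ψ a - ψ b) + (θ a - θ b) • ψ b := by
    rw [smul_sub, sub_smul]; abel
  rw [dist_eq_norm, e]
  refine (norm_add_le _ _).trans ?_
  rw [norm_smul, norm_smul, ← dist_eq_norm, ← dist_eq_norm]
  have h1 := mul_le_mul (hC₁ a) (h₂.dist_le_mul a b) dist_nonneg C₁.2
  have h2 := mul_le_mul (h₁.dist_le_mul a b) (hC₂ b) (norm_nonneg _) (by positivity)
  refine (add_le_add h1 h2).trans (le_of_eq ?_)
  push_cast
  ring

theorem LipschitzOnWith.comp_lipschitzWith {α β γ : Type*} [PseudoEMetricSpace α]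
    [PseudoEMetricSpace β] [PseudoEMetricSpace γ] {h : β → γ} {g : α → β} {D : Set β} {K Kg : ℝ≥0}
    (hh : LipschitzOnWith K h D) (hg : LipschitzWith Kg g) (hgD : ∀ z, g z ∈ D) :
    LipschitzWith (K * Kg) fun z => h (g z) := by
  rw [← lipschitzOnWith_univ] at hg ⊢
  exact hh.comp hg fun z _ => hgD z

/-- Lipschitz functions composed with a map into a compact set are bounded. -/
theorem IsCompact.exists_nnreal_norm_comp_le {α β G : Type*} [TopologicalSpace β]
    [NormedAddCommGroup G] {D : Set β} (hD : IsCompact D) {h : β → G} (hh : ContinuousOn h D)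
    {g : α → β} (hgD : ∀ z, g z ∈ D) : ∃ C : ℝ≥0, ∀ z, ‖h (g z)‖ ≤ C := by
  obtain ⟨C, hC⟩ := hD.exists_bound_of_continuousOn hh
  exact ⟨C.toNNReal, fun z => (hC _ (hgD z)).trans (Real.le_coe_toNNReal C)⟩

end LipschitzCalculus

/-! ### The relative entropy balance -/

section RelativeEntropy

open Filter
open scoped NNReal Topology

variable {d : ℕ} {U D : Set (Vec d)} {f : Vec d → Vec d} {η q : Vec d → ℝ} {u₀ : ℝ → Vec d}
  {u : ℝ → ℝ → Vec d} {g : ℝ × ℝ → Vec d} {Kg : ℝ≥0}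

/-- The production of relative entropy of a solution `u` with respect to a Lipschitz field `g`. -/
noncomputable def relEntropyProduction (U : Set (Vec d)) (f : Vec d → Vec d) (η : Vec d → ℝ)
    (u : ℝ → ℝ → Vec d) (g : ℝ × ℝ → Vec d) (z : ℝ × ℝ) : ℝ :=
  -fderivWithin ℝ (fderivWithin ℝ η U) U (g z) (fderiv ℝ g z (0, 1)) (u z.1 z.2 - g z)
    - fderivWithin ℝ (fderivWithin ℝ η U) U (g z) (fderiv ℝ g z (1, 0)) (f (u z.1 z.2) - f (g z))

theorem integral_sub_sub {α : Type*} [MeasurableSpace α] {μ : Measure α} {a b c : α → ℝ}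
    (ha : Integrable a μ) (hb : Integrable b μ) (hc : Integrable c μ) :
    ∫ z, (a z - b z - c z) ∂μ = ∫ z, a z ∂μ - ∫ z, b z ∂μ - ∫ z, c z ∂μ := by
  rw [← integral_sub ha hb, ← integral_sub (f := fun z => a z - b z) (ha.sub hb) hc]

theorem integral_sub_sub_sub {α : Type*} [MeasurableSpace α] {μ : Measure α} {a b c e : α → ℝ}
    (ha : Integrable a μ) (hb : Integrable b μ) (hc : Integrable c μ) (he : Integrable e μ) :
    ∫ z, (a z - b z - c z - e z) ∂μ =
      ∫ z, a z ∂μ - ∫ z, b z ∂μ - ∫ z, c z ∂μ - ∫ z, e z ∂μ := by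
  rw [← integral_sub_sub ha hb hc,
    ← integral_sub (f := fun z => a z - b z - c z) ((ha.sub hb).sub hc) he]

theorem hasFDerivAt_comp_of_differentiableOn {G : Type*} [NormedAddCommGroup G] [NormedSpace ℝ G]
    {h : Vec d → G} (hh : DifferentiableOn ℝ h U) (hgU : ∀ z, g z ∈ U) {z : ℝ × ℝ}
    (hg : DifferentiableAt ℝ g z) : HasFDerivAt (fun z => h (g z))
      ((fderivWithin ℝ h U (g z)).comp (fderiv ℝ g z)) z :=
  (hh _ (hgU z)).hasFDerivWithinAt.comp_hasFDerivAt z hg.hasFDerivAt (Eventually.of_forall hgU)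

/-- The gradient of the entropy. -/
noncomputable def entropyGrad (U : Set (Vec d)) (η : Vec d → ℝ) (y : Vec d) : Vec d :=
  (InnerProductSpace.toDual ℝ (Vec d)).symm (fderivWithin ℝ η U y)

theorem inner_entropyGrad (v y : Vec d) :
    inner ℝ v (entropyGrad U η y) = fderivWithin ℝ η U y v := by
  rw [real_inner_comm, entropyGrad, InnerProductSpace.toDual_symm_apply]

/-- With ψ₀ = η - Dη·id, the relative entropy is η(u) - u·∇η(g) - ψ₀(g). The entropy inequality
handles the first term, the weak formulation with test function θ∇η(g) the second, and the
fundamental theorem of calculus the third. The exact derivative ∂ₓ(θχ₀(g)) with χ₀ = q - Dη·f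
integrates to zero by periodicity and supplies the term D²η(g)(∂ₓg, f(g)). -/
theorem relEntropy_balance (hU : Convex ℝ U) (hU_int : (interior U).Nonempty)
    (hD : IsCompact D) (hDc : Convex ℝ D) (hDU : D ⊆ U) (hf : ContDiffOn ℝ 2 f U)
    (hηq : IsEntropyPair U f η q) (hu : IsEntropySolution U f η q u₀ u)
    (huD : ∀ᵐ z ∂cylMeasure, u z.1 z.2 ∈ D)
    (hu₀D : ∀ᵐ x ∂(volume.restrict (Ioo (0 : ℝ) 1)), u₀ x ∈ D)
    (hg : LipschitzWith Kg g) (hgD : ∀ z, g z ∈ D) (hper : ∀ x t, g (x + 1, t) = g (x, t))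
    {θ : ℝ → ℝ} {Kθ : ℝ≥0} (hθ : LipschitzWith Kθ θ) (hθ0 : ∀ t, 0 ≤ θ t) (hθ1 : ∀ t, θ t ≤ 1)
    {b : ℝ} (hb : ∀ t, b ≤ t → θ t = 0) :
    0 ≤ (∫ z, (deriv θ z.2 * relEntropy U η (u z.1 z.2) (g z)
        + θ z.2 * relEntropyProduction U f η u g z) ∂cylMeasure)
      + θ 0 * ∫ x in Ioo (0 : ℝ) 1, relEntropy U η (u₀ x) (g (x, 0)) := by
  have hUd := uniqueDiffOn_convex hU hU_int
  have hη := hηq.contDiff_entropy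
  have hη1 : ContDiffOn ℝ 1 (fderivWithin ℝ η U) U := hη.fderivWithin hUd (by norm_num)
  have hf1 : ContDiffOn ℝ 1 f U := hf.of_le (by norm_num)
  have hη0 : ContDiffOn ℝ 1 η U := hη.of_le (by norm_num)
  have hq1 := hηq.contDiff_flux
  have hgU : ∀ z, g z ∈ U := fun z => hDU (hgD z)
  set Θ : ℝ × ℝ → ℝ := fun z => θ z.2 with hΘdef
  have hΘ : LipschitzWith Kθ Θ := by
    simpa [Function.comp_def] using hθ.comp (LipschitzWith.prod_snd (α := ℝ) (β := ℝ))
  have hΘ1 : ∀ z, ‖Θ z‖ ≤ (1 : ℝ≥0) := fun z => by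
    rw [Real.norm_of_nonneg (hθ0 _)]; exact hθ1 _
  have hΘb : ∀ x t, b ≤ t → Θ (x, t) = 0 := fun x t ht => hb t ht
  -- the three Lipschitz test objects built from `g`
  have hgrad1 : ContDiffOn ℝ 1 (entropyGrad U η) U :=
    ((InnerProductSpace.toDual ℝ (Vec d)).symm.toContinuousLinearEquiv.contDiff.comp_contDiffOn
      hη1)
  set ψ₀ : Vec d → ℝ := fun y => η y - fderivWithin ℝ η U y y with hψ₀
  have hψ₀1 : ContDiffOn ℝ 1 ψ₀ U := hη0.sub (hη1.clm_apply contDiffOn_id)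
  set χ₀ : Vec d → ℝ := fun y => q y - fderivWithin ℝ η U y (f y) with hχ₀
  have hχ₀1 : ContDiffOn ℝ 1 χ₀ U := hq1.sub (hη1.clm_apply hf1)
  have hlip {G : Type} [NormedAddCommGroup G] [NormedSpace ℝ G] {h : Vec d → G}
      (hh : ContDiffOn ℝ 1 h U) : ∃ K, LipschitzWith K fun z => Θ z • h (g z) := by
    obtain ⟨K, hK⟩ := hh.exists_lipschitzOnWith_of_isCompact hUd hD hDc hDU
    obtain ⟨C, hC⟩ := hD.exists_nnreal_norm_comp_le (hh.continuousOn.mono hDU) hgD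
    exact ⟨_, hΘ.smul_of_bounded (hK.comp_lipschitzWith hg hgD) hΘ1 hC⟩
  obtain ⟨KΦ, hΦ⟩ := hlip hgrad1
  obtain ⟨Kψ, hψ⟩ := hlip hψ₀1
  obtain ⟨Kχ, hχ⟩ := hlip hχ₀1
  have hzero {G : Type} [NormedAddCommGroup G] [NormedSpace ℝ G] {h : Vec d → G} :
      ∀ x t, b ≤ t → Θ (x, t) • h (g (x, t)) = 0 := fun x t ht => by rw [hΘb x t ht, zero_smul]
  have hperiodic {G : Type} [NormedAddCommGroup G] [NormedSpace ℝ G] {h : Vec d → G} :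
      ∀ x t, Θ (x + 1, t) • h (g (x + 1, t)) = Θ (x, t) • h (g (x, t)) := fun x t => by
    rw [hper]
  have hJ1 := hu.pairing_entropy_nonneg hD (hη0.continuousOn.mono hDU) (hq1.continuousOn.mono hDU)
    huD hu₀D hΘ (fun z => hθ0 z.2) hΘb (fun x t => rfl)
  have hJ2 := hu.pairing_eq_zero hD (hf1.continuousOn.mono hDU) huD hΦ hzero hperiodic
  have hJ3 := integral_cyl_fderiv_snd hψ hzero
  have hJ4 := integral_cyl_fderiv_fst hχ hzero hperiodic
  -- integrability on the cylinder
  have hm := hu.aestronglyMeasurable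
  have hmeas {G : Type} [NormedAddCommGroup G] [SecondCountableTopology G]
      {h : Vec d → G} (hh : ContinuousOn h U) :=
    aestronglyMeasurable_comp_of_continuousOn hm (hh.mono hDU) hD.isClosed huD
  obtain ⟨Cη, hCη⟩ := hD.exists_bound_of_continuousOn (hη0.continuousOn.mono hDU)
  obtain ⟨Cq, hCq⟩ := hD.exists_bound_of_continuousOn (hq1.continuousOn.mono hDU)
  obtain ⟨Cf, hCf⟩ := hD.exists_bound_of_continuousOn (hf1.continuousOn.mono hDU)
  obtain ⟨Ci, hCi⟩ := hD.exists_bound_of_continuousOn (f := id) continuousOn_id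
  have hi1 := integrable_pairing_integrand (hmeas hη0.continuousOn) (hmeas hq1.continuousOn)
    (ae_norm_comp_le hCη huD) (ae_norm_comp_le hCq huD) hΘ hΘb
  have hi2 := integrable_pairing_integrand hm (hmeas hf1.continuousOn)
    (ae_norm_comp_le hCi huD) (ae_norm_comp_le hCf huD) hΦ hzero
  have hi3 := integrable_cyl_fderiv hψ hzero (0, 1)
  have hi4 := integrable_cyl_fderiv hχ hzero (1, 0)
  -- integrability of the initial values
  have hgc : Continuous fun x : ℝ => g (x, 0) := hg.continuous.comp (by fun_prop)
  have hk1 : Integrable (fun x => η (u₀ x)) (volume.restrict (Ioo (0 : ℝ) 1)) :=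
    Integrable.of_bound (aestronglyMeasurable_comp_of_continuousOn hu.memLp_init.1
      (hη0.continuousOn.mono hDU) hD.isClosed hu₀D) Cη (ae_norm_comp_le hCη hu₀D)
  have hcont {G : Type} [NormedAddCommGroup G] {h : Vec d → G} (hh : ContinuousOn h U) :
      Continuous fun x : ℝ => h (g (x, 0)) :=
    hh.comp_continuous hgc fun x => hgU _
  have hk2 : Integrable (fun x => inner ℝ (u₀ x) (entropyGrad U η (g (x, 0))))
      (volume.restrict (Ioo (0 : ℝ) 1)) := by
    obtain ⟨C, hC⟩ := hD.exists_nnreal_norm_comp_le (hgrad1.continuousOn.mono hDU) hgD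
    refine Integrable.of_bound (hu.memLp_init.1.inner
      (hcont hgrad1.continuousOn).aestronglyMeasurable) (Ci * C) ?_
    filter_upwards [ae_norm_comp_le hCi hu₀D] with x hx
    exact (norm_inner_le_norm _ _).trans
      (mul_le_mul hx (hC _) (norm_nonneg _) ((norm_nonneg _).trans hx))
  have hk3 : Integrable (fun x => ψ₀ (g (x, 0))) (volume.restrict (Ioo (0 : ℝ) 1)) := by
    obtain ⟨C, hC⟩ := hD.exists_nnreal_norm_comp_le (hψ₀1.continuousOn.mono hDU) hgD
    exact Integrable.of_bound (hcont hψ₀1.continuousOn).aestronglyMeasurable C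
      (Eventually.of_forall fun x => hC _)
  have hrel0 : θ 0 * ∫ x in Ioo (0 : ℝ) 1, relEntropy U η (u₀ x) (g (x, 0)) =
      (∫ x in Ioo (0 : ℝ) 1, inner ℝ (η (u₀ x)) (Θ (x, 0)))
      - (∫ x in Ioo (0 : ℝ) 1, inner ℝ (u₀ x) (Θ (x, 0) • entropyGrad U η (g (x, 0))))
      - ∫ x in Ioo (0 : ℝ) 1, Θ (x, 0) • ψ₀ (g (x, 0)) := by
    have e1 : ∀ x, relEntropy U η (u₀ x) (g (x, 0)) = η (u₀ x)
        - inner ℝ (u₀ x) (entropyGrad U η (g (x, 0))) - ψ₀ (g (x, 0)) := fun x => by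
      rw [inner_entropyGrad, relEntropy, map_sub, hψ₀]; ring
    simp only [e1]
    rw [integral_sub_sub hk1 hk2 hk3]
    simp only [hΘdef, inner_smul_right, smul_eq_mul, integral_const_mul,
      RCLike.inner_apply, conj_trivial]
    ring
  have hΘd : ∀ᵐ z ∂cylMeasure, DifferentiableAt ℝ Θ z :=
    cylMeasure_absolutelyContinuous.ae_le hΘ.ae_differentiableAt
  have hgd : ∀ᵐ z ∂cylMeasure, DifferentiableAt ℝ g z :=
    cylMeasure_absolutelyContinuous.ae_le hg.ae_differentiableAt
  have hint : ∫ z, (deriv θ z.2 * relEntropy U η (u z.1 z.2) (g z)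
        + θ z.2 * relEntropyProduction U f η u g z) ∂cylMeasure =
      (∫ z, (inner ℝ (η (u z.1 z.2)) (fderiv ℝ Θ z (0, 1))
        + inner ℝ (q (u z.1 z.2)) (fderiv ℝ Θ z (1, 0))) ∂cylMeasure)
      - (∫ z, (inner ℝ (u z.1 z.2) (fderiv ℝ (fun z => Θ z • entropyGrad U η (g z)) z (0, 1))
        + inner ℝ (f (u z.1 z.2)) (fderiv ℝ (fun z => Θ z • entropyGrad U η (g z)) z (1, 0)))
        ∂cylMeasure)
      - (∫ z, fderiv ℝ (fun z => Θ z • ψ₀ (g z)) z (0, 1) ∂cylMeasure)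
      - ∫ z, fderiv ℝ (fun z => Θ z • χ₀ (g z)) z (1, 0) ∂cylMeasure := by
    rw [← integral_sub_sub_sub hi1 hi2 hi3 hi4]
    refine integral_congr_ae ?_
    filter_upwards [hΘd, hgd] with z hz1 hz2
    have hθd : HasDerivAt θ (fderiv ℝ Θ z (0, 1)) z.2 := hz1.hasFDerivAt.hasDerivAt_snd
    have hθx : fderiv ℝ Θ z (1, 0) = 0 :=
      (hz1.hasFDerivAt.hasDerivAt_fst (x := z.1) (t := z.2)).unique (hasDerivAt_const z.1 (θ z.2))
    have hDη := hasFDerivAt_comp_of_differentiableOn (hη1.differentiableOn (by norm_num)) hgU hz2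
    have hdη := hasFDerivAt_comp_of_differentiableOn (hη0.differentiableOn (by norm_num)) hgU hz2
    have hdf := hasFDerivAt_comp_of_differentiableOn (hf1.differentiableOn (by norm_num)) hgU hz2
    have hdq := hasFDerivAt_comp_of_differentiableOn (hq1.differentiableOn (by norm_num)) hgU hz2
    have hgr : HasFDerivAt (fun z => entropyGrad U η (g z)) _ z :=
      (InnerProductSpace.toDual ℝ (Vec d)).symm.toContinuousLinearEquiv.hasFDerivAt.comp z hDη
    have hψd : HasFDerivAt (fun z => ψ₀ (g z)) _ z := hdη.sub (hDη.clm_apply hz2.hasFDerivAt)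
    have hχd : HasFDerivAt (fun z => χ₀ (g z)) _ z := hdq.sub (hDη.clm_apply hdf)
    rw [(hz1.hasFDerivAt.fun_smul hgr).fderiv, (hz1.hasFDerivAt.fun_smul hψd).fderiv,
      (hz1.hasFDerivAt.fun_smul hχd).fderiv, hθd.deriv]
    have hinn (v : Vec d) (l : Vec d →L[ℝ] ℝ) :
        inner ℝ v ((InnerProductSpace.toDual ℝ (Vec d)).symm l) = l v := by
      rw [real_inner_comm, InnerProductSpace.toDual_symm_apply]
    simp only [hθx, inner_zero_right, inner_add_right, inner_smul_right,
      add_apply, smul_apply, ContinuousLinearMap.smulRight_apply, ContinuousLinearMap.comp_apply,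
      smul_eq_mul, zero_smul, sub_apply, ContinuousLinearMap.flip_apply]
    rw [inner_entropyGrad]
    erw [hinn, hinn]
    -- Compatibility cancels Dq against Dη Df in the derivative of χ₀(g), so only the Hessian term
    -- remains.
    rw [hηq.compat _ (hgU z), ContinuousLinearMap.comp_apply, relEntropy,
      relEntropyProduction]
    simp only [hψ₀, hΘdef, map_sub, RCLike.inner_apply, conj_trivial]
    ring
  unfold pairing at hJ1 hJ2
  rw [hint, hrel0]
  linarith

end RelativeEntropy

/-! ### Grönwall's inequality almost everywhere -/

section Gronwall

open Filter
open scoped NNReal Topology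

theorem lipschitzOnWith_intervalIntegral_of_bound {k : ℝ → ℝ} {C : ℝ≥0} {τ : ℝ}
    (hk : IntervalIntegrable k volume 0 τ) (hC : ∀ᵐ t, ‖k t‖ ≤ C) :
    LipschitzOnWith C (fun t => ∫ s in (0 : ℝ)..t, k s) (uIcc 0 τ) := by
  have hi {t : ℝ} (ht : t ∈ uIcc 0 τ) : IntervalIntegrable k volume 0 t :=
    hk.mono_set (uIcc_subset_uIcc left_mem_uIcc ht)
  refine LipschitzOnWith.of_dist_le_mul fun s hs t ht => ?_
  rw [Real.dist_eq, intervalIntegral.integral_interval_sub_left (hi hs) (hi ht), Real.dist_eq]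
  exact intervalIntegral.norm_integral_le_of_norm_le_const_ae (hC.mono fun x hx _ => hx)

/-- Grönwall's inequality for an integral inequality that holds almost everywhere. -/
theorem gronwall_of_ae_le {y β : ℝ → ℝ} {A τ : ℝ} {Cy Cβ : ℝ} (hτ : 0 ≤ τ)
    (hym : AEStronglyMeasurable y (volume.restrict (Ioo 0 τ)))
    (hβm : AEStronglyMeasurable β (volume.restrict (Ioo 0 τ)))
    (hy : ∀ᵐ t ∂(volume.restrict (Ioo 0 τ)), ‖y t‖ ≤ Cy)
    (hβ : ∀ᵐ t ∂(volume.restrict (Ioo 0 τ)), ‖β t‖ ≤ Cβ)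
    (hβ0 : ∀ᵐ t ∂(volume.restrict (Ioo 0 τ)), 0 ≤ β t)
    (h : ∀ᵐ t ∂(volume.restrict (Ioo 0 τ)), y t ≤ A + ∫ s in Ioo 0 t, β s * y s) :
    A + ∫ s in Ioo 0 τ, β s * y s ≤ A * Real.exp (∫ s in Ioo 0 τ, β s) := by
  set b : ℝ → ℝ := (Ioo 0 τ).indicator β with hb
  set k : ℝ → ℝ := (Ioo 0 τ).indicator fun t => β t * y t with hk
  have hfin : volume (Ioo 0 τ) ≠ ⊤ := by simp
  have hbI : Integrable b := by
    rw [hb, integrable_indicator_iff measurableSet_Ioo]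
    exact IntegrableOn.of_bound (by simp) hβm Cβ hβ
  have hβy : ∀ᵐ t ∂(volume.restrict (Ioo 0 τ)), ‖β t * y t‖ ≤ Cβ * Cy := by
    filter_upwards [hy, hβ] with t h1 h2
    rw [norm_mul]
    exact mul_le_mul h2 h1 (norm_nonneg _) ((norm_nonneg _).trans h2)
  have hkI : Integrable k := by
    rw [hk, integrable_indicator_iff measurableSet_Ioo]
    exact IntegrableOn.of_bound (by simp) (hβm.mul hym) _ hβy
  have hbound {v : ℝ → ℝ} {C : ℝ} (hv : ∀ᵐ t ∂(volume.restrict (Ioo 0 τ)), ‖v t‖ ≤ C) :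
      ∀ᵐ t, ‖(Ioo 0 τ).indicator v t‖ ≤ C.toNNReal := by
    filter_upwards [(ae_restrict_iff' measurableSet_Ioo).1 hv] with t ht
    by_cases hm : t ∈ Ioo 0 τ
    · rw [indicator_of_mem hm]; exact (ht hm).trans (Real.le_coe_toNNReal C)
    · rw [indicator_of_notMem hm, norm_zero]; exact NNReal.coe_nonneg _
  have hint {v : ℝ → ℝ} {t : ℝ} (ht : t ∈ Icc 0 τ) :
      ∫ s in (0 : ℝ)..t, (Ioo 0 τ).indicator v s = ∫ s in Ioo 0 t, v s := by
    rw [intervalIntegral.integral_of_le ht.1, integral_Ioc_eq_integral_Ioo]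
    exact setIntegral_congr_fun measurableSet_Ioo fun s hs =>
      indicator_of_mem (show s ∈ Ioo 0 τ from ⟨hs.1, hs.2.trans_le ht.2⟩) _
  -- Y is the right-hand side of the integral inequality. Unlike y it is Lipschitz, and the
  -- conclusion bounds Y(τ).
  set Y : ℝ → ℝ := fun t => A + ∫ s in (0 : ℝ)..t, k s with hY
  set W : ℝ → ℝ := fun t => ∫ s in (0 : ℝ)..t, b s with hW
  have hYl : LipschitzOnWith (0 + (Cβ * Cy).toNNReal) Y (uIcc 0 τ) :=
    (LipschitzWith.const A).lipschitzOnWith.add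
      (lipschitzOnWith_intervalIntegral_of_bound hkI.intervalIntegrable (hbound hβy))
  have hWl : LipschitzOnWith Cβ.toNNReal W (uIcc 0 τ) :=
    lipschitzOnWith_intervalIntegral_of_bound hbI.intervalIntegrable (hbound hβ)
  -- W ≥ 0 because β ≥ 0, so -W stays in the half-line where the exponential is 1-Lipschitz.
  have hexp : LipschitzOnWith 1 Real.exp (Iic 0) := by
    refine (convex_Iic 0).lipschitzOnWith_of_nnnorm_deriv_le
      (fun x _ => Real.differentiableAt_exp) fun x hx => ?_
    rw [Real.deriv_exp, ← NNReal.coe_le_coe, coe_nnnorm, Real.norm_of_nonneg (Real.exp_pos x).le]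
    exact Real.exp_le_one_iff.2 hx
  have hb0 : ∀ᵐ t, 0 ≤ b t := by
    filter_upwards [(ae_restrict_iff' measurableSet_Ioo).1 hβ0] with t ht
    exact indicator_apply_nonneg ht
  have hWneg : MapsTo (fun t => -W t) (uIcc 0 τ) (Iic 0) := fun t ht => by
    rw [uIcc_of_le hτ] at ht
    simp only [mem_Iic, Left.neg_nonpos_iff]
    exact intervalIntegral.integral_nonneg_of_ae ht.1 hb0
  have hElip : LipschitzOnWith (1 * Cβ.toNNReal) (fun t => Real.exp (-W t)) (uIcc 0 τ) :=
    hexp.comp hWl.neg hWneg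
  have hZ := (hYl.absolutelyContinuousOnInterval.fun_mul
    hElip.absolutelyContinuousOnInterval).integral_deriv_eq_sub
  -- Almost everywhere (Y e^{-W})' = β(y - Y)e^{-W} ≤ 0, and Y e^{-W} is absolutely continuous.
  have hneg : ∫ t in (0 : ℝ)..τ, deriv (fun t => Y t * Real.exp (-W t)) t ≤ 0 := by
    rw [intervalIntegral.integral_of_le hτ, integral_Ioc_eq_integral_Ioo]
    refine integral_nonpos_of_ae ?_
    have h1 := ae_restrict_of_ae (s := Ioo 0 τ)
      (LocallyIntegrable.ae_hasDerivAt_integral hkI.locallyIntegrable)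
    have h2 := ae_restrict_of_ae (s := Ioo 0 τ)
      (LocallyIntegrable.ae_hasDerivAt_integral hbI.locallyIntegrable)
    filter_upwards [h, hβ0, h1, h2, ae_restrict_mem measurableSet_Ioo] with t ht hbt h1 h2 htm
    have hd := ((h1 0).const_add A).fun_mul (h2 0).fun_neg.exp
    have hYt : Y t = A + ∫ s in Ioo 0 t, β s * y s := by
      rw [hY, hk]; simp only; rw [hint (Ioo_subset_Icc_self htm)]
    rw [← hYt] at ht
    rw [hd.deriv]
    change k t * Real.exp (-W t) + Y t * (Real.exp (-W t) * -b t) ≤ 0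
    rw [hk, hb, indicator_of_mem htm, indicator_of_mem htm]
    have := mul_nonneg (mul_nonneg (Real.exp_pos (-W t)).le hbt) (sub_nonneg.2 ht)
    linarith
  rw [hZ] at hneg
  have hY0 : Y 0 = A := by simp [hY]
  have hW0 : W 0 = 0 := by simp [hW]
  have hYτ : Y τ = A + ∫ s in Ioo 0 τ, β s * y s := by
    rw [hY, hk]; simp only; rw [hint (right_mem_Icc.2 hτ)]
  have hWτ : W τ = ∫ s in Ioo 0 τ, β s := by
    rw [hW, hb]; simp only; rw [hint (right_mem_Icc.2 hτ)]
  rw [hY0, hW0, neg_zero, Real.exp_zero, mul_one, sub_nonpos, Real.exp_neg,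
    ← div_eq_mul_inv, div_le_iff₀ (Real.exp_pos _)] at hneg
  rwa [← hYτ, ← hWτ]

end Gronwall

/-! ### Time slices of functions on the cylinder -/

section Slices

open Filter
open scoped NNReal Topology

variable {G : Type*} [NormedAddCommGroup G]

theorem ae_integrable_slice {A : ℝ × ℝ → G} {C : ℝ} (hA : AEStronglyMeasurable A cylMeasure)
    (hC : ∀ᵐ z ∂cylMeasure, ‖A z‖ ≤ C) :
    ∀ᵐ t ∂(volume.restrict (Ioi (0 : ℝ))),
      Integrable (fun x => A (x, t)) (volume.restrict (Ioo (0 : ℝ) 1)) := by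
  filter_upwards [ae_ae_of_ae_cylMeasure hC, hA.prod_swap.prodMk_left] with t h1 h2
  exact Integrable.of_bound h2 C h1

theorem aestronglyMeasurable_integral_slice [NormedSpace ℝ G] {A : ℝ × ℝ → G}
    (hA : AEStronglyMeasurable A cylMeasure) :
    AEStronglyMeasurable (fun t => ∫ x in Ioo (0 : ℝ) 1, A (x, t))
      (volume.restrict (Ioi (0 : ℝ))) :=
  hA.prod_swap.integral_prod_right'

theorem ae_norm_integral_slice_le [NormedSpace ℝ G] {A : ℝ × ℝ → G} {C : ℝ}
    (hC : ∀ᵐ z ∂cylMeasure, ‖A z‖ ≤ C) :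
    ∀ᵐ t ∂(volume.restrict (Ioi (0 : ℝ))), ‖∫ x in Ioo (0 : ℝ) 1, A (x, t)‖ ≤ C := by
  filter_upwards [ae_ae_of_ae_cylMeasure hC] with t h1
  simpa using norm_integral_le_of_norm_le_const h1

/-- Localization in time of a space-time inequality tested with cutoffs. -/
theorem ae_slice_le_of_forall_timeCutoff {A B : ℝ × ℝ → ℝ} {CA CB E₀ : ℝ}
    (hA : AEStronglyMeasurable A cylMeasure) (hB : AEStronglyMeasurable B cylMeasure)
    (hCA : ∀ᵐ z ∂cylMeasure, ‖A z‖ ≤ CA) (hCB : ∀ᵐ z ∂cylMeasure, ‖B z‖ ≤ CB)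
    (h : ∀ τ > 0, ∀ δ > 0, 0 ≤ (∫ z, (deriv (timeCutoff τ δ) z.2 * A z
      + timeCutoff τ δ z.2 * B z) ∂cylMeasure) + E₀) :
    ∀ᵐ τ ∂(volume.restrict (Ioi (0 : ℝ))), ∫ x in Ioo (0 : ℝ) 1, A (x, τ) ≤
      E₀ + ∫ t in Ioo 0 τ, ∫ x in Ioo (0 : ℝ) 1, B (x, t) := by
  refine ae_le_add_setIntegral_of_forall_timeCutoff (aestronglyMeasurable_integral_slice hA)
    (aestronglyMeasurable_integral_slice hB) (ae_norm_integral_slice_le hCA)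
    (ae_norm_integral_slice_le hCB) fun τ hτ δ hδ => ?_
  refine (h τ hτ δ hδ).trans (le_of_eq ?_)
  have hcut : Continuous (timeCutoff τ δ) := lipschitzWith_timeCutoff.continuous
  have hint : Integrable (fun z : ℝ × ℝ => deriv (timeCutoff τ δ) z.2 * A z
      + timeCutoff τ δ z.2 * B z) cylMeasure := by
    -- The extra 1 steps past the kink of the cutoff at τ + δ, beyond which its derivative is zero.
    refine integrable_cyl_of_bound (C := |δ⁻¹| * CA + 1 * CB) (b := τ + δ + 1) ?_ ?_ ?_
    · exact (((measurable_deriv _).comp measurable_snd).aestronglyMeasurable.mul hA).add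
        ((hcut.comp continuous_snd).aestronglyMeasurable.mul hB)
    · filter_upwards [hCA, hCB] with z h1 h2
      refine (norm_add_le _ _).trans (add_le_add ?_ ?_)
      · rw [norm_mul]
        refine mul_le_mul ?_ h1 (norm_nonneg _) (abs_nonneg _)
        simpa using norm_deriv_le_of_lipschitz (x₀ := z.2) (lipschitzWith_timeCutoff (τ := τ) (δ := δ))
      · rw [norm_mul, Real.norm_of_nonneg (timeCutoff_nonneg _)]
        exact mul_le_mul (timeCutoff_le_one _) h2 (norm_nonneg _) zero_le_one
    · intro x t ht
      rw [deriv_timeCutoff_of_gt hδ (by simpa using by linarith),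
        timeCutoff_of_ge hδ (by simpa using by linarith)]
      ring
  rw [integral_prod_symm _ hint]
  congr 1
  refine integral_congr_ae ?_
  filter_upwards [ae_integrable_slice hA hCA, ae_integrable_slice hB hCB] with t h1 h2
  rw [integral_add (h1.const_mul _) (h2.const_mul _), integral_const_mul, integral_const_mul]

end Slices

/-! ### Stability in terms of the residual, at almost every time -/

section Stability

open Filter
open scoped NNReal Topology

variable {d : ℕ} {U D : Set (Vec d)} {f : Vec d → Vec d} {η q : Vec d → ℝ} {u₀ : ℝ → Vec d}
  {u : ℝ → ℝ → Vec d} {g : ℝ × ℝ → Vec d} {Kg : ℝ≥0} {Cf Clo Chi : ℝ}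

/-- The residual of a Lipschitz field in the conservation law, in quasilinear form. -/
noncomputable def quasilinearResidual (U : Set (Vec d)) (f : Vec d → Vec d) (g : ℝ × ℝ → Vec d)
    (z : ℝ × ℝ) : Vec d :=
  fderiv ℝ g z (0, 1) + fderivWithin ℝ f U (g z) (fderiv ℝ g z (1, 0))

theorem norm_fderiv_fst_le (hg : LipschitzWith Kg g) (z : ℝ × ℝ) :
    ‖fderiv ℝ g z (1, 0)‖ ≤ Kg := by
  refine ((fderiv ℝ g z).le_opNorm _).trans ?_
  rw [norm_unit_fst, mul_one]
  exact norm_fderiv_le_of_lipschitz ℝ hg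

theorem norm_fderiv_snd_le (hg : LipschitzWith Kg g) (z : ℝ × ℝ) :
    ‖fderiv ℝ g z (0, 1)‖ ≤ Kg := by
  refine ((fderiv ℝ g z).le_opNorm _).trans ?_
  rw [norm_unit_snd, mul_one]
  exact norm_fderiv_le_of_lipschitz ℝ hg

theorem stronglyMeasurable_comp_clm_apply {G : Type*} [NormedAddCommGroup G] [NormedSpace ℝ G]
    [SecondCountableTopology G] {h : Vec d → Vec d →L[ℝ] G} (hh : ContinuousOn h U)
    (hg : Continuous g) (hgU : ∀ z, g z ∈ U) (v : ℝ × ℝ) :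
    StronglyMeasurable fun z => h (g z) (fderiv ℝ g z v) := by
  have h1 : StronglyMeasurable fun z => h (g z) := (hh.comp_continuous hg hgU).stronglyMeasurable
  have h2 : StronglyMeasurable fun z => fderiv ℝ g z v :=
    (measurable_fderiv_apply_const ℝ g v).stronglyMeasurable
  exact isBoundedBilinearMap_apply.continuous.comp_stronglyMeasurable (h1.prodMk h2)

theorem stronglyMeasurable_quasilinearResidual (hUd : UniqueDiffOn ℝ U) (hf : ContDiffOn ℝ 1 f U)
    (hg : Continuous g) (hgU : ∀ z, g z ∈ U) :
    StronglyMeasurable (quasilinearResidual U f g) :=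
  (measurable_fderiv_apply_const ℝ g _).stronglyMeasurable.add
    (stronglyMeasurable_comp_clm_apply (hf.continuousOn_fderivWithin hUd (by norm_num)) hg hgU _)

theorem exists_norm_quasilinearResidual_le (hUd : UniqueDiffOn ℝ U) (hf : ContDiffOn ℝ 1 f U)
    (hD : IsCompact D) (hDU : D ⊆ U) (hg : LipschitzWith Kg g) (hgD : ∀ z, g z ∈ D) :
    ∃ C, ∀ z, ‖quasilinearResidual U f g z‖ ≤ C := by
  obtain ⟨C, hC⟩ := hD.exists_nnreal_norm_comp_le
    ((hf.continuousOn_fderivWithin hUd (by norm_num)).mono hDU) hgD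
  refine ⟨Kg + C * Kg, fun z => (norm_add_le _ _).trans (add_le_add (norm_fderiv_snd_le hg z) ?_)⟩
  exact (ContinuousLinearMap.le_opNorm _ _).trans
    (mul_le_mul (hC z) (norm_fderiv_fst_le hg z) (norm_nonneg _) C.2)

/-- Substitute ∂ₜg = R - Df(g)∂ₓg and move Df(g) to the other slot of the Hessian by symmetry. It
then combines with f(u) - f(g) into the Taylor remainder ρ, which is quadratic in u - g. The term in
R is split by Young's inequality, Chi|R||e| ≤ |R|²/2 + Chi²|e|²/2. -/
theorem relEntropyProduction_le (hU : Convex ℝ U) (hU_int : (interior U).Nonempty)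
    (hDc : Convex ℝ D) (hDU : D ⊆ U) (hf : ContDiffOn ℝ 2 f U)
    (hηq : IsEntropyPair U f η q) (hC : IsHessianBound U D f η Cf Clo Chi)
    (hgD : ∀ z, g z ∈ D) {z : ℝ × ℝ} (hz : u z.1 z.2 ∈ D) {S : ℝ}
    (hS : ‖fderiv ℝ g z (1, 0)‖ ≤ S) :
    relEntropyProduction U f η u g z ≤ 1 / 2 * ‖quasilinearResidual U f g z‖ ^ 2
      + 1 / 2 * ((Chi * Cf * S + Chi ^ 2) * ‖u z.1 z.2 - g z‖ ^ 2) := by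
  have hUd := uniqueDiffOn_convex hU hU_int
  have hη := hηq.contDiff_entropy
  have hChi : 0 ≤ Chi := hC.lower_pos.le.trans hC.lower_le_upper
  set e := u z.1 z.2 - g z with he
  set H := fderivWithin ℝ (fderivWithin ℝ η U) U (g z) with hH
  set R := quasilinearResidual U f g z with hR
  set ρ := f (u z.1 z.2) - f (g z) - fderivWithin ℝ f U (g z) e with hρ
  have hsymm := hηq.hessian_symmetrizes hU hU_int hf (hDU (hgD z)) (fderiv ℝ g z (1, 0)) e
  have hid : relEntropyProduction U f η u g z = -H R e - H (fderiv ℝ g z (1, 0)) ρ := by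
    rw [relEntropyProduction, hR, quasilinearResidual, hρ]
    simp only [map_add, map_sub, add_apply, ← he, ← hH] at hsymm ⊢
    rw [hsymm]; ring
  have h1 := abs_hessian_le hU hU_int hη hDU hC (hgD z) R e
  have h2 := abs_hessian_le hU hU_int hη hDU hC (hgD z) (fderiv ℝ g z (1, 0)) ρ
  have h3 : ‖ρ‖ ≤ Cf / 2 * ‖e‖ ^ 2 := norm_flux_remainder_le hU hUd hf hDc hDU hC (hgD z) hz
  have h4 : Chi * ‖fderiv ℝ g z (1, 0)‖ * ‖ρ‖ ≤ Chi * S * (Cf / 2 * ‖e‖ ^ 2) :=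
    mul_le_mul (mul_le_mul_of_nonneg_left hS hChi) h3 (norm_nonneg _)
      (mul_nonneg hChi ((norm_nonneg _).trans hS))
  rw [hid]
  have h5 := (abs_le.1 h1).1
  have h6 := (abs_le.1 h2).1
  nlinarith [sq_nonneg (‖R‖ - Chi * ‖e‖)]

theorem aestronglyMeasurable_relEntropy {α : Type*} [MeasurableSpace α] {μ : Measure α}
    (hUd : UniqueDiffOn ℝ U) (hη : ContDiffOn ℝ 1 η U) (hD : IsCompact D) (hDU : D ⊆ U)
    {v k : α → Vec d} (hv : AEStronglyMeasurable v μ) (hvD : ∀ᵐ z ∂μ, v z ∈ D)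
    (hk : AEStronglyMeasurable k μ) (hkD : ∀ᵐ z ∂μ, k z ∈ D) :
    AEStronglyMeasurable (fun z => relEntropy U η (v z) (k z)) μ := by
  have h1 := aestronglyMeasurable_comp_of_continuousOn hv (hη.continuousOn.mono hDU) hD.isClosed hvD
  have h2 := aestronglyMeasurable_comp_of_continuousOn hk (hη.continuousOn.mono hDU) hD.isClosed hkD
  have h3 := aestronglyMeasurable_comp_of_continuousOn hk
    ((hη.continuousOn_fderivWithin hUd (by norm_num)).mono hDU) hD.isClosed hkD
  exact (h1.sub h2).sub (isBoundedBilinearMap_apply.continuous.comp_aestronglyMeasurable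
    (h3.prodMk (hv.sub hk)))

theorem aestronglyMeasurable_relEntropyProduction
    (hUd : UniqueDiffOn ℝ U) (hη : ContDiffOn ℝ 2 η U) (hf : ContinuousOn f U)
    (hD : IsCompact D) (hDU : D ⊆ U)
    (hum : AEStronglyMeasurable (fun z => u z.1 z.2) cylMeasure)
    (huD : ∀ᵐ z ∂cylMeasure, u z.1 z.2 ∈ D) (hg : Continuous g) (hgD : ∀ z, g z ∈ D) :
    AEStronglyMeasurable (relEntropyProduction U f η u g) cylMeasure := by
  have hgU : ∀ z, g z ∈ U := fun z => hDU (hgD z)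
  have hc : ContinuousOn (fderivWithin ℝ (fderivWithin ℝ η U) U) U :=
    ContDiffOn.continuousOn_fderivWithin (n := 1) (hη.fderivWithin hUd (by norm_num)) hUd
      (by norm_num)
  have h1 (v : ℝ × ℝ) := stronglyMeasurable_comp_clm_apply hc hg hgU v
  have h2 := aestronglyMeasurable_comp_of_continuousOn hum (hf.mono hDU) hD.isClosed huD
  have h3 : Continuous fun z => f (g z) := hf.comp_continuous hg hgU
  exact (isBoundedBilinearMap_apply.continuous.comp_aestronglyMeasurable
    ((h1 _).aestronglyMeasurable.prodMk (hum.sub hg.aestronglyMeasurable))).neg.sub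
    (isBoundedBilinearMap_apply.continuous.comp_aestronglyMeasurable
    ((h1 _).aestronglyMeasurable.prodMk (h2.sub h3.aestronglyMeasurable)))

/-- The relative entropy is bounded below by Clo/2 times the squared error and initially above by
Chi/2 times it. After division by Clo/2 the balance is a Grönwall inequality for y with rate β and
forcing `Clo⁻¹ * r`. -/
theorem IsEntropySolution.ae_stability (hU : Convex ℝ U) (hU_int : (interior U).Nonempty)
    (hD : IsCompact D) (hDc : Convex ℝ D) (hDU : D ⊆ U) (hf : ContDiffOn ℝ 2 f U)
    (hηq : IsEntropyPair U f η q) (hC : IsHessianBound U D f η Cf Clo Chi)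
    (hu : IsEntropySolution U f η q u₀ u)
    (huD : ∀ᵐ z ∂cylMeasure, u z.1 z.2 ∈ D)
    (hu₀D : ∀ᵐ x ∂(volume.restrict (Ioo (0 : ℝ) 1)), u₀ x ∈ D)
    (hg : LipschitzWith Kg g) (hgD : ∀ z, g z ∈ D) (hper : ∀ x t, g (x + 1, t) = g (x, t))
    {S : ℝ → ℝ} {CS : ℝ} (hSm : Measurable S) (hS0 : ∀ t, 0 ≤ S t) (hSC : ∀ t, S t ≤ CS)
    (hS : ∀ᵐ z ∂cylMeasure, ‖fderiv ℝ g z (1, 0)‖ ≤ S z.2) :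
    ∀ᵐ τ ∂(volume.restrict (Ioi (0 : ℝ))),
      ∫ x in Ioo (0 : ℝ) 1, ‖u x τ - g (x, τ)‖ ^ 2 ≤
      Clo⁻¹ * ((∫ t in Ioo 0 τ, ∫ x in Ioo (0 : ℝ) 1, ‖quasilinearResidual U f g (x, t)‖ ^ 2)
        + Chi * ∫ x in Ioo (0 : ℝ) 1, ‖u₀ x - g (x, 0)‖ ^ 2)
      * Real.exp (∫ t in Ioo 0 τ, (Chi * Cf * S t + Chi ^ 2) / Clo) := by
  have hUd := uniqueDiffOn_convex hU hU_int
  have hη := hηq.contDiff_entropy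
  have hη1 : ContDiffOn ℝ 1 η U := hη.of_le (by norm_num)
  have hf1 : ContDiffOn ℝ 1 f U := hf.of_le (by norm_num)
  have hgU : ∀ z, g z ∈ U := fun z => hDU (hgD z)
  have hm := hu.aestronglyMeasurable
  have hClo := hC.lower_pos
  have hCf := hC.flux_nonneg
  have hChi : 0 ≤ Chi := hC.lower_pos.le.trans hC.lower_le_upper
  obtain ⟨Ci, hCi⟩ := hD.exists_bound_of_continuousOn (f := id) continuousOn_id
  obtain ⟨Cfl, hCfl⟩ := hD.exists_bound_of_continuousOn (hf1.continuousOn.mono hDU)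
  obtain ⟨CR, hCR⟩ := exists_norm_quasilinearResidual_le hUd hf1 hD hDU hg hgD
  have hediff (a b : Vec d) (ha : a ∈ D) (hb : b ∈ D) : ‖a - b‖ ≤ Ci + Ci :=
    (norm_sub_le _ _).trans (add_le_add (hCi a ha) (hCi b hb))
  -- relative entropy
  have hAm : AEStronglyMeasurable (fun z => relEntropy U η (u z.1 z.2) (g z)) cylMeasure :=
    aestronglyMeasurable_relEntropy hUd hη1 hD hDU hm huD hg.continuous.aestronglyMeasurable
      (Eventually.of_forall hgD)
  have hrel0 {a b : Vec d} (ha : a ∈ D) (hb : b ∈ D) : 0 ≤ relEntropy U η b a :=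
    (by positivity : 0 ≤ Clo / 2 * ‖b - a‖ ^ 2).trans (le_relEntropy hU hUd hη hDc hDU hC ha hb)
  have hrelC {a b : Vec d} (ha : a ∈ D) (hb : b ∈ D) :
      ‖relEntropy U η b a‖ ≤ Chi / 2 * (Ci + Ci) ^ 2 := by
    rw [Real.norm_of_nonneg (hrel0 ha hb)]
    refine (relEntropy_le hU hUd hη hDc hDU hC ha hb).trans ?_
    have := hediff b a hb ha
    gcongr
  have hAC : ∀ᵐ z ∂cylMeasure, ‖relEntropy U η (u z.1 z.2) (g z)‖ ≤ Chi / 2 * (Ci + Ci) ^ 2 :=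
    huD.mono fun z hz => hrelC (hgD z) hz
  -- entropy production
  have hBm := aestronglyMeasurable_relEntropyProduction hUd hη hf1.continuousOn hD hDU hm huD
    hg.continuous hgD
  have hBC : ∀ᵐ z ∂cylMeasure, ‖relEntropyProduction U f η u g z‖ ≤
      Chi * Kg * (Ci + Ci) + Chi * Kg * (Cfl + Cfl) := by
    filter_upwards [huD] with z hz
    rw [relEntropyProduction]
    refine (norm_sub_le _ _).trans (add_le_add ?_ ?_)
    · rw [norm_neg]
      refine (abs_hessian_le hU hU_int hη hDU hC (hgD z) _ _).trans ?_
      have h1 := norm_fderiv_snd_le hg z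
      have h2 := hediff _ _ hz (hgD z)
      gcongr
    · refine (abs_hessian_le hU hU_int hη hDU hC (hgD z) _ _).trans ?_
      have h1 := norm_fderiv_fst_le hg z
      have h2 : ‖f (u z.1 z.2) - f (g z)‖ ≤ Cfl + Cfl :=
        (norm_sub_le _ _).trans (add_le_add (hCfl _ hz) (hCfl _ (hgD z)))
      gcongr
  have hbal := ae_slice_le_of_forall_timeCutoff hAm hBm hAC hBC
    (E₀ := ∫ x in Ioo (0 : ℝ) 1, relEntropy U η (u₀ x) (g (x, 0))) fun τ hτ δ hδ => by
      have := relEntropy_balance hU hU_int hD hDc hDU hf hηq hu huD hu₀D hg hgD hper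
        (lipschitzWith_timeCutoff (τ := τ) (δ := δ)) timeCutoff_nonneg timeCutoff_le_one
        (b := τ + δ) (fun t ht => timeCutoff_of_ge hδ ht)
      rwa [timeCutoff_of_le hδ hτ.le, one_mul] at this
  -- squared error
  have hem : AEStronglyMeasurable (fun z => ‖u z.1 z.2 - g z‖ ^ 2) cylMeasure :=
    (hm.sub hg.continuous.aestronglyMeasurable).norm.pow 2
  have heC : ∀ᵐ z ∂cylMeasure, ‖‖u z.1 z.2 - g z‖ ^ 2‖ ≤ (Ci + Ci) ^ 2 := by
    filter_upwards [huD] with z hz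
    rw [norm_pow, norm_norm]
    have := hediff _ _ hz (hgD z)
    gcongr
  have hRm : AEStronglyMeasurable (fun z => ‖quasilinearResidual U f g z‖ ^ 2) cylMeasure :=
    (stronglyMeasurable_quasilinearResidual hUd hf1 hg.continuous
      hgU).aestronglyMeasurable.norm.pow 2
  have hRC : ∀ᵐ z ∂cylMeasure, ‖‖quasilinearResidual U f g z‖ ^ 2‖ ≤ CR ^ 2 :=
    Eventually.of_forall fun z => by
      rw [norm_pow, norm_norm]
      have := hCR z
      gcongr
  set y : ℝ → ℝ := fun t => ∫ x in Ioo (0 : ℝ) 1, ‖u x t - g (x, t)‖ ^ 2 with hy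
  set r : ℝ → ℝ := fun t => ∫ x in Ioo (0 : ℝ) 1, ‖quasilinearResidual U f g (x, t)‖ ^ 2 with hr
  set β : ℝ → ℝ := fun t => (Chi * Cf * S t + Chi ^ 2) / Clo with hβ
  set y₀ : ℝ := ∫ x in Ioo (0 : ℝ) 1, ‖u₀ x - g (x, 0)‖ ^ 2 with hy₀
  have hym : AEStronglyMeasurable y (volume.restrict (Ioi 0)) :=
    aestronglyMeasurable_integral_slice hem
  have hyC : ∀ᵐ t ∂(volume.restrict (Ioi (0 : ℝ))), ‖y t‖ ≤ (Ci + Ci) ^ 2 :=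
    ae_norm_integral_slice_le heC
  have hrm : AEStronglyMeasurable r (volume.restrict (Ioi 0)) :=
    aestronglyMeasurable_integral_slice hRm
  have hrC : ∀ᵐ t ∂(volume.restrict (Ioi (0 : ℝ))), ‖r t‖ ≤ CR ^ 2 :=
    ae_norm_integral_slice_le hRC
  have hr0 (t : ℝ) : 0 ≤ r t := integral_nonneg fun x => by positivity
  have hβm : Measurable β := ((hSm.const_mul _).add_const _).div_const _
  have hβ0 (t : ℝ) : 0 ≤ β t := by
    have := hS0 t
    simp only [hβ]; positivity
  have hβC (t : ℝ) : ‖β t‖ ≤ (Chi * Cf * CS + Chi ^ 2) / Clo := by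
    rw [Real.norm_of_nonneg (hβ0 t)]
    have := hSC t
    simp only [hβ]; gcongr
  have hβyC : ∀ᵐ t ∂(volume.restrict (Ioi (0 : ℝ))), ‖β t * y t‖ ≤
      (Chi * Cf * CS + Chi ^ 2) / Clo * (Ci + Ci) ^ 2 := by
    filter_upwards [hyC] with t ht
    rw [norm_mul]
    exact mul_le_mul (hβC t) ht (norm_nonneg _) ((norm_nonneg _).trans (hβC t))
  have hloc {v : ℝ → ℝ} {C : ℝ} (hv : AEStronglyMeasurable v (volume.restrict (Ioi 0)))
      (hC : ∀ᵐ t ∂(volume.restrict (Ioi (0 : ℝ))), ‖v t‖ ≤ C) (τ : ℝ) :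
      IntegrableOn v (Ioo 0 τ) :=
    IntegrableOn.of_bound (by simp) (hv.mono_set Ioo_subset_Ioi_self) C
      (ae_mono (Measure.restrict_mono Ioo_subset_Ioi_self le_rfl) hC)
  have hy0t (t : ℝ) : 0 ≤ y t := integral_nonneg fun x => by positivity
  -- bound on the production in each time slice
  have hprod : ∀ᵐ t ∂(volume.restrict (Ioi (0 : ℝ))),
      ∫ x in Ioo (0 : ℝ) 1, relEntropyProduction U f η u g (x, t) ≤
        Clo / 2 * (Clo⁻¹ * r t + β t * y t) := by
    filter_upwards [ae_integrable_slice hBm hBC, ae_integrable_slice hem heC,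
      ae_integrable_slice hRm hRC, ae_ae_of_ae_cylMeasure huD, ae_ae_of_ae_cylMeasure hS]
      with t h1 h2 h3 h4 h5
    have : Clo / 2 * (Clo⁻¹ * r t + β t * y t) = ∫ x in Ioo (0 : ℝ) 1,
        (1 / 2 * ‖quasilinearResidual U f g (x, t)‖ ^ 2
          + 1 / 2 * ((Chi * Cf * S t + Chi ^ 2) * ‖u x t - g (x, t)‖ ^ 2)) := by
      rw [integral_add (h3.const_mul _) ((h2.const_mul _).const_mul _), integral_const_mul,
        integral_const_mul, integral_const_mul]
      simp only [hβ, hr, hy]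
      field_simp
    rw [this]
    refine integral_mono_ae h1 ((h3.const_mul _).add ((h2.const_mul _).const_mul _)) ?_
    filter_upwards [h4, h5] with x hx1 hx2
    exact relEntropyProduction_le hU hU_int hDc hDU hf hηq hC hgD hx1 hx2
  have hinit : ∫ x in Ioo (0 : ℝ) 1, relEntropy U η (u₀ x) (g (x, 0)) ≤ Chi / 2 * y₀ := by
    have hgc : Continuous fun x : ℝ => g (x, 0) := hg.continuous.comp (by fun_prop)
    rw [hy₀, ← integral_const_mul]
    refine integral_mono_ae ?_ (Integrable.const_mul ?_ _) ?_
    · refine Integrable.of_bound (aestronglyMeasurable_relEntropy hUd hη1 hD hDU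
        hu.memLp_init.1 hu₀D hgc.aestronglyMeasurable (Eventually.of_forall fun x => hgD _))
        (Chi / 2 * (Ci + Ci) ^ 2) ?_
      exact hu₀D.mono fun x hx => hrelC (hgD _) hx
    · refine Integrable.of_bound ((hu.memLp_init.1.sub hgc.aestronglyMeasurable).norm.pow 2)
        ((Ci + Ci) ^ 2) ?_
      filter_upwards [hu₀D] with x hx
      rw [norm_pow, norm_norm]
      have := hediff _ _ hx (hgD (x, 0))
      gcongr
    · exact hu₀D.mono fun x hx => relEntropy_le hU hUd hη hDc hDU hC (hgD _) hx
  have hlower : ∀ᵐ t ∂(volume.restrict (Ioi (0 : ℝ))),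
      Clo / 2 * y t ≤ ∫ x in Ioo (0 : ℝ) 1, relEntropy U η (u x t) (g (x, t)) := by
    filter_upwards [ae_integrable_slice hem heC, ae_integrable_slice hAm hAC,
      ae_ae_of_ae_cylMeasure huD] with t h1 h2 h3
    rw [hy, ← integral_const_mul]
    exact integral_mono_ae (h1.const_mul _) h2
      (h3.mono fun x hx => le_relEntropy hU hUd hη hDc hDU hC (hgD _) hx)
  have hmain : ∀ᵐ τ ∂(volume.restrict (Ioi (0 : ℝ))), y τ ≤
      Clo⁻¹ * ((∫ t in Ioo 0 τ, r t) + Chi * y₀) + ∫ t in Ioo 0 τ, β t * y t := by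
    filter_upwards [hbal, hlower] with τ h1 h2
    have hiB := hloc (aestronglyMeasurable_integral_slice hBm) (ae_norm_integral_slice_le hBC) τ
    have hir := hloc hrm hrC τ
    have hiy : IntegrableOn (fun t => β t * y t) (Ioo 0 τ) := hloc (hβm.aestronglyMeasurable.mul hym) hβyC τ
    have h3 : ∫ t in Ioo 0 τ, ∫ x in Ioo (0 : ℝ) 1, relEntropyProduction U f η u g (x, t) ≤
        ∫ t in Ioo 0 τ, Clo / 2 * (Clo⁻¹ * r t + β t * y t) :=
      integral_mono_ae hiB (((hir.const_mul _).add hiy).const_mul _)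
        (ae_mono (Measure.restrict_mono Ioo_subset_Ioi_self le_rfl) hprod)
    rw [integral_const_mul, integral_add (hir.const_mul _) hiy, integral_const_mul] at h3
    have h4 : Clo / 2 * y τ ≤ Clo / 2 * (Clo⁻¹ * ((∫ t in Ioo 0 τ, r t) + Chi * y₀)
        + ∫ t in Ioo 0 τ, β t * y t) := by
      have h5 : Chi / 2 * y₀ = Clo / 2 * (Clo⁻¹ * (Chi * y₀)) := by field_simp
      linarith
    exact le_of_mul_le_mul_left h4 (by positivity)
  -- Grönwall's inequality is applied on (0, τ) with the forcing frozen at its value at τ.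
  filter_upwards [hmain, ae_restrict_mem measurableSet_Ioi] with τ hτ hτ0
  refine hτ.trans (gronwall_of_ae_le (mem_Ioi.1 hτ0).le (hym.mono_set Ioo_subset_Ioi_self)
    hβm.aestronglyMeasurable
    (ae_mono (Measure.restrict_mono Ioo_subset_Ioi_self le_rfl) hyC) (Eventually.of_forall hβC)
    (Eventually.of_forall hβ0) ?_)
  filter_upwards [ae_mono (Measure.restrict_mono Ioo_subset_Ioi_self le_rfl) hmain,
    ae_restrict_mem measurableSet_Ioo] with t ht htm
  refine ht.trans ?_
  -- Since r ≥ 0, the forcing at an earlier time t is dominated by the one frozen at τ.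
  have : ∫ s in Ioo 0 t, r s ≤ ∫ s in Ioo 0 τ, r s :=
    setIntegral_mono_set (hloc hrm hrC τ) (Eventually.of_forall hr0)
      (Eventually.of_forall (Ioo_subset_Ioo_right htm.2.le))
  gcongr

end Stability

/-! ### Periodic extension and trapezoidal test functions -/

section PeriodicExtension

open Filter
open scoped NNReal Topology

/-- For points in different periods, go from x to the end of its period and from the start of the
period of y to y. Equality of the end values makes the jump free, and the two lengths add up to at
most y - x. -/
theorem LipschitzOnWith.lipschitzWith_comp_fract {G : Type*} [PseudoMetricSpace G] {h : ℝ → G}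
    {K : ℝ≥0} (hh : LipschitzOnWith K h (Icc 0 1)) (h01 : h 0 = h 1) :
    LipschitzWith K fun x => h (Int.fract x) := by
  have hmem (x : ℝ) : Int.fract x ∈ Icc (0 : ℝ) 1 := ⟨Int.fract_nonneg x, (Int.fract_lt_one x).le⟩
  have key (x y : ℝ) (hxy : x ≤ y) : dist (h (Int.fract x)) (h (Int.fract y)) ≤ K * (y - x) := by
    have ex := Int.floor_add_fract x
    have ey := Int.floor_add_fract y
    rcases (Int.floor_mono hxy).eq_or_lt with he | hlt
    · refine (hh.dist_le_mul _ (hmem x) _ (hmem y)).trans (le_of_eq ?_)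
      have : Int.fract x - Int.fract y = -(y - x) := by
        have : (⌊x⌋ : ℝ) = ⌊y⌋ := by exact_mod_cast he
        linarith
      rw [Real.dist_eq, this, abs_neg, abs_of_nonneg (by linarith)]
    · have h1 : (⌊x⌋ : ℝ) + 1 ≤ ⌊y⌋ := by exact_mod_cast hlt
      have h2 := hh.dist_le_mul _ (hmem x) 1 (right_mem_Icc.2 zero_le_one)
      have h3 := hh.dist_le_mul 0 (left_mem_Icc.2 zero_le_one) _ (hmem y)
      rw [Real.dist_eq, abs_sub_comm, abs_of_nonneg (by linarith [(hmem x).2])] at h2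
      rw [Real.dist_eq, zero_sub, abs_neg, abs_of_nonneg (hmem y).1] at h3
      calc dist (h (Int.fract x)) (h (Int.fract y))
          ≤ dist (h (Int.fract x)) (h 1) + dist (h 0) (h (Int.fract y)) := by
            rw [h01]; exact dist_triangle _ _ _
        _ ≤ K * (1 - Int.fract x) + K * Int.fract y := add_le_add h2 h3
        _ = K * (1 - Int.fract x + Int.fract y) := by ring
        _ ≤ K * (y - x) := mul_le_mul_of_nonneg_left (by linarith) K.2
  refine LipschitzWith.of_dist_le_mul fun x y => ?_
  rcases le_total x y with hxy | hxy
  · rw [Real.dist_eq, abs_sub_comm, abs_of_nonneg (by linarith)]; exact key x y hxy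
  · rw [Real.dist_eq, abs_of_nonneg (by linarith), dist_comm]; exact key y x hxy

theorem fract_eventuallyEq {x : ℝ} (hx : x ∈ Ioo (0 : ℝ) 1) : ∀ᶠ y in 𝓝 x, Int.fract y = y := by
  filter_upwards [isOpen_Ioo.mem_nhds hx] with y hy
  exact Int.fract_eq_self.2 ⟨hy.1.le, hy.2⟩

/-- A trapezoidal function with slopes `±n`, supported in `[0,b]`. -/
noncomputable def trapezoid (b n x : ℝ) : ℝ := max 0 (min 1 (n * min x (b - x)))

variable {b n : ℝ}

theorem trapezoid_nonneg (x : ℝ) : 0 ≤ trapezoid b n x := le_max_left _ _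

theorem trapezoid_le_one (x : ℝ) : trapezoid b n x ≤ 1 := max_le zero_le_one (min_le_left _ _)

theorem lipschitzWith_trapezoid : LipschitzWith (Real.nnabs n) (trapezoid b n) := by
  have h1 : LipschitzWith 1 fun x : ℝ => min x (b - x) := by
    have h2 : LipschitzWith 1 fun x : ℝ => b - x := by
      simpa using (LipschitzWith.const b).sub LipschitzWith.id
    simpa using LipschitzWith.id.min h2
  have h3 : LipschitzWith (Real.nnabs n) fun x : ℝ => n * min x (b - x) := by
    refine LipschitzWith.of_dist_le_mul fun x y => ?_
    have := h1.dist_le_mul x y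
    rw [NNReal.coe_one, one_mul] at this
    rw [Real.dist_eq, ← mul_sub, abs_mul, Real.coe_nnabs]
    exact mul_le_mul_of_nonneg_left this (abs_nonneg n)
  exact (h3.const_min 1).const_max 0

theorem trapezoid_of_notMem (hn : 0 ≤ n) {x : ℝ} (hx : x ≤ 0 ∨ b ≤ x) : trapezoid b n x = 0 := by
  have : min x (b - x) ≤ 0 := by
    rcases hx with h | h
    · exact (min_le_left _ _).trans h
    · exact (min_le_right _ _).trans (by linarith)
  exact max_eq_left ((min_le_right _ _).trans (mul_nonpos_of_nonneg_of_nonpos hn this))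

theorem trapezoid_of_mem (hn : 0 < n) {x : ℝ} (h1 : n⁻¹ ≤ x) (h2 : x ≤ b - n⁻¹) :
    trapezoid b n x = 1 := by
  have h3 : n⁻¹ ≤ min x (b - x) := le_min h1 (by linarith)
  have h4 : 1 ≤ n * min x (b - x) := by
    have := mul_le_mul_of_nonneg_left h3 hn.le
    rwa [mul_inv_cancel₀ hn.ne'] at this
  rw [trapezoid, min_eq_left h4, max_eq_right zero_le_one]

theorem tendsto_trapezoid {x : ℝ} (hx : x ≠ b) (hx0 : 0 < x) :
    Tendsto (fun k : ℕ => trapezoid b (k + 1) x) atTop (𝓝 ((Iio b).indicator 1 x)) := by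
  rcases lt_or_gt_of_ne hx with h | h
  · rw [indicator_of_mem (mem_Iio.2 h)]
    refine tendsto_const_nhds.congr' ?_
    have h1 : Tendsto (fun k : ℕ => ((k : ℝ) + 1)⁻¹) atTop (𝓝 0) := by
      simpa using tendsto_one_div_add_atTop_nhds_zero_nat (𝕜 := ℝ)
    filter_upwards [h1.eventually (gt_mem_nhds hx0), h1.eventually (gt_mem_nhds (sub_pos.2 h))]
      with k h2 h3
    exact (trapezoid_of_mem (by positivity) h2.le (by linarith)).symm
  · rw [indicator_of_notMem (by simpa using h.le)]
    exact tendsto_const_nhds.congr fun k =>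
      (trapezoid_of_notMem (by positivity) (Or.inr h.le)).symm

/-- The slope is at most n, on a set of measure at most 2/n. The bound does not depend on n, which
makes the trapezoids usable as approximations of an indicator in the construction of the potential.
-/
theorem integral_abs_deriv_trapezoid_le (hn : 0 < n) :
    ∫ x in Ioo (0 : ℝ) 1, |deriv (trapezoid b n) x| ≤ 2 := by
  set s : Set ℝ := Icc 0 n⁻¹ ∪ Icc (b - n⁻¹) b with hs
  have hsm : MeasurableSet s := measurableSet_Icc.union measurableSet_Icc
  have hvol : volume s ≤ ENNReal.ofReal (2 * n⁻¹) := by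
    refine (measure_union_le _ _).trans (le_of_eq ?_)
    rw [Real.volume_Icc, Real.volume_Icc, ← ENNReal.ofReal_add (by simp [hn.le]) (by simp [hn.le])]
    congr 1; ring
  have hfin : volume s ≠ ⊤ := ne_top_of_le_ne_top ENNReal.ofReal_ne_top hvol
  have hz (x : ℝ) (hx : x ∉ s) : deriv (trapezoid b n) x = 0 := by
    simp only [hs, mem_union, mem_Icc, not_or, not_and_or, not_le] at hx
    have hconst : (∃ c, trapezoid b n =ᶠ[𝓝 x] fun _ => c) := by
      rcases hx.1 with h | h
      · exact ⟨0, by filter_upwards [gt_mem_nhds h] with y hy using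
          trapezoid_of_notMem hn.le (Or.inl hy.le)⟩
      · rcases hx.2 with h' | h'
        · exact ⟨1, by filter_upwards [lt_mem_nhds h, gt_mem_nhds h'] with y hy hy' using
            trapezoid_of_mem hn hy.le hy'.le⟩
        · exact ⟨0, by filter_upwards [lt_mem_nhds h'] with y hy using
            trapezoid_of_notMem hn.le (Or.inr hy.le)⟩
    obtain ⟨c, hc⟩ := hconst
    rw [hc.deriv_eq]; simp
  have hle (x : ℝ) : |deriv (trapezoid b n) x| ≤ s.indicator (fun _ => n) x := by
    by_cases hx : x ∈ s
    · rw [indicator_of_mem hx]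
      have := norm_deriv_le_of_lipschitz (x₀ := x) (lipschitzWith_trapezoid (b := b) (n := n))
      simpa [abs_of_pos hn] using this
    · rw [indicator_of_notMem hx, hz x hx, abs_zero]
  have hint : Integrable (s.indicator fun _ => n) := by
    rw [integrable_indicator_iff hsm]
    exact integrableOn_const hfin
  calc ∫ x in Ioo (0 : ℝ) 1, |deriv (trapezoid b n) x|
      ≤ ∫ x in Ioo (0 : ℝ) 1, s.indicator (fun _ => n) x :=
        integral_mono_of_nonneg (Eventually.of_forall fun x => abs_nonneg _) hint.integrableOn
          (Eventually.of_forall hle)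
    _ ≤ ∫ x, s.indicator (fun _ => n) x :=
        setIntegral_le_integral hint (Eventually.of_forall fun x =>
          indicator_nonneg (fun _ _ => hn.le) x)
    _ = volume.real s * n := by rw [integral_indicator hsm, setIntegral_const, smul_eq_mul]
    _ ≤ 2 * n⁻¹ * n := by
        refine mul_le_mul_of_nonneg_right ?_ hn.le
        exact ENNReal.toReal_le_of_le_ofReal (by positivity) hvol
    _ = 2 := by field_simp

end PeriodicExtension

/-! ### The weak formulation on time slices -/

section SliceIdentity

open Filter
open scoped NNReal Topology

variable {d : ℕ} {U D : Set (Vec d)} {f : Vec d → Vec d} {η q : Vec d → ℝ} {u₀ : ℝ → Vec d}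
  {u : ℝ → ℝ → Vec d}

/-- The product of Ψ with a time cutoff is a Lipschitz test function. The signs are those required
by `ae_slice_le_of_forall_timeCutoff`; the reverse inequality comes from -Ψ. -/
theorem IsEntropySolution.ae_slice_le (hu : IsEntropySolution U f η q u₀ u)
    (hD : IsCompact D) (hf : ContinuousOn f D) (huD : ∀ᵐ z ∂cylMeasure, u z.1 z.2 ∈ D)
    {Ψ : ℝ → Vec d} {K C : ℝ≥0} (hΨ : LipschitzWith K Ψ) (hC : ∀ x, ‖Ψ x‖ ≤ C)
    (hper : ∀ x, Ψ (x + 1) = Ψ x) :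
    ∀ᵐ t ∂(volume.restrict (Ioi (0 : ℝ))), -∫ x in Ioo (0 : ℝ) 1, inner ℝ (u x t) (Ψ x) ≤
      -(∫ x in Ioo (0 : ℝ) 1, inner ℝ (u₀ x) (Ψ x)) +
        ∫ s in Ioo 0 t, -∫ x in Ioo (0 : ℝ) 1, inner ℝ (f (u x s)) (deriv Ψ x) := by
  obtain ⟨CA, hCA⟩ := hD.exists_bound_of_continuousOn (f := id) continuousOn_id
  obtain ⟨CB, hCB⟩ := hD.exists_bound_of_continuousOn hf
  have hm := hu.aestronglyMeasurable
  have hmf := aestronglyMeasurable_comp_of_continuousOn hm hf hD.isClosed huD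
  have hΨf : LipschitzWith K fun z : ℝ × ℝ => Ψ z.1 := by
    simpa [Function.comp_def] using hΨ.comp (LipschitzWith.prod_fst (α := ℝ) (β := ℝ))
  have hAm : AEStronglyMeasurable (fun z : ℝ × ℝ => -inner ℝ (u z.1 z.2) (Ψ z.1)) cylMeasure :=
    (hm.inner hΨf.continuous.aestronglyMeasurable).neg
  have hBm : AEStronglyMeasurable (fun z : ℝ × ℝ => -inner ℝ (f (u z.1 z.2)) (deriv Ψ z.1))
      cylMeasure :=
    (hmf.inner ((measurable_deriv Ψ).comp measurable_fst).aestronglyMeasurable).neg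
  have hAC : ∀ᵐ z ∂cylMeasure, ‖-inner ℝ (u z.1 z.2) (Ψ z.1)‖ ≤ CA * C := by
    filter_upwards [huD] with z hz
    rw [norm_neg]
    have h1 : ‖u z.1 z.2‖ ≤ CA := hCA _ hz
    exact (norm_inner_le_norm _ _).trans
      (mul_le_mul h1 (hC _) (norm_nonneg _) ((norm_nonneg _).trans h1))
  have hBC : ∀ᵐ z ∂cylMeasure, ‖-inner ℝ (f (u z.1 z.2)) (deriv Ψ z.1)‖ ≤ CB * K := by
    filter_upwards [huD] with z hz
    rw [norm_neg]
    have h1 : ‖f (u z.1 z.2)‖ ≤ CB := hCB _ hz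
    exact (norm_inner_le_norm _ _).trans
      (mul_le_mul h1 (norm_deriv_le_of_lipschitz hΨ) (norm_nonneg _) ((norm_nonneg _).trans h1))
  have hmain := ae_slice_le_of_forall_timeCutoff hAm hBm hAC hBC
    (E₀ := -∫ x in Ioo (0 : ℝ) 1, inner ℝ (u₀ x) (Ψ x)) fun τ hτ δ hδ => by
      have hΘ : LipschitzWith (Real.nnabs δ⁻¹) fun z : ℝ × ℝ => timeCutoff τ δ z.2 := by
        simpa [Function.comp_def] using
          (lipschitzWith_timeCutoff (τ := τ) (δ := δ)).comp (LipschitzWith.prod_snd (α := ℝ) (β := ℝ))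
      have hΦ := hΘ.smul_of_bounded hΨf (C₁ := 1) (C₂ := C)
        (fun z => by
          rw [Real.norm_of_nonneg (timeCutoff_nonneg _)]; exact timeCutoff_le_one _)
        (fun z => hC _)
      have h0 := hu.pairing_eq_zero hD hf huD hΦ (b := τ + δ)
        (fun x t ht => by simp [timeCutoff_of_ge hδ ht]) (fun x t => by simp [hper])
      unfold pairing at h0
      simp only [timeCutoff_of_le hδ hτ.le, one_smul] at h0
      have hΘd : ∀ᵐ z ∂cylMeasure, DifferentiableAt ℝ (fun z : ℝ × ℝ => timeCutoff τ δ z.2) z :=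
        cylMeasure_absolutelyContinuous.ae_le hΘ.ae_differentiableAt
      have hΨd : ∀ᵐ z ∂cylMeasure, DifferentiableAt ℝ (fun z : ℝ × ℝ => Ψ z.1) z :=
        cylMeasure_absolutelyContinuous.ae_le hΨf.ae_differentiableAt
      refine le_of_eq ?_
      rw [← neg_eq_zero, neg_add, ← integral_neg] at h0
      refine h0.symm.trans ?_
      congr 1
      refine integral_congr_ae ?_
      filter_upwards [hΘd, hΨd] with z hz1 hz2
      have e1 : HasDerivAt (timeCutoff τ δ) _ z.2 :=
        hz1.hasFDerivAt.hasDerivAt_snd (x := z.1) (t := z.2)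
      have e2 : HasDerivAt Ψ _ z.1 := hz2.hasFDerivAt.hasDerivAt_fst (x := z.1) (t := z.2)
      have e3 : fderiv ℝ (fun z : ℝ × ℝ => timeCutoff τ δ z.2) z (1, 0) = 0 :=
        (hz1.hasFDerivAt.hasDerivAt_fst (x := z.1) (t := z.2)).unique (hasDerivAt_const z.1 (timeCutoff τ δ z.2))
      have e4 : fderiv ℝ (fun z : ℝ × ℝ => Ψ z.1) z (0, 1) = 0 :=
        (hz2.hasFDerivAt.hasDerivAt_snd (x := z.1) (t := z.2)).unique (hasDerivAt_const z.2 (Ψ z.1))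
      rw [(hz1.hasFDerivAt.fun_smul hz2.hasFDerivAt).fderiv, e1.deriv, e2.deriv]
      simp only [add_apply, smul_apply, ContinuousLinearMap.smulRight_apply, e3, e4, smul_zero,
        zero_smul, add_zero, zero_add, inner_smul_right]
      ring
  simpa only [integral_neg] using hmain

theorem IsEntropySolution.ae_slice_eq (hu : IsEntropySolution U f η q u₀ u)
    (hD : IsCompact D) (hf : ContinuousOn f D) (huD : ∀ᵐ z ∂cylMeasure, u z.1 z.2 ∈ D)
    {Ψ : ℝ → Vec d} {K C : ℝ≥0} (hΨ : LipschitzWith K Ψ) (hC : ∀ x, ‖Ψ x‖ ≤ C)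
    (hper : ∀ x, Ψ (x + 1) = Ψ x) :
    ∀ᵐ t ∂(volume.restrict (Ioi (0 : ℝ))), ∫ x in Ioo (0 : ℝ) 1, inner ℝ (u x t) (Ψ x) =
      (∫ x in Ioo (0 : ℝ) 1, inner ℝ (u₀ x) (Ψ x)) +
        ∫ s in Ioo 0 t, ∫ x in Ioo (0 : ℝ) 1, inner ℝ (f (u x s)) (deriv Ψ x) := by
  filter_upwards [hu.ae_slice_le hD hf huD hΨ hC hper,
    hu.ae_slice_le hD hf huD hΨ.neg (fun x => by simpa using hC x) (fun x => by simp [hper])]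
    with t h1 h2
  have hd : deriv (-Ψ) = -deriv Ψ := by ext1 x; exact deriv.neg
  simp only [hd, Pi.neg_apply, inner_neg_right, integral_neg, neg_neg] at h1 h2
  linarith

end SliceIdentity

/-! ### Weak-* continuity of the spatial derivative of a Lipschitz function -/

section WeakStarDerivative

open Filter
open scoped NNReal Topology

variable {F : Type*} [NormedAddCommGroup F] [InnerProductSpace ℝ F] [FiniteDimensional ℝ F]

/-- The spatial derivative of a Lipschitz function of space and time is weak-* continuous in
time. -/
theorem continuous_integral_inner_deriv {W : ℝ × ℝ → F} {K : ℝ≥0} (hW : LipschitzWith K W)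
    {ψ : ℝ → F} (hψ : Integrable ψ (volume.restrict (Ioo (0 : ℝ) 1))) :
    Continuous fun t => ∫ x in Ioo (0 : ℝ) 1, inner ℝ (deriv (fun y => W (y, t)) x) (ψ x) := by
  borelize F
  have hWb (x t : ℝ) : ‖deriv (fun y => W (y, t)) x‖ ≤ K :=
    norm_deriv_le_of_lipschitz (hW.comp_prodMk_right t)
  have hWm (t : ℝ) : AEStronglyMeasurable (fun x => deriv (fun y => W (y, t)) x)
      (volume.restrict (Ioo (0 : ℝ) 1)) := (stronglyMeasurable_deriv _).aestronglyMeasurable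
  have hint {φ : ℝ → F} (hφ : Integrable φ (volume.restrict (Ioo (0 : ℝ) 1))) (t : ℝ) :
      Integrable (fun x => (inner ℝ (deriv (fun y => W (y, t)) x) (φ x) : ℝ))
        (volume.restrict (Ioo (0 : ℝ) 1)) := by
    refine (hφ.norm.const_mul (K : ℝ)).mono' ((hWm t).inner hφ.1) (Eventually.of_forall fun x => ?_)
    exact (norm_inner_le_norm _ _).trans
      (mul_le_mul_of_nonneg_right (hWb x t) (norm_nonneg _))
  -- smooth weights
  have hsmooth {φ : ℝ → F} (hφ : ContDiff ℝ ∞ φ) :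
      Continuous fun t => ∫ x in Ioo (0 : ℝ) 1, inner ℝ (deriv (fun y => W (y, t)) x) (φ x) := by
    have hφd : Differentiable ℝ φ := hφ.differentiable (by simp)
    have hφ' : Continuous (deriv φ) := hφ.continuous_deriv (by simp)
    obtain ⟨C, hC⟩ := isCompact_Icc.exists_bound_of_continuousOn (s := Icc (0 : ℝ) 1)
      hφ.continuous.continuousOn
    -- Integration by parts moves the derivative to φ and leaves values of W, which are continuous
    -- in t. W is not assumed periodic, so the boundary terms stay.
    have heq (t : ℝ) : ∫ x in Ioo (0 : ℝ) 1, inner ℝ (deriv (fun y => W (y, t)) x) (φ x) =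
        inner ℝ (W (1, t)) (φ 1) - inner ℝ (W (0, t)) (φ 0)
          - ∫ x in (0 : ℝ)..1, inner ℝ (W (x, t)) (deriv φ x) := by
      have hlip := hW.comp_prodMk_right t
      have hφl : ∃ K', LipschitzOnWith K' φ (uIcc 0 1) := by
        obtain ⟨C', hC'⟩ := isCompact_uIcc.exists_bound_of_continuousOn (s := uIcc (0 : ℝ) 1)
          hφ'.continuousOn
        refine ⟨C'.toNNReal, (convex_uIcc 0 1).lipschitzOnWith_of_nnnorm_deriv_le
          (fun x _ => hφd x) fun x hx => ?_⟩
        rw [← NNReal.coe_le_coe, coe_nnnorm]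
        exact (hC' x hx).trans (Real.le_coe_toNNReal C')
      obtain ⟨K', hK'⟩ := hφl
      obtain ⟨CW, hCW⟩ := isCompact_uIcc.exists_bound_of_continuousOn (s := uIcc (0 : ℝ) 1)
        hlip.continuous.continuousOn
      have hprod : LipschitzOnWith (CW.toNNReal * K' + K * C.toNNReal)
          (fun x => (inner ℝ (W (x, t)) (φ x) : ℝ)) (uIcc 0 1) := by
        refine LipschitzOnWith.of_dist_le_mul fun x hx y hy => ?_
        have e : (inner ℝ (W (x, t)) (φ x) - inner ℝ (W (y, t)) (φ y) : ℝ) =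
            inner ℝ (W (x, t)) (φ x - φ y) + inner ℝ (W (x, t) - W (y, t)) (φ y) := by
          rw [inner_sub_right, inner_sub_left]; ring
        have h1 : ‖W (x, t)‖ ≤ CW.toNNReal := (hCW x hx).trans (Real.le_coe_toNNReal CW)
        have h2 : ‖φ y‖ ≤ C.toNNReal :=
          (hC y (by rwa [uIcc_of_le zero_le_one] at hy)).trans (Real.le_coe_toNNReal C)
        have h3 := hK'.dist_le_mul x hx y hy
        have h4 := hlip.dist_le_mul x y
        rw [dist_eq_norm] at h3 h4
        rw [Real.dist_eq, e]
        refine (abs_add_le _ _).trans ?_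
        have h5 := (abs_real_inner_le_norm (W (x, t)) (φ x - φ y)).trans
          (mul_le_mul h1 h3 (norm_nonneg _) (NNReal.coe_nonneg _))
        have h6 := (abs_real_inner_le_norm (W (x, t) - W (y, t)) (φ y)).trans
          (mul_le_mul h4 h2 (norm_nonneg _) (by positivity))
        refine (add_le_add h5 h6).trans (le_of_eq ?_)
        push_cast; ring
      have hftc := hprod.absolutelyContinuousOnInterval.integral_deriv_eq_sub
      rw [← hftc]
      have hae : ∀ᵐ x ∂volume, x ∈ Ioc (0 : ℝ) 1 → deriv (fun x => (inner ℝ (W (x, t)) (φ x) : ℝ)) x =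
          inner ℝ (W (x, t)) (deriv φ x) + inner ℝ (deriv (fun y => W (y, t)) x) (φ x) := by
        filter_upwards [hlip.ae_differentiableAt_real] with x hx _
        exact (hx.hasDerivAt.inner ℝ (hφd x).hasDerivAt).deriv
      have hi1 : IntervalIntegrable (fun x => (inner ℝ (W (x, t)) (deriv φ x) : ℝ)) volume 0 1 :=
        (hlip.continuous.inner hφ').intervalIntegrable _ _
      have hi2 : IntervalIntegrable (fun x => (inner ℝ (deriv (fun y => W (y, t)) x) (φ x) : ℝ))
          volume 0 1 := by
        rw [intervalIntegrable_iff_integrableOn_Ioo_of_le zero_le_one]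
        exact hint (hφ.continuous.integrableOn_Icc.mono_set Ioo_subset_Icc_self) t
      rw [intervalIntegral.integral_congr_ae (by rwa [uIoc_of_le zero_le_one]),
        intervalIntegral.integral_add hi1 hi2, add_sub_cancel_left,
        intervalIntegral.integral_of_le zero_le_one, integral_Ioc_eq_integral_Ioo]
    simp only [heq]
    have hWc := hW.continuous
    refine ((Continuous.inner (by fun_prop) continuous_const).sub
      (Continuous.inner (by fun_prop) continuous_const)).sub ?_
    refine intervalIntegral.continuous_parametric_intervalIntegral_of_continuous' ?_ 0 1
    exact Continuous.inner (hWc.comp (by fun_prop)) (hφ'.comp continuous_snd)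
  -- approximation of integrable weights
  have hψ' : MemLp ((Ioo (0 : ℝ) 1).indicator ψ) 1 volume := by
    rw [memLp_one_iff_integrable, integrable_indicator_iff measurableSet_Ioo]; exact hψ
  have happrox (k : ℕ) := hψ'.exist_eLpNorm_sub_le ENNReal.one_ne_top le_rfl
    (ε := 1 / ((k : ℝ) + 1)) (by positivity)
  choose φ hφc hφs hφ using happrox
  have hφi (k : ℕ) : Integrable (φ k) := (hφs k).continuous.integrable_of_hasCompactSupport (hφc k)
  have hL1 (k : ℕ) : ∫ x in Ioo (0 : ℝ) 1, ‖ψ x - φ k x‖ ≤ 1 / ((k : ℝ) + 1) := by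
    have hi : Integrable ((Ioo (0 : ℝ) 1).indicator ψ - φ k) :=
      (memLp_one_iff_integrable.1 hψ').sub (hφi k)
    have h1 : ∫ x in Ioo (0 : ℝ) 1, ‖ψ x - φ k x‖ =
        ∫ x in Ioo (0 : ℝ) 1, ‖((Ioo (0 : ℝ) 1).indicator ψ - φ k) x‖ :=
      setIntegral_congr_fun measurableSet_Ioo fun x hx => by simp [hx.1, hx.2]
    rw [h1]
    refine (setIntegral_le_integral hi.norm (Eventually.of_forall fun x => norm_nonneg _)).trans ?_
    rw [integral_norm_eq_lintegral_enorm hi.1, ← eLpNorm_one_eq_lintegral_enorm]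
    exact ENNReal.toReal_le_of_le_ofReal (by positivity) (hφ k)
  -- The error is at most K times the L¹ distance of the weights, uniformly in t, and a uniform
  -- limit of continuous functions is continuous.
  have hunif : TendstoUniformly
      (fun (k : ℕ) t => ∫ x in Ioo (0 : ℝ) 1, (inner ℝ (deriv (fun y => W (y, t)) x) (φ k x) : ℝ))
      (fun t => ∫ x in Ioo (0 : ℝ) 1, inner ℝ (deriv (fun y => W (y, t)) x) (ψ x)) atTop := by
    rw [Metric.tendstoUniformly_iff]
    intro ε hε
    have hlim : Tendsto (fun k : ℕ => (K : ℝ) * (1 / ((k : ℝ) + 1))) atTop (𝓝 0) := by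
      simpa using (tendsto_one_div_add_atTop_nhds_zero_nat (𝕜 := ℝ)).const_mul (K : ℝ)
    filter_upwards [hlim.eventually (gt_mem_nhds hε)] with k hk t
    refine lt_of_le_of_lt ?_ hk
    have hφk := (hφi k).integrableOn (s := Ioo (0 : ℝ) 1)
    rw [Real.dist_eq, ← integral_sub (hint hψ t) (hint hφk t), ← Real.norm_eq_abs]
    refine (norm_integral_le_of_norm_le ((hψ.sub hφk).norm.const_mul (K : ℝ))
      (Eventually.of_forall fun x => ?_)).trans ?_
    · rw [← inner_sub_right]
      exact (norm_inner_le_norm _ _).trans (mul_le_mul_of_nonneg_right (hWb x t) (norm_nonneg _))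
    · rw [integral_const_mul]
      exact mul_le_mul_of_nonneg_left (hL1 k) K.2
  exact hunif.continuous (Eventually.of_forall fun k => hsmooth (hφs k)).frequently

end WeakStarDerivative

/-! ### The space-time Lipschitz potential of a solution -/

section Potential

open Filter
open scoped NNReal Topology

variable {d : ℕ} {U D : Set (Vec d)} {f : Vec d → Vec d} {η q : Vec d → ℝ} {u₀ : ℝ → Vec d}
  {u : ℝ → ℝ → Vec d}

/-- The periodic extension of a trapezoidal function, in direction `e`. -/
noncomputable def periodicTrapezoid (b n : ℝ) (e : Vec d) (x : ℝ) : Vec d :=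
  trapezoid b n (Int.fract x) • e

theorem lipschitzWith_periodicTrapezoid {b n : ℝ} (hn : 0 ≤ n) (hb : b ≤ 1) (e : Vec d) :
    LipschitzWith (1 * 0 + Real.nnabs n * ‖e‖₊) (periodicTrapezoid b n e) := by
  refine LipschitzWith.smul_of_bounded ?_ (LipschitzWith.const e) (fun x => ?_) (fun x => le_rfl)
  · refine (lipschitzWith_trapezoid.lipschitzOnWith).lipschitzWith_comp_fract ?_
    rw [trapezoid_of_notMem hn (Or.inl le_rfl), trapezoid_of_notMem hn (Or.inr hb)]
  · rw [Real.norm_of_nonneg (trapezoid_nonneg _)]; exact trapezoid_le_one _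

theorem norm_periodicTrapezoid_le {b n : ℝ} (e : Vec d) (x : ℝ) :
    ‖periodicTrapezoid b n e x‖ ≤ ‖e‖ := by
  rw [periodicTrapezoid, norm_smul, Real.norm_of_nonneg (trapezoid_nonneg _)]
  exact mul_le_of_le_one_left (norm_nonneg _) (trapezoid_le_one _)

theorem integral_norm_deriv_periodicTrapezoid_le {b n : ℝ} (hn : 0 < n) {e : Vec d}
    (he : ‖e‖ = 1) :
    ∫ x in Ioo (0 : ℝ) 1, ‖deriv (periodicTrapezoid b n e) x‖ ≤ 2 := by
  refine (le_of_eq ?_).trans (integral_abs_deriv_trapezoid_le (b := b) hn)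
  refine setIntegral_congr_ae measurableSet_Ioo ?_
  filter_upwards [(lipschitzWith_trapezoid (b := b) (n := n)).ae_differentiableAt_real] with x hx hm
  have h1 : periodicTrapezoid b n e =ᶠ[𝓝 x] fun y => trapezoid b n y • e := by
    filter_upwards [fract_eventuallyEq hm] with y hy
    rw [periodicTrapezoid, hy]
  rw [h1.deriv_eq, (hx.hasDerivAt.smul_const e).deriv, norm_smul, he, mul_one, Real.norm_eq_abs]

theorem norm_le_card_mul_of_abs_inner_le {z : Vec d} {C : ℝ}
    (h : ∀ i : Fin d, |inner ℝ z (EuclideanSpace.single i (1 : ℝ))| ≤ C) : ‖z‖ ≤ d * C := by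
  have h1 := (EuclideanSpace.basisFun (Fin d) ℝ).sum_repr' z
  calc ‖z‖ = ‖∑ i, inner ℝ (EuclideanSpace.basisFun (Fin d) ℝ i) z •
        EuclideanSpace.basisFun (Fin d) ℝ i‖ := by rw [h1]
    _ ≤ ∑ _i : Fin d, C := by
        refine norm_sum_le_of_le _ fun i _ => ?_
        rw [norm_smul, (EuclideanSpace.basisFun (Fin d) ℝ).norm_eq_one, mul_one,
          EuclideanSpace.basisFun_apply, real_inner_comm]
        exact h i
    _ = d * C := by simp

/-- The slices of a solution, completed by the initial datum at time zero. -/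
noncomputable def slice (u₀ : ℝ → Vec d) (u : ℝ → ℝ → Vec d) (t x : ℝ) : Vec d :=
  if t = 0 then u₀ x else u x t

theorem norm_intervalIntegral_le_of_ae {v : ℝ → Vec d} {C : ℝ}
    (hC : ∀ᵐ x ∂(volume.restrict (Ioo (0 : ℝ) 1)), ‖v x‖ ≤ C) {a b : ℝ}
    (ha : a ∈ Icc (0 : ℝ) 1) (hb : b ∈ Icc (0 : ℝ) 1) :
    ‖∫ x in a..b, v x‖ ≤ C * |b - a| := by
  refine intervalIntegral.norm_integral_le_of_norm_le_const_ae ?_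
  have h1 : ∀ᵐ x : ℝ, x ≠ 1 := by simp [ae_iff, measure_singleton]
  filter_upwards [(ae_restrict_iff' measurableSet_Ioo).1 hC, h1] with x hx hx1 hm
  rw [uIoc, mem_Ioc] at hm
  exact hx ⟨(le_min ha.1 hb.1).trans_lt hm.1, lt_of_le_of_ne (hm.2.trans (max_le ha.2 hb.2)) hx1⟩

theorem intervalIntegrable_of_ae_bound {v : ℝ → Vec d} {C : ℝ}
    (hv : AEStronglyMeasurable v (volume.restrict (Ioo (0 : ℝ) 1)))
    (hC : ∀ᵐ x ∂(volume.restrict (Ioo (0 : ℝ) 1)), ‖v x‖ ≤ C) {a b : ℝ}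
    (ha : a ∈ Icc (0 : ℝ) 1) (hb : b ∈ Icc (0 : ℝ) 1) : IntervalIntegrable v volume a b := by
  have h1 : IntervalIntegrable v volume 0 1 := by
    rw [intervalIntegrable_iff_integrableOn_Ioo_of_le zero_le_one]
    exact IntegrableOn.of_bound (by simp) hv C hC
  refine h1.mono_set ?_
  rw [uIcc_of_le zero_le_one]
  exact uIcc_subset_Icc ha hb

/-- W is Lipschitz in x because u is bounded. In time, formally ∂ₜW = f(u(0,t)) - f(u(x,t)) is
bounded; this is made rigorous by testing with trapezoids that tend to the indicator of (0,x), whose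
derivatives have L¹ norm at most 2. Treating u₀ as the slice at t = 0 ties W(·,0) to the initial
datum. -/
theorem IsEntropySolution.exists_potential (hu : IsEntropySolution U f η q u₀ u)
    (hD : IsCompact D) (hf : ContinuousOn f D) (huD : ∀ᵐ z ∂cylMeasure, u z.1 z.2 ∈ D) :
    ∃ (W : ℝ × ℝ → Vec d) (K : ℝ≥0), LipschitzWith K W ∧
      (∀ᵐ t ∂(volume.restrict (Ioi (0 : ℝ))), ∀ x ∈ Icc (0 : ℝ) 1,
        W (x, t) = ∫ y in (0 : ℝ)..x, u y t) ∧
      ∀ x ∈ Icc (0 : ℝ) 1, W (x, 0) = ∫ y in (0 : ℝ)..x, u₀ y := by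
  obtain ⟨CA, hCA⟩ := hD.exists_bound_of_continuousOn (f := id) continuousOn_id
  obtain ⟨CB, hCB⟩ := hD.exists_bound_of_continuousOn hf
  obtain ⟨C₀, hC₀0, hC₀⟩ := hu.memLp_init.exists_ae_norm_le
  set C := max CA C₀ with hCdef
  have hC0 : 0 ≤ C := hC₀0.trans (le_max_right _ _)
  set Λ := max CB 0 with hΛdef
  have hΛ0 : 0 ≤ Λ := le_max_right _ _
  have hm := hu.aestronglyMeasurable
  have hmf := aestronglyMeasurable_comp_of_continuousOn hm hf hD.isClosed huD
  -- Countably many tests, so that a single null set of times is excluded. The minimum with 1 keeps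
  -- every trapezoid supported in one period, hence its periodic extension Lipschitz.
  set Ψ : ℚ → ℕ → Fin d → ℝ → Vec d := fun r k i =>
    periodicTrapezoid (min (r : ℝ) 1) ((k : ℝ) + 1) (EuclideanSpace.single i (1 : ℝ)) with hΨ
  set Bf : ℚ → ℕ → Fin d → ℝ → ℝ := fun r k i s =>
    ∫ x in Ioo (0 : ℝ) 1, inner ℝ (f (u x s)) (deriv (Ψ r k i) x) with hBf
  have hsingle (i : Fin d) : ‖(EuclideanSpace.single i (1 : ℝ) : Vec d)‖ = 1 := by simp
  have hΨlip (r : ℚ) (k : ℕ) (i : Fin d) :=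
    lipschitzWith_periodicTrapezoid (b := min (r : ℝ) 1) (n := (k : ℝ) + 1) (by positivity)
      (min_le_right _ _) (EuclideanSpace.single i (1 : ℝ) : Vec d)
  have hid : ∀ᵐ t ∂(volume.restrict (Ioi (0 : ℝ))), ∀ (r : ℚ) (k : ℕ) (i : Fin d),
      ∫ x in Ioo (0 : ℝ) 1, inner ℝ (u x t) (Ψ r k i x) =
      (∫ x in Ioo (0 : ℝ) 1, inner ℝ (u₀ x) (Ψ r k i x)) + ∫ s in Ioo 0 t, Bf r k i s := by
    simp only [ae_all_iff]
    intro r k i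
    exact hu.ae_slice_eq hD hf huD (hΨlip r k i) (C := 1)
      (fun x => (norm_periodicTrapezoid_le _ x).trans (hsingle i).le)
      (fun x => by simp [hΨ, periodicTrapezoid])
  have hBfC (r : ℚ) (k : ℕ) (i : Fin d) :
      ∀ᵐ s ∂(volume.restrict (Ioi (0 : ℝ))), ‖Bf r k i s‖ ≤ 2 * Λ := by
    filter_upwards [ae_ae_of_ae_cylMeasure huD] with s hs
    have hint : Integrable (fun x => ‖deriv (Ψ r k i) x‖) (volume.restrict (Ioo (0 : ℝ) 1)) :=
      Integrable.of_bound (measurable_deriv _).norm.aestronglyMeasurable _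
        (Eventually.of_forall fun x => by
          rw [norm_norm]; exact norm_deriv_le_of_lipschitz (hΨlip r k i))
    refine (norm_integral_le_of_norm_le (hint.const_mul Λ) ?_).trans ?_
    · filter_upwards [hs] with x hx
      refine (norm_inner_le_norm _ _).trans (mul_le_mul_of_nonneg_right ?_ (norm_nonneg _))
      exact (hCB _ hx).trans (le_max_left _ _)
    · rw [integral_const_mul, mul_comm 2 Λ]
      exact mul_le_mul_of_nonneg_left
        (integral_norm_deriv_periodicTrapezoid_le (by positivity) (hsingle i)) hΛ0
  have hBfm (r : ℚ) (k : ℕ) (i : Fin d) :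
      AEStronglyMeasurable (Bf r k i) (volume.restrict (Ioi (0 : ℝ))) := by
    have h1 : AEStronglyMeasurable
        (fun z : ℝ × ℝ => (inner ℝ (f (u z.1 z.2)) (deriv (Ψ r k i) z.1) : ℝ)) cylMeasure :=
      hmf.inner ((measurable_deriv (Ψ r k i)).comp measurable_fst).aestronglyMeasurable
    exact aestronglyMeasurable_integral_slice h1
  have hBfdiff (r : ℚ) (k : ℕ) (i : Fin d) {s t : ℝ} (hs : 0 ≤ s) (ht : 0 ≤ t) :
      |(∫ a in Ioo 0 t, Bf r k i a) - ∫ a in Ioo 0 s, Bf r k i a| ≤ 2 * Λ * |t - s| := by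
    have hii {t : ℝ} (ht : 0 ≤ t) : IntervalIntegrable (Bf r k i) volume 0 t := by
      rw [intervalIntegrable_iff_integrableOn_Ioo_of_le ht]
      exact IntegrableOn.of_bound (by simp) ((hBfm r k i).mono_set Ioo_subset_Ioi_self) _
        (ae_mono (Measure.restrict_mono Ioo_subset_Ioi_self le_rfl) (hBfC r k i))
    rw [← integral_Ioc_eq_integral_Ioo, ← integral_Ioc_eq_integral_Ioo,
      ← intervalIntegral.integral_of_le ht, ← intervalIntegral.integral_of_le hs,
      intervalIntegral.integral_interval_sub_left (hii ht) (hii hs)]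
    rw [← Real.norm_eq_abs]
    refine intervalIntegral.norm_integral_le_of_norm_le_const_ae ?_
    filter_upwards [(ae_restrict_iff' measurableSet_Ioi).1 (hBfC r k i)] with a ha hm
    rw [uIoc, mem_Ioc] at hm
    exact ha ((le_min hs ht).trans_lt hm.1)
  -- the set of good times
  set S : Set ℝ := {t | 0 ≤ t ∧
    AEStronglyMeasurable (slice u₀ u t) (volume.restrict (Ioo (0 : ℝ) 1)) ∧
    (∀ᵐ x ∂(volume.restrict (Ioo (0 : ℝ) 1)), ‖slice u₀ u t x‖ ≤ C) ∧
    ∀ (r : ℚ) (k : ℕ) (i : Fin d), ∫ x in Ioo (0 : ℝ) 1, inner ℝ (slice u₀ u t x) (Ψ r k i x) =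
      (∫ x in Ioo (0 : ℝ) 1, inner ℝ (u₀ x) (Ψ r k i x)) + ∫ s in Ioo 0 t, Bf r k i s} with hS
  have h0S : (0 : ℝ) ∈ S := by
    have : slice u₀ u 0 = u₀ := by ext1 x; simp [slice]
    refine ⟨le_rfl, ?_, ?_, fun r k i => ?_⟩
    · rw [this]; exact hu.memLp_init.1
    · rw [this]; exact hC₀.mono fun x hx => hx.trans (le_max_right _ _)
    · simp [this]
  have hSae : ∀ᵐ t ∂(volume.restrict (Ioi (0 : ℝ))), t ∈ S := by
    filter_upwards [hid, ae_ae_of_ae_cylMeasure huD, hm.prod_swap.prodMk_left,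
      ae_restrict_mem measurableSet_Ioi] with t h1 h2 h3 h4
    have : slice u₀ u t = fun x => u x t := by ext1 x; simp [slice, (mem_Ioi.1 h4).ne']
    refine ⟨(mem_Ioi.1 h4).le, ?_, ?_, ?_⟩
    · rw [this]; exact h3
    · rw [this]; exact h2.mono fun x hx => (hCA _ hx).trans (le_max_left _ _)
    · rw [this]; exact h1
  have h01 : (0 : ℝ) ∈ Icc (0 : ℝ) 1 := left_mem_Icc.2 zero_le_one
  -- passage to the limit in the trapezoids
  have hlim {t : ℝ} (ht : t ∈ S) (r : ℚ) (hr : 0 < r) (hr1 : r ≤ 1) (i : Fin d) :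
      Tendsto (fun k => ∫ x in Ioo (0 : ℝ) 1, (inner ℝ (slice u₀ u t x) (Ψ r k i x) : ℝ)) atTop
        (𝓝 (inner ℝ (∫ x in (0 : ℝ)..r, slice u₀ u t x) (EuclideanSpace.single i (1 : ℝ)))) := by
    have hr1' : (r : ℝ) ≤ 1 := by exact_mod_cast hr1
    have hr0' : (0 : ℝ) < r := by exact_mod_cast hr
    have hint : Integrable (slice u₀ u t) (volume.restrict (Ioo (0 : ℝ) 1)) :=
      Integrable.of_bound ht.2.1 C ht.2.2.1
    have heq : inner ℝ (∫ x in (0 : ℝ)..r, slice u₀ u t x) (EuclideanSpace.single i (1 : ℝ)) =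
        ∫ x in Ioo (0 : ℝ) 1, inner ℝ (slice u₀ u t x)
          ((Iio (r : ℝ)).indicator (1 : ℝ → ℝ) x • EuclideanSpace.single i (1 : ℝ)) := by
      rw [intervalIntegral.integral_of_le hr0'.le, integral_Ioc_eq_integral_Ioo, real_inner_comm,
        ← integral_inner (hint.mono_measure (Measure.restrict_mono
          (Ioo_subset_Ioo_right hr1') le_rfl))]
      have h1 : ∀ x, (inner ℝ (slice u₀ u t x)
          ((Iio (r : ℝ)).indicator (1 : ℝ → ℝ) x • EuclideanSpace.single i (1 : ℝ)) : ℝ) =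
          (Iio (r : ℝ)).indicator
            (fun x => inner ℝ (EuclideanSpace.single i (1 : ℝ)) (slice u₀ u t x)) x := fun x => by
        by_cases hx : x ∈ Iio (r : ℝ)
        · rw [indicator_of_mem hx, indicator_of_mem hx, Pi.one_apply, one_smul, real_inner_comm]
        · rw [indicator_of_notMem hx, indicator_of_notMem hx, zero_smul, inner_zero_right]
      simp only [h1]
      rw [setIntegral_indicator measurableSet_Iio, Ioo_inter_Iio, min_eq_right hr1']
    rw [heq]
    refine tendsto_integral_of_dominated_convergence (fun _ => C) (fun k => ?_)
      (integrable_const _) (fun k => ?_) ?_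
    · exact ht.2.1.inner (hΨlip r k i).continuous.aestronglyMeasurable
    · filter_upwards [ht.2.2.1] with x hx
      refine (norm_inner_le_norm _ _).trans ((mul_le_of_le_one_right (norm_nonneg _) ?_).trans hx)
      exact (norm_periodicTrapezoid_le _ x).trans (hsingle i).le
    · have h1 : ∀ᵐ x ∂(volume.restrict (Ioo (0 : ℝ) 1)), x ≠ (r : ℝ) :=
        ae_restrict_of_ae (by simp [ae_iff, measure_singleton])
      filter_upwards [h1, ae_restrict_mem measurableSet_Ioo] with x hx hxm
      refine tendsto_const_nhds.inner ?_
      simp only [hΨ, periodicTrapezoid, min_eq_left hr1', Int.fract_eq_self.2 ⟨hxm.1.le, hxm.2⟩]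
      exact (tendsto_trapezoid hx hxm.1).smul_const _
  have hrat {s t : ℝ} (hs : s ∈ S) (ht : t ∈ S) (r : ℚ) (hr : 0 < r) (hr1 : r ≤ 1) :
      ‖(∫ x in (0 : ℝ)..r, slice u₀ u t x) - ∫ x in (0 : ℝ)..r, slice u₀ u s x‖ ≤
        d * (2 * Λ * |t - s|) := by
    refine norm_le_card_mul_of_abs_inner_le fun i => ?_
    rw [inner_sub_left]
    -- The initial terms cancel between the two times, and the bound on the flux integrals is
    -- uniform in k.
    refine le_of_tendsto' ((hlim ht r hr hr1 i).sub (hlim hs r hr hr1 i)).abs fun k => ?_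
    rw [ht.2.2.2 r k i, hs.2.2.2 r k i, add_sub_add_left_eq_sub]
    exact hBfdiff r k i hs.1 ht.1
  set W₀ : ℝ × ℝ → Vec d := fun z => ∫ x in (0 : ℝ)..z.1, slice u₀ u z.2 x with hW₀
  have hspace {t : ℝ} (ht : t ∈ S) {x y : ℝ} (hx : x ∈ Icc (0 : ℝ) 1) (hy : y ∈ Icc (0 : ℝ) 1) :
      ‖W₀ (x, t) - W₀ (y, t)‖ ≤ C * |x - y| := by
    have hii {x : ℝ} (hx : x ∈ Icc (0 : ℝ) 1) :=
      intervalIntegrable_of_ae_bound ht.2.1 ht.2.2.1 h01 hx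
    simp only [hW₀]
    rw [intervalIntegral.integral_interval_sub_left (hii hx) (hii hy)]
    exact norm_intervalIntegral_le_of_ae ht.2.2.1 hy hx
  have htime {s t : ℝ} (hs : s ∈ S) (ht : t ∈ S) {x : ℝ} (hx : x ∈ Icc (0 : ℝ) 1) :
      ‖W₀ (x, t) - W₀ (x, s)‖ ≤ d * (2 * Λ * |t - s|) := by
    rcases hx.1.eq_or_lt with h0 | h0
    · simp only [hW₀, ← h0, intervalIntegral.integral_same, sub_zero, norm_zero]
      positivity
    · refine le_of_forall_pos_le_add fun ε hε => ?_
      -- Replacing x by a rational r at two times costs 2C(x - r) ≤ ε; the added 1 avoids division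
      -- by zero.
      have hδ : 0 < ε / (2 * C + 1) := by positivity
      obtain ⟨r, hr1, hr2⟩ := exists_rat_btwn (show max 0 (x - ε / (2 * C + 1)) < x from
        max_lt h0 (by linarith))
      have hr0 : (0 : ℝ) < r := (le_max_left _ _).trans_lt hr1
      have hr3 : x - ε / (2 * C + 1) < r := (le_max_right _ _).trans_lt hr1
      have hrm : (r : ℝ) ∈ Icc (0 : ℝ) 1 := ⟨hr0.le, hr2.le.trans hx.2⟩
      have e1 := hspace ht hx hrm
      have e2 := hspace hs hrm hx
      have e3 := hrat hs ht r (by exact_mod_cast hr0) (by exact_mod_cast hrm.2)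
      rw [abs_sub_comm, abs_of_nonpos (by linarith)] at e1
      rw [abs_of_nonpos (by linarith)] at e2
      have e4 : (x - r) * (2 * C + 1) ≤ ε := by
        have : x - r ≤ ε / (2 * C + 1) := by linarith
        rwa [le_div_iff₀ (by positivity)] at this
      have e5 : W₀ (x, t) - W₀ (x, s) = (W₀ (x, t) - W₀ (r, t)) + (W₀ (r, t) - W₀ (r, s))
          + (W₀ (r, s) - W₀ (x, s)) := by abel
      rw [e5]
      refine (norm_add₃_le).trans ?_
      have e6 : ‖W₀ (r, t) - W₀ (r, s)‖ ≤ d * (2 * Λ * |t - s|) := e3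
      nlinarith
  have hW₀lip : LipschitzOnWith (C + d * (2 * Λ)).toNNReal W₀ (Icc 0 1 ×ˢ S) := by
    refine LipschitzOnWith.of_dist_le_mul fun z hz w hw => ?_
    rw [Real.coe_toNNReal _ (by positivity), dist_eq_norm]
    have e1 := hspace hz.2 hz.1 hw.1
    have e2 := htime hw.2 hz.2 hw.1
    have h1 : |z.1 - w.1| ≤ dist z w := by rw [Prod.dist_eq]; exact le_max_left _ _
    have h2 : |z.2 - w.2| ≤ dist z w := by rw [Prod.dist_eq]; exact le_max_right _ _
    calc ‖W₀ z - W₀ w‖ = ‖(W₀ (z.1, z.2) - W₀ (w.1, z.2)) + (W₀ (w.1, z.2) - W₀ (w.1, w.2))‖ := by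
          congr 1; simp
      _ ≤ C * |z.1 - w.1| + d * (2 * Λ * |z.2 - w.2|) := (norm_add_le _ _).trans (add_le_add e1 e2)
      _ ≤ C * dist z w + d * (2 * Λ * dist z w) := by gcongr
      _ = _ := by ring
  -- The good times need not be all times, so W is obtained as a Lipschitz extension to the whole
  -- plane.
  obtain ⟨W, hWlip, hWeq⟩ := hW₀lip.extend_finite_dimension
  refine ⟨W, _, hWlip, ?_, fun x hx => ?_⟩
  · filter_upwards [hSae, ae_restrict_mem measurableSet_Ioi] with t ht ht0 x hx
    rw [← hWeq (mk_mem_prod hx ht)]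
    simp only [hW₀, slice, (mem_Ioi.1 ht0).ne', if_false]
  · rw [← hWeq (mk_mem_prod hx h0S)]
    simp only [hW₀, slice, if_true]

end Potential

/-! ### Values of the initial datum and the weak-* continuous representative -/

section WeakStarRepresentative

open Filter
open scoped NNReal Topology

theorem exists_seq_tendsto_of_ae_restrict_Ioo {P : ℝ → Prop} {a b t : ℝ} (hab : a < b)
    (ht : t ∈ Icc a b) (h : ∀ᵐ s ∂(volume.restrict (Ioo a b)), P s) :
    ∃ s : ℕ → ℝ, Tendsto s atTop (𝓝 t) ∧ ∀ k, s k ∈ Ioo a b ∧ P (s k) := by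
  have hd : Dense {s | s ∈ Ioo a b → P s} :=
    Measure.dense_of_ae ((ae_restrict_iff' measurableSet_Ioo).1 h)
  have h1 : t ∈ closure (Ioo a b ∩ {s | s ∈ Ioo a b → P s}) := by
    rw [← closure_Ioo hab.ne] at ht
    exact closure_minimal (hd.open_subset_closure_inter isOpen_Ioo) isClosed_closure ht
  obtain ⟨s, hs, hlim⟩ := mem_closure_iff_seq_limit.1 h1
  exact ⟨s, hlim, fun k => ⟨(hs k).1, (hs k).2 (hs k).1⟩⟩

theorem ae_cylMeasure_of_ae_ae {P : ℝ × ℝ → Prop} (hP : MeasurableSet {z | P z})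
    (h : ∀ᵐ t ∂(volume.restrict (Ioi (0 : ℝ))), ∀ᵐ x ∂(volume.restrict (Ioo (0 : ℝ) 1)),
      P (x, t)) : ∀ᵐ z ∂cylMeasure, P z := by
  have hs : ∀ᵐ z ∂((volume.restrict (Ioi (0 : ℝ))).prod (volume.restrict (Ioo (0 : ℝ) 1))),
      P z.swap :=
    (Measure.ae_prod_iff_ae_ae (p := fun z : ℝ × ℝ => P z.swap) (measurable_swap hP)).2 h
  exact Measure.measurePreserving_swap.quasiMeasurePreserving.ae hs

variable {d : ℕ} {U D : Set (Vec d)} {f : Vec d → Vec d} {η q : Vec d → ℝ} {u₀ : ℝ → Vec d}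
  {u : ℝ → ℝ → Vec d}

theorem ae_hasDerivAt_of_eq_intervalIntegral {E : Type*} [NormedAddCommGroup E] [NormedSpace ℝ E]
    [CompleteSpace E] {V v : ℝ → E} (hv : Integrable v (volume.restrict (Ioo (0 : ℝ) 1)))
    (hV : ∀ x ∈ Icc (0 : ℝ) 1, V x = ∫ y in (0 : ℝ)..x, v y) :
    ∀ᵐ x ∂(volume.restrict (Ioo (0 : ℝ) 1)), HasDerivAt V (v x) x := by
  have hi : IntervalIntegrable v volume 0 1 := by
    rwa [intervalIntegrable_iff_integrableOn_Ioo_of_le zero_le_one]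
  rw [ae_restrict_iff' measurableSet_Ioo]
  filter_upwards [hi.ae_hasDerivAt_integral] with x hx hm
  rw [uIcc_of_le zero_le_one] at hx
  refine (hx (Ioo_subset_Icc_self hm) 0 (left_mem_Icc.2 zero_le_one)).congr_of_eventuallyEq ?_
  filter_upwards [isOpen_Ioo.mem_nhds hm] with y hy
  exact hV y (Ioo_subset_Icc_self hy)

/-- At almost every positive time the difference quotients of the potential are averages of u, hence
lie in the closed convex set D. By continuity they do so at t = 0, where their limits are the values
of u₀ almost everywhere. -/
theorem IsEntropySolution.init_mem_of_ae_mem (hu : IsEntropySolution U f η q u₀ u)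
    (hD : IsCompact D) (hDc : Convex ℝ D) (hf : ContinuousOn f D)
    (huD : ∀ᵐ z ∂cylMeasure, u z.1 z.2 ∈ D) :
    ∀ᵐ x ∂(volume.restrict (Ioo (0 : ℝ) 1)), u₀ x ∈ D := by
  obtain ⟨W, K, hW, hWt, hW0⟩ := hu.exists_potential hD hf huD
  have hu₀i : Integrable u₀ (volume.restrict (Ioo (0 : ℝ) 1)) :=
    hu.memLp_init.integrable le_top
  obtain ⟨CA, hCA⟩ := hD.exists_bound_of_continuousOn (f := id) continuousOn_id
  have hgood : ∀ᵐ t ∂(volume.restrict (Ioi (0 : ℝ))), ∀ x y, 0 < x → x < y → y < 1 →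
      (y - x)⁻¹ • (W (y, t) - W (x, t)) ∈ D := by
    filter_upwards [hWt, ae_ae_of_ae_cylMeasure huD,
      hu.aestronglyMeasurable.prod_swap.prodMk_left] with t h1 h2 h3 x y hx hxy hy
    have hii (a : ℝ) (ha : a ∈ Icc (0 : ℝ) 1) : IntervalIntegrable (fun y => u y t) volume 0 a :=
      intervalIntegrable_of_ae_bound h3 (h2.mono fun x hx => hCA _ hx)
        (left_mem_Icc.2 zero_le_one) ha
    have hxm : x ∈ Icc (0 : ℝ) 1 := ⟨hx.le, by linarith⟩
    have hym : y ∈ Icc (0 : ℝ) 1 := ⟨by linarith, hy.le⟩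
    rw [h1 x hxm, h1 y hym,
      intervalIntegral.integral_interval_sub_left (hii y hym) (hii x hxm),
      ← interval_average_eq]
    have hsub : uIoc x y ⊆ Ioo 0 1 := by
      rw [uIoc_of_le hxy.le]
      exact fun z hz => ⟨hx.trans hz.1, hz.2.trans_lt hy⟩
    refine hDc.set_average_mem hD.isClosed ?_ ?_
      (ae_mono (Measure.restrict_mono hsub le_rfl) h2) ?_
    · rw [uIoc_of_le hxy.le]; simp [hxy]
    · rw [uIoc_of_le hxy.le]; simp
    · exact ((hii x hxm).symm.trans (hii y hym)).def'
  have h01 : ∀ᵐ t ∂(volume.restrict (Ioo (0 : ℝ) 1)), ∀ x y, 0 < x → x < y → y < 1 →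
      (y - x)⁻¹ • (W (y, t) - W (x, t)) ∈ D :=
    ae_mono (Measure.restrict_mono Ioo_subset_Ioi_self le_rfl) hgood
  obtain ⟨s, hs, hsP⟩ := exists_seq_tendsto_of_ae_restrict_Ioo zero_lt_one
    (left_mem_Icc.2 zero_le_one) h01
  have hslope (x y : ℝ) (hx : 0 < x) (hxy : x < y) (hy : y < 1) :
      (y - x)⁻¹ • (W (y, 0) - W (x, 0)) ∈ D := by
    refine hD.isClosed.mem_of_tendsto (f := fun k => (y - x)⁻¹ • (W (y, s k) - W (x, s k)))
      (b := atTop) ?_ (Eventually.of_forall fun k => (hsP k).2 x y hx hxy hy)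
    have hc (z : ℝ) : Tendsto (fun k => W (z, s k)) atTop (𝓝 (W (z, 0))) :=
      ((hW.continuous.comp (Continuous.prodMk_right z)).tendsto 0).comp hs
    exact ((hc y).sub (hc x)).const_smul _
  filter_upwards [ae_hasDerivAt_of_eq_intervalIntegral (V := fun x => W (x, 0)) hu₀i hW0,
    ae_restrict_mem measurableSet_Ioo] with x hx hm
  have h1 : Tendsto (slope (fun x => W (x, 0)) x) (𝓝[>] x) (𝓝 (u₀ x)) :=
    (hasDerivAt_iff_tendsto_slope.1 hx).mono_left
      (nhdsWithin_mono _ fun y (hy : x < y) => hy.ne')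
  refine hD.isClosed.mem_of_tendsto h1 ?_
  filter_upwards [Ioo_mem_nhdsGT hm.2] with y hy
  rw [slope_def_module]
  exact hslope x y hm.1 hy.1 hy.2

/-- The representative is ∂ₓW. At points where W is not differentiable in x, `deriv` is 0, so the
Lipschitz constant bounds it everywhere, at every time. -/
theorem IsEntropySolution.exists_isWeakStarContRep (hu : IsEntropySolution U f η q u₀ u)
    (hD : IsCompact D) (hf : ContinuousOn f D) (huD : ∀ᵐ z ∂cylMeasure, u z.1 z.2 ∈ D) :
    ∃ v, IsWeakStarContRep u v := by
  obtain ⟨W, K, hW, hWt, -⟩ := hu.exists_potential hD hf huD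
  obtain ⟨CA, hCA⟩ := hD.exists_bound_of_continuousOn (f := id) continuousOn_id
  have hm := hu.aestronglyMeasurable
  have hderiv : ∀ᵐ t ∂(volume.restrict (Ioi (0 : ℝ))), ∀ᵐ x ∂(volume.restrict (Ioo (0 : ℝ) 1)),
      deriv (fun y => W (y, t)) x = u x t := by
    filter_upwards [hWt, ae_ae_of_ae_cylMeasure huD, hm.prod_swap.prodMk_left] with t h1 h2 h3
    have hi : Integrable (fun x => u x t) (volume.restrict (Ioo (0 : ℝ) 1)) :=
      Integrable.of_bound h3 CA (h2.mono fun x hx => hCA _ hx)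
    exact (ae_hasDerivAt_of_eq_intervalIntegral hi h1).mono fun x hx => hx.deriv
  have hmeas : StronglyMeasurable fun z : ℝ × ℝ => deriv (fun y => W (y, z.2)) z.1 := by
    have h1 : Continuous (Function.uncurry fun t y : ℝ => W (y, t)) :=
      hW.continuous.comp continuous_swap
    exact (stronglyMeasurable_deriv_with_param h1).comp_measurable measurable_swap
  refine ⟨fun x t => deriv (fun y => W (y, t)) x, ?_, fun t _ => ?_, fun ψ hψ => ?_⟩
  · rw [← cylMeasure_eq]
    refine EventuallyEq.trans ?_ hm.ae_eq_mk.symm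
    have hset : MeasurableSet {z : ℝ × ℝ | deriv (fun y => W (y, z.2)) z.1 = hm.mk _ z} :=
      hmeas.measurableSet_eq_fun hm.stronglyMeasurable_mk
    refine ae_cylMeasure_of_ae_ae hset ?_
    filter_upwards [hderiv, ae_ae_of_ae_cylMeasure hm.ae_eq_mk] with t h1 h2
    filter_upwards [h1, h2] with x h3 h4
    exact h3.trans h4
  · exact MemLp.of_bound (stronglyMeasurable_deriv _).aestronglyMeasurable K
      (Eventually.of_forall fun x => norm_deriv_le_of_lipschitz (hW.comp_prodMk_right t))
  · exact (continuous_integral_inner_deriv hW hψ).continuousOn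

end WeakStarRepresentative

/-! ### Polynomials orthogonal to lower degrees -/

section OrthogonalPolynomial

open Polynomial

/-- Integration of polynomials over `[-r, r]`. -/
noncomputable def symmIntegral (r : ℝ) : ℝ[X] →ₗ[ℝ] ℝ where
  toFun P := ∫ x in (-r)..r, P.eval x
  map_add' P Q := by
    simp only [eval_add]
    exact intervalIntegral.integral_add (P.continuous.intervalIntegrable _ _)
      (Q.continuous.intervalIntegrable _ _)
  map_smul' c P := by
    simp only [eval_smul, smul_eq_mul, intervalIntegral.integral_const_mul, RingHom.id_apply]

theorem symmIntegral_comp_neg (r : ℝ) (P : ℝ[X]) :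
    symmIntegral r (P.comp (-X)) = symmIntegral r P := by
  have := intervalIntegral.integral_comp_neg (a := -r) (b := r) fun x => P.eval x
  simpa [symmIntegral] using this

theorem Polynomial.comp_neg_X_coeff (P : ℝ[X]) (m : ℕ) :
    (P.comp (-X)).coeff m = (-1) ^ m * P.coeff m := by
  have h := comp_C_mul_X_coeff (p := P) (r := (-1 : ℝ)) (n := m)
  rw [C_neg, C_1, neg_one_mul] at h
  rw [h, mul_comm]

theorem symmIntegral_sq_nonneg {r : ℝ} (hr : 0 ≤ r) (P : ℝ[X]) : 0 ≤ symmIntegral r (P * P) := by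
  refine intervalIntegral.integral_nonneg (by linarith) fun x _ => ?_
  rw [eval_mul]; exact mul_self_nonneg _

theorem symmIntegral_derivative (r : ℝ) (P : ℝ[X]) :
    symmIntegral r (derivative P) = P.eval r - P.eval (-r) :=
  intervalIntegral.integral_eq_sub_of_hasDerivAt (fun x _ => P.hasDerivAt x)
    ((derivative P).continuous.intervalIntegrable _ _)

variable {p : ℕ} {G : ℝ[X]} {r : ℝ}

/-- The leading term of a polynomial of degree `p + 1` orthogonal to all polynomials of degree
less than `p` is nonnegatively correlated with it. -/
theorem leading_correlation_nonneg (hr : 0 ≤ r) (hG : G.degree < ((p + 2 : ℕ) : WithBot ℕ))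
    (horth : ∀ Q : ℝ[X], Q.degree < (p : WithBot ℕ) → symmIntegral r (G * Q) = 0) :
    0 ≤ G.coeff (p + 1) * symmIntegral r (G * X ^ (p + 1)) := by
  rw [degree_lt_iff_coeff_zero] at hG
  set a := G.coeff (p + 1)
  set ε : ℝ := (-1) ^ (p + 1) with hε
  have hεε : ε * ε = 1 := by rw [hε, ← mul_pow]; simp
  -- Reflection with the parity of p + 1: in G + H the coefficients of degree p cancel and the
  -- leading ones double. So G + H is 2a X^(p+1) plus a polynomial S of degree below p, to which G
  -- and H are both orthogonal.
  set H : ℝ[X] := ε • G.comp (-X) with hH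
  have hHI (Q : ℝ[X]) : symmIntegral r (H * Q) = ε * symmIntegral r (G * Q.comp (-X)) := by
    rw [hH, smul_mul_assoc, map_smul, smul_eq_mul, ← symmIntegral_comp_neg r (G * Q.comp (-X)),
      mul_comp, comp_assoc]
    simp
  set S : ℝ[X] := G + H - (2 * a) • X ^ (p + 1) with hS
  have hSdeg : S.degree < (p : WithBot ℕ) := by
    rw [degree_lt_iff_coeff_zero]
    intro m hm
    have hc : S.coeff m = G.coeff m + ε * ((-1) ^ m * G.coeff m) -
        2 * a * (if m = p + 1 then 1 else 0) := by
      simp only [hS, hH, coeff_sub, coeff_add, coeff_smul, smul_eq_mul, comp_neg_X_coeff, coeff_X_pow]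
    rw [hc]
    rcases hm.eq_or_lt with rfl | h1
    · rw [if_neg (by omega), hε, pow_succ]
      have : ((-1 : ℝ) ^ p) * (-1) ^ p = 1 := by rw [← mul_pow]; simp
      linear_combination (-G.coeff p) * this
    · rcases (Nat.succ_le_of_lt h1).eq_or_lt with h2 | h2
      · have h3 : m = p + 1 := h2.symm
        subst h3
        rw [if_pos rfl, ← hε]
        linear_combination a * hεε
      · rw [hG m (by omega), if_neg (by omega)]; ring
  have hSdeg' : (S.comp (-X)).degree < (p : WithBot ℕ) := by
    rw [degree_lt_iff_coeff_zero] at hSdeg ⊢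
    intro m hm
    rw [comp_neg_X_coeff, hSdeg m hm, mul_zero]
  have h1 : symmIntegral r ((G + H) * S) = 0 := by
    rw [add_mul, map_add, horth S hSdeg, hHI, horth _ hSdeg', mul_zero, add_zero]
  have h2 : symmIntegral r (H * X ^ (p + 1)) = symmIntegral r (G * X ^ (p + 1)) := by
    have : (X ^ (p + 1) : ℝ[X]).comp (-X) = ε • X ^ (p + 1) := by
      rw [pow_comp, X_comp, neg_pow, hε, smul_eq_C_mul]; simp
    rw [hHI, this, mul_smul_comm, map_smul, smul_eq_mul, ← mul_assoc, hεε, one_mul]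
  -- The claimed product is a quarter of the integral of a square.
  have h3 : symmIntegral r ((G + H) * (G + H)) =
      4 * (a * symmIntegral r (G * X ^ (p + 1))) := by
    have e : (G + H) * (G + H) = (G + H) * S + (2 * a) • (G * X ^ (p + 1) + H * X ^ (p + 1)) := by
      rw [hS, smul_eq_C_mul, smul_eq_C_mul]; ring
    rw [e, map_add, h1, map_smul, map_add, h2, smul_eq_mul]; ring
  have h4 := symmIntegral_sq_nonneg hr (G + H)
  linarith

/-- Up to degrees below p, X G' equals pG + aX^(p+1), with a the coefficient of degree p + 1.
Integrating (xG²)' = G² + 2G·xG' therefore gives (2p + 1)∫G² + 2a∫G x^(p+1) = r(G(-r)² + G(r)²). The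
correlation term is nonnegative, and so is 2p∫G²; both are dropped. -/
theorem symmIntegral_sq_le (hr : 0 ≤ r) (hG : G.degree < ((p + 2 : ℕ) : WithBot ℕ))
    (horth : ∀ Q : ℝ[X], Q.degree < (p : WithBot ℕ) → symmIntegral r (G * Q) = 0) :
    symmIntegral r (G * G) ≤ r * (G.eval (-r) ^ 2 + G.eval r ^ 2) := by
  have hA := leading_correlation_nonneg hr hG horth
  rw [degree_lt_iff_coeff_zero] at hG
  set a := G.coeff (p + 1)
  set R : ℝ[X] := X * derivative G - (p : ℝ) • G - a • X ^ (p + 1) with hR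
  have hRdeg : R.degree < (p : WithBot ℕ) := by
    rw [degree_lt_iff_coeff_zero]
    intro m hm
    have hXd : (X * derivative G).coeff m = m * G.coeff m := by
      cases m with
      | zero => simp
      | succ k => rw [coeff_X_mul, coeff_derivative]; push_cast; ring
    have hc : R.coeff m = m * G.coeff m - p * G.coeff m - a * (if m = p + 1 then 1 else 0) := by
      simp only [hR, coeff_sub, coeff_smul, smul_eq_mul, coeff_X_pow, hXd]
    rw [hc]
    rcases hm.eq_or_lt with rfl | h1
    · rw [if_neg (by omega)]; ring
    · rcases (Nat.succ_le_of_lt h1).eq_or_lt with h2 | h2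
      · have h3 : m = p + 1 := h2.symm
        subst h3
        rw [if_pos rfl]; push_cast; ring
      · rw [hG m (by omega), if_neg (by omega)]; ring
  have h1 : symmIntegral r (G * (X * derivative G)) =
      p * symmIntegral r (G * G) + a * symmIntegral r (G * X ^ (p + 1)) := by
    have e : G * (X * derivative G) = G * R + ((p : ℝ) • (G * G) + a • (G * X ^ (p + 1))) := by
      rw [hR, smul_eq_C_mul, smul_eq_C_mul, smul_eq_C_mul, smul_eq_C_mul]; ring
    rw [e, map_add, horth R hRdeg, map_add, map_smul, map_smul, smul_eq_mul, smul_eq_mul, zero_add]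
  have h2 : symmIntegral r (G * G) + 2 * symmIntegral r (G * (X * derivative G)) =
      r * (G.eval (-r) ^ 2 + G.eval r ^ 2) := by
    have e : derivative (X * (G * G)) = G * G + (2 : ℝ) • (G * (X * derivative G)) := by
      rw [derivative_mul, derivative_mul, derivative_X, smul_eq_C_mul]
      simp only [map_ofNat]
      ring
    have h3 := symmIntegral_derivative r (X * (G * G))
    rw [e, map_add, map_smul, smul_eq_mul] at h3
    rw [h3]
    simp only [eval_mul, eval_X]
    ring
  have h3 : 0 ≤ (p : ℝ) * symmIntegral r (G * G) :=
    mul_nonneg (Nat.cast_nonneg p) (symmIntegral_sq_nonneg hr G)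
  linarith

/-- A polynomial of degree at most `p + 1` that is orthogonal on an interval to all polynomials of
degree less than `p` is controlled by its endpoint values. -/
theorem intervalIntegral_sq_le_of_orthogonal {P : ℝ[X]} {a b : ℝ} (hab : a ≤ b)
    (hP : P.degree < ((p + 2 : ℕ) : WithBot ℕ))
    (horth : ∀ Q : ℝ[X], Q.degree < (p : WithBot ℕ) → ∫ x in a..b, P.eval x * Q.eval x = 0) :
    ∫ x in a..b, P.eval x ^ 2 ≤ (b - a) / 2 * (P.eval a ^ 2 + P.eval b ^ 2) := by
  set c := (a + b) / 2 with hc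
  set r := (b - a) / 2 with hr
  have hr0 : 0 ≤ r := by rw [hr]; linarith
  have ha : -r + c = a := by rw [hr, hc]; ring
  have hb : r + c = b := by rw [hr, hc]; ring
  have hshift (Q : ℝ[X]) : symmIntegral r (Q.comp (X + C c)) = ∫ x in a..b, Q.eval x := by
    have := intervalIntegral.integral_comp_add_right (a := -r) (b := r) (fun x => Q.eval x) c
    rw [ha, hb] at this
    simpa [symmIntegral] using this
  have hdeg (Q : ℝ[X]) (y : ℝ) : (Q.comp (X + C y)).degree = Q.degree := by
    by_cases hQ : Q = 0
    · simp [hQ]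
    · have h1 : (Q.comp (X + C y)).natDegree = Q.natDegree := by simp [natDegree_comp]
      have h2 : Q.comp (X + C y) ≠ 0 := by
        intro h
        apply hQ
        have : (Q.comp (X + C y)).comp (X - C y) = Q := by simp [comp_assoc]
        rw [← this, h, zero_comp]
      rw [degree_eq_natDegree h2, degree_eq_natDegree hQ, h1]
  have hmain := symmIntegral_sq_le (G := P.comp (X + C c)) (p := p) hr0 (by rwa [hdeg])
    fun Q hQ => by
      have e : P.comp (X + C c) * Q = (P * Q.comp (X + C (-c))).comp (X + C c) := by
        rw [mul_comp, comp_assoc]; simp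
      rw [e, hshift]
      simpa only [eval_mul] using horth (Q.comp (X + C (-c))) (by rwa [hdeg])
  rw [← mul_comp, hshift] at hmain
  simp only [eval_comp, eval_add, eval_X, eval_C, ha, hb, eval_mul] at hmain
  simp only [pow_two] at hmain ⊢
  exact hmain

end OrthogonalPolynomial

/-! ### The distance from a piecewise polynomial to its reconstruction -/

section PiecewisePolynomial

open Polynomial Filter
open scoped Topology

variable {d N : ℕ} (M : Mesh N)

namespace Mesh

theorem node_castSucc_lt_succ (n : Fin N) : M.node n.castSucc < M.node n.succ :=
  M.strictMono Fin.castSucc_lt_succ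

theorem size_nonneg (n : Fin N) : 0 ≤ M.size n := sub_nonneg.2 (M.node_castSucc_lt_succ n).le

theorem eq_of_mem_cell {m n : Fin N} {x : ℝ} (hm : x ∈ M.cell m) (hn : x ∈ M.cell n) : m = n := by
  rcases lt_trichotomy m n with h | h | h
  · have := M.strictMono.monotone (show m.succ ≤ n.castSucc by simpa [Fin.le_def] using h)
    exact absurd (hm.2.trans_le this) (not_lt.2 hn.1.le)
  · exact h
  · have := M.strictMono.monotone (show n.succ ≤ m.castSucc by simpa [Fin.le_def] using h)
    exact absurd (hn.2.trans_le this) (not_lt.2 hm.1.le)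

theorem integrableOn_and_integral_eq_sum {F : ℝ → ℝ} (hF : ∀ n, IntegrableOn F (M.cell n)) :
    IntegrableOn F (Ioo 0 1) ∧ ∫ x in Ioo (0 : ℝ) 1, F x = ∑ n, ∫ x in M.cell n, F x := by
  set a : ℕ → ℝ := fun k => M.node ⟨min k N, by omega⟩ with ha
  have ha0 : a 0 = 0 := by rw [← M.node_zero]; exact congrArg M.node (Fin.ext (by simp))
  have haN : a N = 1 := by rw [← M.node_last]; exact congrArg M.node (Fin.ext (by simp))
  have hac (n : Fin N) : a n = M.node n.castSucc :=
    congrArg M.node (Fin.ext (by simp))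
  have has (n : Fin N) : a (n + 1) = M.node n.succ :=
    congrArg M.node (Fin.ext (by simp))
  have hi : ∀ k < N, IntervalIntegrable F volume (a k) (a (k + 1)) := fun k hk => by
    rw [hac ⟨k, hk⟩, has ⟨k, hk⟩, intervalIntegrable_iff_integrableOn_Ioo_of_le
      (M.node_castSucc_lt_succ _).le]
    exact hF ⟨k, hk⟩
  constructor
  · have h1 := IntervalIntegrable.trans_iterate hi
    rwa [ha0, haN, intervalIntegrable_iff_integrableOn_Ioo_of_le zero_le_one] at h1
  · have h1 := intervalIntegral.sum_integral_adjacent_intervals hi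
    rw [ha0, haN, intervalIntegral.integral_of_le zero_le_one, integral_Ioc_eq_integral_Ioo] at h1
    rw [← h1, Finset.sum_range]
    refine Finset.sum_congr rfl fun n _ => ?_
    rw [hac, has, intervalIntegral.integral_of_le (M.node_castSucc_lt_succ _).le,
      integral_Ioc_eq_integral_Ioo]
    rfl

end Mesh

/-- The vector-valued polynomial function with given components. -/
noncomputable def polyVec (P : Fin d → ℝ[X]) (x : ℝ) : Vec d := WithLp.toLp 2 fun i => (P i).eval x

theorem continuous_polyVec (P : Fin d → ℝ[X]) : Continuous (polyVec P) :=
  (PiLp.continuous_toLp 2 _).comp (continuous_pi fun i => (P i).continuous)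

theorem norm_polyVec_sq (P : Fin d → ℝ[X]) (x : ℝ) :
    ‖polyVec P x‖ ^ 2 = ∑ i, (P i).eval x ^ 2 := by
  rw [EuclideanSpace.norm_sq_eq]
  simp [polyVec]

namespace Mesh

variable {M}

theorem rightTrace_castSucc_of_eqOn {g h : ℝ → Vec d} {n : Fin N} (hg : EqOn g h (M.cell n))
    (hh : Continuous h) : M.rightTrace g n.castSucc = h (M.node n.castSucc) := by
  rw [rightTrace, if_neg (Fin.castSucc_lt_last n).ne]
  refine rightLim_eq_of_tendsto ?_
  refine (hh.continuousWithinAt (s := Ioi _) (x := M.node n.castSucc)).congr' ?_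
  filter_upwards [Ioo_mem_nhdsGT (M.node_castSucc_lt_succ n)] with x hx
  exact (hg hx).symm

theorem leftTrace_succ_of_eqOn {g h : ℝ → Vec d} {n : Fin N} (hg : EqOn g h (M.cell n))
    (hh : Continuous h) : M.leftTrace g n.succ = h (M.node n.succ) := by
  rw [leftTrace, if_neg (Fin.succ_ne_zero n)]
  refine leftLim_eq_of_tendsto ?_
  refine (hh.continuousWithinAt (s := Iio _) (x := M.node n.succ)).congr' ?_
  filter_upwards [Ioo_mem_nhdsLT (M.node_castSucc_lt_succ n)] with x hx
  exact (hg hx).symm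

theorem exists_polyVec_eqOn {k : ℕ} {g : ℝ → Vec d} (hg : g ∈ M.dgSpace k) (n : Fin N) :
    ∃ P : Fin d → ℝ[X], (∀ i, (P i).degree < (k : WithBot ℕ)) ∧ EqOn g (polyVec P) (M.cell n) := by
  obtain ⟨P, hP, hgP⟩ := hg n
  refine ⟨P, hP, fun x hx => ?_⟩
  ext i
  simpa [polyVec] using hgP x hx i

/-- Test functions in the piecewise polynomial space may be discontinuous, so one supported in a
single cell and a single component localizes the moment condition. -/
theorem moment_eq {p : ℕ} {g h : ℝ → Vec d}
    (hgh : ∀ φ ∈ M.dgSpace (d := d) p, ∑ n : Fin N, ∫ x in M.cell n, (inner ℝ (g x) (φ x) : ℝ) =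
      ∑ n : Fin N, ∫ x in M.cell n, inner ℝ (h x) (φ x))
    (n : Fin N) (i : Fin d) {Q : ℝ[X]} (hQ : Q.degree < (p : WithBot ℕ)) :
    ∫ x in M.cell n, g x i * Q.eval x = ∫ x in M.cell n, h x i * Q.eval x := by
  set φ : ℝ → Vec d := (M.cell n).indicator fun x => EuclideanSpace.single i (Q.eval x) with hφ
  have hmem : φ ∈ M.dgSpace (d := d) p := by
    intro m
    by_cases hmn : m = n
    · subst hmn
      refine ⟨Pi.single i Q, fun j => ?_, fun x hx j => ?_⟩
      · by_cases hj : j = i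
        · subst hj; simpa using hQ
        · rw [Pi.single_eq_of_ne hj, degree_zero]; exact WithBot.bot_lt_coe p
      · rw [hφ, indicator_of_mem hx]
        by_cases hj : j = i
        · subst hj; simp
        · simp [hj]
    · refine ⟨0, fun j => ?_, fun x hx j => ?_⟩
      · rw [Pi.zero_apply, degree_zero]; exact WithBot.bot_lt_coe p
      · rw [hφ, indicator_of_notMem fun h => hmn (M.eq_of_mem_cell hx h)]; simp
  have hsum (g : ℝ → Vec d) : ∑ m : Fin N, ∫ x in M.cell m, (inner ℝ (g x) (φ x) : ℝ) =
      ∫ x in M.cell n, g x i * Q.eval x := by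
    rw [Finset.sum_eq_single n]
    · refine setIntegral_congr_fun measurableSet_Ioo fun x hx => ?_
      simp only [hφ, indicator_of_mem hx]
      rw [EuclideanSpace.inner_single_right]
      simp [mul_comm]
    · intro m _ hmn
      refine setIntegral_eq_zero_of_forall_eq_zero fun x hx => ?_
      simp only [hφ, indicator_of_notMem fun h => hmn (M.eq_of_mem_cell hx h), inner_zero_right]
    · simp
  rw [← hsum, ← hsum, hgh φ hmem]

end Mesh

variable {M}

/-- The distance between a piecewise polynomial and its reconstruction is controlled by the
jumps. -/
theorem IsReconstruction.integral_norm_sub_sq_le {p : ℕ} {U : Set (Vec d)} {f : Vec d → Vec d}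
    {F w : Vec d → Vec d → Vec d} {L : ℝ} {g ghat : ℝ → Vec d} (hF : IsAdmissibleFlux U f F w L)
    (hr : IsReconstruction M p w g ghat) (hg : g ∈ M.dgSpace (p + 1))
    (hl : ∀ j, M.leftTrace g j ∈ U) (hr' : ∀ j, M.rightTrace g j ∈ U) :
    IntegrableOn (fun x => ‖ghat x - g x‖ ^ 2) (Ioo 0 1) ∧
      l2NormSq (fun x => ghat x - g x) ≤ L ^ 2 * ∑ n : Fin N, M.size n *
        (‖M.jump g n.castSucc‖ ^ 2 + ‖M.jump g n.succ‖ ^ 2) := by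
  have hcell (n : Fin N) : IntegrableOn (fun x => ‖ghat x - g x‖ ^ 2) (M.cell n) ∧
      ∫ x in M.cell n, ‖ghat x - g x‖ ^ 2 ≤ M.size n *
        (L ^ 2 * (‖M.jump g n.castSucc‖ ^ 2 + ‖M.jump g n.succ‖ ^ 2)) := by
    obtain ⟨P, hP, hgP⟩ := Mesh.exists_polyVec_eqOn hg n
    obtain ⟨P', hP', hgP'⟩ := Mesh.exists_polyVec_eqOn hr.mem_space n
    set E : Fin d → ℝ[X] := fun i => P' i - P i with hE
    have hEv (x : ℝ) : polyVec E x = polyVec P' x - polyVec P x := by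
      ext i; simp [polyVec, hE]
    have heq : EqOn (fun x => ‖ghat x - g x‖ ^ 2) (fun x => ‖polyVec E x‖ ^ 2) (M.cell n) :=
      fun x hx => by simp only [hgP hx, hgP' hx, hEv]
    have hEdeg (i : Fin d) : (E i).degree < ((p + 2 : ℕ) : WithBot ℕ) := by
      refine (degree_sub_le _ _).trans_lt (max_lt (hP' i) ((hP i).trans_le ?_))
      exact_mod_cast Nat.le_succ _
    have hlt := M.node_castSucc_lt_succ n
    have hcont : Continuous fun x => ‖polyVec E x‖ ^ 2 := (continuous_polyVec E).norm.pow 2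
    have horth (i : Fin d) (Q : ℝ[X]) (hQ : Q.degree < (p : WithBot ℕ)) :
        ∫ x in M.node n.castSucc..M.node n.succ, (E i).eval x * Q.eval x = 0 := by
      have h1 := Mesh.moment_eq hr.moments n i hQ
      have h2 {h : ℝ → Vec d} {R : Fin d → ℝ[X]} (hh : EqOn h (polyVec R) (M.cell n)) :
          ∫ x in M.cell n, h x i * Q.eval x =
            ∫ x in M.node n.castSucc..M.node n.succ, (R i).eval x * Q.eval x := by
        rw [intervalIntegral.integral_of_le hlt.le, integral_Ioc_eq_integral_Ioo]
        refine setIntegral_congr_fun measurableSet_Ioo fun x hx => ?_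
        simp only [hh hx, polyVec]
      rw [h2 hgP, h2 hgP'] at h1
      simp only [hE, eval_sub, sub_mul]
      rw [intervalIntegral.integral_sub, h1, sub_self]
      · exact (((P' i).continuous.mul Q.continuous).intervalIntegrable _ _)
      · exact (((P i).continuous.mul Q.continuous).intervalIntegrable _ _)
    -- At a node the one-sided value of the reconstruction is w of the two traces, so the difference
    -- is controlled by the jump through the Lipschitz property of w.
    have ha : ‖polyVec E (M.node n.castSucc)‖ ≤ L * ‖M.jump g n.castSucc‖ := by
      rw [hEv, ← Mesh.rightTrace_castSucc_of_eqOn hgP' (continuous_polyVec P'),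
        ← Mesh.rightTrace_castSucc_of_eqOn hgP (continuous_polyVec P), hr.right n]
      exact hF.dist_right _ (hl _) _ (hr' _)
    have hb : ‖polyVec E (M.node n.succ)‖ ≤ L * ‖M.jump g n.succ‖ := by
      rw [hEv, ← Mesh.leftTrace_succ_of_eqOn hgP' (continuous_polyVec P'),
        ← Mesh.leftTrace_succ_of_eqOn hgP (continuous_polyVec P), hr.left n]
      exact hF.dist_left _ (hl _) _ (hr' _)
    constructor
    · exact (integrableOn_congr_fun heq measurableSet_Ioo).2
        (hcont.integrableOn_Icc.mono_set Ioo_subset_Icc_self)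
    · rw [Mesh.cell] at heq ⊢
      rw [setIntegral_congr_fun measurableSet_Ioo heq, ← integral_Ioc_eq_integral_Ioo,
        ← intervalIntegral.integral_of_le hlt.le]
      simp only [norm_polyVec_sq]
      rw [intervalIntegral.integral_finsetSum (f := fun i x => (E i).eval x ^ 2)
        fun i _ => ((E i).continuous.pow 2).intervalIntegrable _ _]
      calc ∑ i, ∫ x in M.node n.castSucc..M.node n.succ, (E i).eval x ^ 2
          ≤ ∑ i, M.size n / 2 * ((E i).eval (M.node n.castSucc) ^ 2 +
              (E i).eval (M.node n.succ) ^ 2) := Finset.sum_le_sum fun i _ =>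
            intervalIntegral_sq_le_of_orthogonal hlt.le (hEdeg i) (horth i)
        _ = M.size n / 2 * (‖polyVec E (M.node n.castSucc)‖ ^ 2 +
              ‖polyVec E (M.node n.succ)‖ ^ 2) := by
            rw [norm_polyVec_sq, norm_polyVec_sq, ← Finset.mul_sum, Finset.sum_add_distrib]
        -- The factor 1/2 from the endpoint estimate is discarded here.
        _ ≤ M.size n * ((L * ‖M.jump g n.castSucc‖) ^ 2 + (L * ‖M.jump g n.succ‖) ^ 2) := by
            have := M.size_nonneg n
            gcongr
            linarith
        _ = _ := by ring
  obtain ⟨h1, h2⟩ := M.integrableOn_and_integral_eq_sum fun n => (hcell n).1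
  refine ⟨h1, ?_⟩
  rw [l2NormSq, h2, Finset.mul_sum]
  refine Finset.sum_le_sum fun n _ => (hcell n).2.trans (le_of_eq ?_)
  ring

end PiecewisePolynomial

/-! ### The sup norm of the spatial derivative as a function of time -/

section SliceNorm

open Filter
open scoped NNReal ENNReal Topology

theorem lt_essSup_iff {α : Type*} [MeasurableSpace α] {μ : Measure α} {h : α → ℝ≥0∞} {c : ℝ≥0∞} :
    c < essSup h μ ↔ 0 < μ {x | c < h x} := by
  have h1 : essSup h μ ≤ c ↔ μ {x | c < h x} = 0 := by
    have h2 : μ {x | c < h x} = 0 ↔ ∀ᵐ x ∂μ, h x ≤ c := by simp [ae_iff]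
    rw [h2]
    exact ⟨fun hc => (ENNReal.ae_le_essSup h).mono fun x hx => hx.trans hc,
      fun hc => essSup_le_of_ae_le c hc⟩
  rw [pos_iff_ne_zero, ← not_le, h1, Ne]

/-- The norm exceeds c exactly when the slice of {‖h‖ > c} has positive measure, and measures of
slices are measurable. Grönwall's inequality needs this for its rate. -/
theorem measurable_eLpNorm_top_slice {α β F : Type*} [MeasurableSpace α] [MeasurableSpace β]
    [NormedAddCommGroup F] {μ : Measure α} [SFinite μ] {h : α × β → F} (hh : StronglyMeasurable h) :
    Measurable fun t => eLpNorm (fun x => h (x, t)) ⊤ μ := by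
  refine measurable_of_Ioi fun c => ?_
  have h1 : MeasurableSet {z : α × β | c < ‖h z‖ₑ} :=
    measurableSet_lt measurable_const hh.enorm
  have h2 : Measurable fun t => μ ((fun x => (x, t)) ⁻¹' {z : α × β | c < ‖h z‖ₑ}) :=
    measurable_measure_prodMk_right h1
  have h3 : (fun t => eLpNorm (fun x => h (x, t)) ⊤ μ) ⁻¹' Ioi c =
      {t | 0 < μ ((fun x => (x, t)) ⁻¹' {z : α × β | c < ‖h z‖ₑ})} := by
    ext t
    rw [mem_preimage, mem_Ioi, eLpNorm_exponent_top, eLpNormEssSup, lt_essSup_iff]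
    rfl
  rw [h3]
  exact measurableSet_lt measurable_const h2

variable {F : Type*} [NormedAddCommGroup F] [NormedSpace ℝ F] {g : ℝ × ℝ → F} {K : ℝ≥0}

/-- The `L∞(0,1)` norm of the spatial derivative of a function of space and time. -/
noncomputable def spaceDerivNorm (g : ℝ × ℝ → F) (t : ℝ) : ℝ :=
  (eLpNorm (fun x => deriv (fun y => g (y, t)) x) ⊤ (volume.restrict (Ioo (0 : ℝ) 1))).toReal

theorem eLpNorm_spaceDeriv_le (hg : LipschitzWith K g) (t : ℝ) :
    eLpNorm (fun x => deriv (fun y => g (y, t)) x) ⊤ (volume.restrict (Ioo (0 : ℝ) 1)) ≤ K := by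
  rw [eLpNorm_exponent_top]
  refine eLpNormEssSup_le_of_ae_nnnorm_bound (Eventually.of_forall fun x => ?_)
  exact norm_deriv_le_of_lipschitz (hg.comp_prodMk_right t)

theorem spaceDerivNorm_le (hg : LipschitzWith K g) (t : ℝ) : spaceDerivNorm g t ≤ K :=
  ENNReal.toReal_le_coe_of_le_coe (eLpNorm_spaceDeriv_le hg t)

variable [FiniteDimensional ℝ F]

theorem stronglyMeasurable_spaceDeriv (hg : Continuous g) :
    StronglyMeasurable fun z : ℝ × ℝ => deriv (fun y => g (y, z.2)) z.1 := by
  borelize F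
  have h1 : Continuous (Function.uncurry fun t y : ℝ => g (y, t)) := hg.comp continuous_swap
  exact (stronglyMeasurable_deriv_with_param h1).comp_measurable measurable_swap

theorem measurable_spaceDerivNorm (hg : Continuous g) : Measurable (spaceDerivNorm g) :=
  (measurable_eLpNorm_top_slice (stronglyMeasurable_spaceDeriv hg)).ennreal_toReal

theorem ae_norm_fderiv_le_spaceDerivNorm (hg : LipschitzWith K g) :
    ∀ᵐ z ∂cylMeasure, ‖fderiv ℝ g z (1, 0)‖ ≤ spaceDerivNorm g z.2 := by
  have h1 : ∀ᵐ z ∂cylMeasure, ‖deriv (fun y => g (y, z.2)) z.1‖ ≤ spaceDerivNorm g z.2 := by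
    refine ae_cylMeasure_of_ae_ae ?_ (Eventually.of_forall fun t => ?_)
    · exact measurableSet_le (stronglyMeasurable_spaceDeriv hg.continuous).norm.measurable
        ((measurable_spaceDerivNorm hg.continuous).comp measurable_snd)
    · filter_upwards [enorm_ae_le_eLpNormEssSup (fun x => deriv (fun y => g (y, t)) x)
        (volume.restrict (Ioo (0 : ℝ) 1))] with x hx
      rw [← eLpNorm_exponent_top] at hx
      rw [← toReal_enorm]
      exact ENNReal.toReal_mono
        (ne_top_of_le_ne_top ENNReal.coe_ne_top (eLpNorm_spaceDeriv_le hg t)) hx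
  have h2 : ∀ᵐ z ∂cylMeasure, DifferentiableAt ℝ g z :=
    cylMeasure_absolutelyContinuous.ae_le hg.ae_differentiableAt
  filter_upwards [h1, h2] with z hz hd
  rwa [(hd.hasFDerivAt.hasDerivAt_fst (x := z.1) (t := z.2)).deriv] at hz

end SliceNorm

/-! ### Weak-* lower semicontinuity of the squared distance -/

section LowerSemicontinuity

open Filter
open scoped NNReal Topology

variable {d : ℕ}

/-- Lower semicontinuity of the distance to a continuous function along a weak-* convergent
sequence of slices. -/
theorem IsWeakStarContRep.integral_norm_sub_sq_le {u v : ℝ → ℝ → Vec d}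
    (hv : IsWeakStarContRep u v) {g : ℝ × ℝ → Vec d} (hg : Continuous g) {C : ℝ}
    (hgC : ∀ z, ‖g z‖ ≤ C) {B : ℕ → ℝ} {s : ℕ → ℝ} {t b : ℝ} (ht : 0 ≤ t) (hs0 : ∀ k, 0 ≤ s k)
    (hs : Tendsto s atTop (𝓝 t)) (hB : Tendsto B atTop (𝓝 b))
    (hle : ∀ k, ∫ x in Ioo (0 : ℝ) 1, ‖v x (s k) - g (x, s k)‖ ^ 2 ≤ B k) :
    ∫ x in Ioo (0 : ℝ) 1, ‖v x t - g (x, t)‖ ^ 2 ≤ b := by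
  have hgm (τ : ℝ) : MemLp (fun x => g (x, τ)) ⊤ (volume.restrict (Ioo (0 : ℝ) 1)) :=
    memLp_top_of_bound (hg.comp (Continuous.prodMk_left τ)).aestronglyMeasurable C
      (Eventually.of_forall fun x => hgC _)
  have hvg (τ : ℝ) (hτ : 0 ≤ τ) := (hv.memLp τ hτ).sub (hgm τ)
  have hL2 (τ : ℝ) (hτ : 0 ≤ τ) : MemLp (fun x => v x τ - g (x, τ)) 2
      (volume.restrict (Ioo (0 : ℝ) 1)) := (hvg τ hτ).mono_exponent le_top
  -- The limit difference itself is the weight: the pairing of ψ with the differences at times s k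
  -- tends to ∫‖ψ‖².
  set ψ : ℝ → Vec d := fun x => v x t - g (x, t) with hψ
  have hψ2 : MemLp ψ 2 (volume.restrict (Ioo (0 : ℝ) 1)) := hL2 t ht
  have hψi : Integrable ψ (volume.restrict (Ioo (0 : ℝ) 1)) := (hvg t ht).integrable le_top
  have hin {w : ℝ → Vec d} (hw : MemLp w ⊤ (volume.restrict (Ioo (0 : ℝ) 1))) :
      Integrable (fun x => (inner ℝ (w x) (ψ x) : ℝ)) (volume.restrict (Ioo (0 : ℝ) 1)) := by
    obtain ⟨Cw, -, hCw⟩ := hw.exists_ae_norm_le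
    refine (hψi.norm.const_mul Cw).mono' (hw.1.inner hψi.1) ?_
    filter_upwards [hCw] with x hx
    exact (norm_inner_le_norm _ _).trans (mul_le_mul_of_nonneg_right hx (norm_nonneg _))
  have h1 : Tendsto (fun k => ∫ x in Ioo (0 : ℝ) 1, (inner ℝ (v x (s k)) (ψ x) : ℝ)) atTop
      (𝓝 (∫ x in Ioo (0 : ℝ) 1, inner ℝ (v x t) (ψ x))) :=
    (hv.weakStar_cont ψ hψi t ht).tendsto.comp
      (tendsto_nhdsWithin_iff.2 ⟨hs, Eventually.of_forall hs0⟩)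
  have h2 : Tendsto (fun k => ∫ x in Ioo (0 : ℝ) 1, (inner ℝ (g (x, s k)) (ψ x) : ℝ)) atTop
      (𝓝 (∫ x in Ioo (0 : ℝ) 1, inner ℝ (g (x, t)) (ψ x))) := by
    refine tendsto_integral_of_dominated_convergence (fun x => C * ‖ψ x‖)
      (fun k => (hin (hgm (s k))).1) (hψi.norm.const_mul C)
      (fun k => Eventually.of_forall fun x => ?_) (Eventually.of_forall fun x => ?_)
    · exact (norm_inner_le_norm _ _).trans (mul_le_mul_of_nonneg_right (hgC _) (norm_nonneg _))
    · exact (((hg.comp (Continuous.prodMk_right x)).tendsto t).comp hs).inner tendsto_const_nhds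
  have h3 : Tendsto (fun k => ∫ x in Ioo (0 : ℝ) 1, (inner ℝ (v x (s k) - g (x, s k)) (ψ x) : ℝ))
      atTop (𝓝 (∫ x in Ioo (0 : ℝ) 1, ‖ψ x‖ ^ 2)) := by
    have e (τ : ℝ) (hτ : 0 ≤ τ) : ∫ x in Ioo (0 : ℝ) 1, (inner ℝ (v x τ - g (x, τ)) (ψ x) : ℝ) =
        (∫ x in Ioo (0 : ℝ) 1, inner ℝ (v x τ) (ψ x)) -
          ∫ x in Ioo (0 : ℝ) 1, inner ℝ (g (x, τ)) (ψ x) := by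
      simp only [inner_sub_left]
      exact integral_sub (hin (hv.memLp τ hτ)) (hin (hgm τ))
    have e2 : ∫ x in Ioo (0 : ℝ) 1, ‖ψ x‖ ^ 2 =
        (∫ x in Ioo (0 : ℝ) 1, inner ℝ (v x t) (ψ x)) -
          ∫ x in Ioo (0 : ℝ) 1, inner ℝ (g (x, t)) (ψ x) := by
      rw [← e t ht]
      refine integral_congr_ae (Eventually.of_forall fun x => ?_)
      simp only [hψ, real_inner_self_eq_norm_sq]
    rw [e2]
    exact (h1.sub h2).congr fun k => (e _ (hs0 k)).symm
  -- By Young's inequality each pairing is at most B k / 2 + ∫‖ψ‖²/2; in the limit ∫‖ψ‖² ≤ b/2 +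
  -- ∫‖ψ‖²/2, which is the claim.
  have h4 : Tendsto (fun k => 1 / 2 * B k + 1 / 2 * ∫ x in Ioo (0 : ℝ) 1, ‖ψ x‖ ^ 2) atTop
      (𝓝 (1 / 2 * b + 1 / 2 * ∫ x in Ioo (0 : ℝ) 1, ‖ψ x‖ ^ 2)) :=
    (hB.const_mul _).add_const _
  have h5 := le_of_tendsto_of_tendsto' h3 h4 fun k => by
    have hi1 := (hL2 (s k) (hs0 k)).integrable_norm_pow (by norm_num)
    have hi2 := hψ2.integrable_norm_pow (by norm_num)
    calc ∫ x in Ioo (0 : ℝ) 1, (inner ℝ (v x (s k) - g (x, s k)) (ψ x) : ℝ)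
        ≤ ∫ x in Ioo (0 : ℝ) 1, (1 / 2 * ‖v x (s k) - g (x, s k)‖ ^ 2 + 1 / 2 * ‖ψ x‖ ^ 2) := by
          refine integral_mono (hin (hvg _ (hs0 k))) ((hi1.const_mul _).add (hi2.const_mul _))
            fun x => ?_
          have := real_inner_le_norm (v x (s k) - g (x, s k)) (ψ x)
          nlinarith [sq_nonneg (‖v x (s k) - g (x, s k)‖ - ‖ψ x‖)]
      _ = 1 / 2 * (∫ x in Ioo (0 : ℝ) 1, ‖v x (s k) - g (x, s k)‖ ^ 2) +
            1 / 2 * ∫ x in Ioo (0 : ℝ) 1, ‖ψ x‖ ^ 2 := by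
          rw [integral_add (hi1.const_mul _) (hi2.const_mul _), integral_const_mul,
            integral_const_mul]
      _ ≤ _ := by linarith [hle k]
  linarith

end LowerSemicontinuity

/-! ### Stability at every time -/

section Stability

open Filter
open scoped NNReal Topology

variable {d : ℕ} {U D : Set (Vec d)} {f : Vec d → Vec d} {η q : Vec d → ℝ} {u₀ : ℝ → Vec d}
  {u : ℝ → ℝ → Vec d} {Cf Clo Chi : ℝ}

theorem tendsto_setIntegral_Ioo_of_bound {h : ℝ → ℝ} {C : ℝ} (hm : StronglyMeasurable h)
    (hC : ∀ s, ‖h s‖ ≤ C) {s : ℕ → ℝ} {t : ℝ} (ht : 0 ≤ t) (hs0 : ∀ k, 0 ≤ s k)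
    (hs : Tendsto s atTop (𝓝 t)) :
    Tendsto (fun k => ∫ r in Ioo 0 (s k), h r) atTop (𝓝 (∫ r in Ioo 0 t, h r)) := by
  have hi (a b : ℝ) : IntervalIntegrable h volume a b := by
    rw [intervalIntegrable_iff]
    exact IntegrableOn.of_bound (by simp [uIoc]) hm.aestronglyMeasurable C
      (Eventually.of_forall hC)
  have he (τ : ℝ) (hτ : 0 ≤ τ) : ∫ r in Ioo 0 τ, h r = ∫ r in (0 : ℝ)..τ, h r := by
    rw [intervalIntegral.integral_of_le hτ, integral_Ioc_eq_integral_Ioo]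
  rw [he t ht]
  exact (((intervalIntegral.continuous_primitive hi 0).tendsto t).comp hs).congr
    fun k => (he _ (hs0 k)).symm

/-- The relative entropy stability estimate, for every time, between an entropy solution and a
periodic Lipschitz function. -/
theorem IsWeakStarContRep.stability (hU : Convex ℝ U) (hU_int : (interior U).Nonempty)
    (hD : IsCompact D) (hDc : Convex ℝ D) (hDU : D ⊆ U) (hf : ContDiffOn ℝ 2 f U)
    (hηq : IsEntropyPair U f η q) (hC : IsHessianBound U D f η Cf Clo Chi)
    (hu : IsEntropySolution U f η q u₀ u) (huD : ∀ᵐ z ∂cylMeasure, u z.1 z.2 ∈ D)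
    {g : ℝ × ℝ → Vec d} {K : ℝ≥0} (hg : LipschitzWith K g) (hgD : ∀ z, g z ∈ D)
    (hper : ∀ x t, g (x + 1, t) = g (x, t)) {v : ℝ → ℝ → Vec d} (hv : IsWeakStarContRep u v)
    {t : ℝ} (ht : 0 ≤ t) :
    ∫ x in Ioo (0 : ℝ) 1, ‖v x t - g (x, t)‖ ^ 2 ≤
      Clo⁻¹ * ((∫ s in Ioo 0 t, ∫ x in Ioo (0 : ℝ) 1, ‖quasilinearResidual U f g (x, s)‖ ^ 2)
        + Chi * ∫ x in Ioo (0 : ℝ) 1, ‖u₀ x - g (x, 0)‖ ^ 2)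
        * Real.exp (∫ s in Ioo 0 t, (Chi * Cf * spaceDerivNorm g s + Chi ^ 2) / Clo) := by
  have hUd := uniqueDiffOn_convex hU hU_int
  have hf1 : ContDiffOn ℝ 1 f U := hf.of_le (by norm_num)
  have hu₀D := hu.init_mem_of_ae_mem hD hDc (hf.continuousOn.mono hDU) huD
  have hgU (z : ℝ × ℝ) : g z ∈ U := hDU (hgD z)
  have hSm := measurable_spaceDerivNorm hg.continuous
  have hS0 (s : ℝ) : 0 ≤ spaceDerivNorm g s := ENNReal.toReal_nonneg
  have hstab := hu.ae_stability hU hU_int hD hDc hDU hf hηq hC huD hu₀D hg hgD hper hSm hS0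
    (spaceDerivNorm_le hg) (ae_norm_fderiv_le_spaceDerivNorm hg)
  obtain ⟨CR, hCR⟩ := exists_norm_quasilinearResidual_le hUd hf1 hD hDU hg hgD
  have hRm := stronglyMeasurable_quasilinearResidual hUd hf1 hg.continuous hgU
  obtain ⟨CD, hCD⟩ := hD.exists_bound_of_continuousOn (f := id) continuousOn_id
  have hvu : ∀ᵐ z ∂cylMeasure, v z.1 z.2 = u z.1 z.2 := by
    rw [cylMeasure_eq]; exact hv.ae_eq
  -- The interval (0, t + 1) has t in its closure even when t = 0, so times at which the estimate
  -- holds accumulate at t.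
  have hgood : ∀ᵐ τ ∂(volume.restrict (Ioo (0 : ℝ) (t + 1))),
      ∫ x in Ioo (0 : ℝ) 1, ‖v x τ - g (x, τ)‖ ^ 2 ≤
      Clo⁻¹ * ((∫ s in Ioo 0 τ, ∫ x in Ioo (0 : ℝ) 1, ‖quasilinearResidual U f g (x, s)‖ ^ 2)
        + Chi * ∫ x in Ioo (0 : ℝ) 1, ‖u₀ x - g (x, 0)‖ ^ 2)
        * Real.exp (∫ s in Ioo 0 τ, (Chi * Cf * spaceDerivNorm g s + Chi ^ 2) / Clo) := by
    refine ae_mono (Measure.restrict_mono Ioo_subset_Ioi_self le_rfl) ?_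
    filter_upwards [hstab, ae_ae_of_ae_cylMeasure hvu] with τ h1 h2
    refine (integral_congr_ae ?_).trans_le h1
    filter_upwards [h2] with x hx
    rw [hx]
  obtain ⟨s, hs, hsP⟩ := exists_seq_tendsto_of_ae_restrict_Ioo (t := t) (by linarith)
    ⟨ht, by linarith⟩ hgood
  have hs0 (k : ℕ) : 0 ≤ s k := (hsP k).1.1.le
  refine hv.integral_norm_sub_sq_le hg.continuous (fun z => hCD _ (hgD z)) ht hs0 hs ?_
    fun k => (hsP k).2
  have hR2m : StronglyMeasurable fun z : ℝ × ℝ => ‖quasilinearResidual U f g z‖ ^ 2 := hRm.norm.pow 2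
  have hI1 := tendsto_setIntegral_Ioo_of_bound (C := CR ^ 2)
    (h := fun s => ∫ x in Ioo (0 : ℝ) 1, ‖quasilinearResidual U f g (x, s)‖ ^ 2)
    (hR2m.integral_prod_left' (μ := volume.restrict (Ioo (0 : ℝ) 1))) (fun r => by
      refine (norm_integral_le_of_norm_le_const (C := CR ^ 2)
        (Eventually.of_forall fun x => ?_)).trans (by simp)
      rw [norm_pow, norm_norm]
      exact pow_le_pow_left₀ (norm_nonneg _) (hCR _) 2) ht hs0 hs
  have hI2 := tendsto_setIntegral_Ioo_of_bound (C := (Chi * Cf * K + Chi ^ 2) / Clo)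
    (h := fun s => (Chi * Cf * spaceDerivNorm g s + Chi ^ 2) / Clo)
    (((hSm.const_mul _).add_const _).div_const _).stronglyMeasurable (fun r => by
      have hChi : 0 ≤ Chi := hC.lower_pos.le.trans hC.lower_le_upper
      have hCf := hC.flux_nonneg
      have hClo := hC.lower_pos
      have h1 := hS0 r
      have h2 := spaceDerivNorm_le hg r
      rw [Real.norm_of_nonneg (by positivity)]
      gcongr) ht hs0 hs
  exact ((hI1.add_const _).const_mul _).mul ((Real.continuous_exp.tendsto _).comp hI2)

end Stability

/-! ### Periodic extension of the reconstruction -/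

section Reconstruction

open Filter
open scoped NNReal Topology

variable {d N p : ℕ} {M : Mesh N} {w : Vec d → Vec d → Vec d}

/-- A continuous reconstruction is periodic. -/
theorem IsReconstruction.apply_zero_eq_apply_one {g ghat : ℝ → Vec d}
    (hr : IsReconstruction M p w g ghat) (hc : ContinuousOn ghat (Icc 0 1)) :
    ghat 0 = ghat 1 := by
  cases N with
  -- A mesh without cells would identify the nodes 0 and 1.
  | zero =>
    have h1 : M.node 0 = M.node (Fin.last 0) := rfl
    rw [M.node_zero, M.node_last] at h1
    exact absurd h1 zero_ne_one
  | succ k =>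
    have h0 := hr.right 0
    have h1 := hr.left (Fin.last k)
    have hne : (0 : Fin (k + 1 + 1)) ≠ Fin.last (k + 1) := (Fin.last_pos (n := k)).ne
    have e0 : (0 : Fin (k + 1)).castSucc = 0 := rfl
    rw [e0, Mesh.rightTrace, if_neg hne, M.node_zero] at h0
    rw [Fin.succ_last, Mesh.leftTrace, if_neg hne.symm, M.node_last] at h1
    -- By the periodic convention both end values of the reconstruction are w of the same pair of
    -- traces.
    have hl : M.leftTrace g 0 = M.leftTrace g (Fin.last (k + 1)) := by
      rw [Mesh.leftTrace, Mesh.leftTrace, if_pos rfl, if_neg hne.symm]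
    have hr' : M.rightTrace g 0 = M.rightTrace g (Fin.last (k + 1)) := by
      rw [Mesh.rightTrace, Mesh.rightTrace, if_pos rfl, if_neg hne]
    have hlim0 : Function.rightLim ghat 0 = ghat 0 := by
      refine rightLim_eq_of_tendsto ?_
      refine ((hc 0 (left_mem_Icc.2 zero_le_one)).mono_of_mem_nhdsWithin ?_).tendsto
      exact mem_of_superset (Ioo_mem_nhdsGT zero_lt_one) Ioo_subset_Icc_self
    have hlim1 : Function.leftLim ghat 1 = ghat 1 := by
      refine leftLim_eq_of_tendsto ?_
      refine ((hc 1 (right_mem_Icc.2 zero_le_one)).mono_of_mem_nhdsWithin ?_).tendsto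
      exact mem_of_superset (Ioo_mem_nhdsLT zero_lt_one) Ioo_subset_Icc_self
    rw [← hlim0, ← hlim1, h0, h1, hl, hr']

/-- The extension of a function on `[0,1] × [0,T]`, periodic in space and constant in time outside
`[0,T]`. -/
noncomputable def periodicClamp (T : ℝ) (h : ℝ → ℝ → Vec d) (z : ℝ × ℝ) : Vec d :=
  h (Int.fract z.1) (max 0 (min z.2 T))

variable {T : ℝ} {h : ℝ → ℝ → Vec d}

theorem clamp_mem_Icc (hT : 0 ≤ T) (t : ℝ) : max 0 (min t T) ∈ Icc 0 T :=
  ⟨le_max_left _ _, max_le hT (min_le_right _ _)⟩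

theorem clamp_eq_self {t : ℝ} (ht : t ∈ Icc 0 T) : max 0 (min t T) = t := by
  rw [min_eq_left ht.2, max_eq_right ht.1]

theorem periodicClamp_apply {x t : ℝ} (hx : x ∈ Ioo (0 : ℝ) 1) (ht : t ∈ Icc 0 T) :
    periodicClamp T h (x, t) = h x t := by
  rw [periodicClamp, clamp_eq_self ht, Int.fract_eq_self.2 ⟨hx.1.le, hx.2⟩]

theorem lipschitzWith_periodicClamp (hT : 0 ≤ T) {K : ℝ≥0}
    (hh : LipschitzOnWith K (fun z : ℝ × ℝ => h z.1 z.2) (Icc 0 1 ×ˢ Icc 0 T))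
    (h01 : ∀ t ∈ Icc 0 T, h 0 t = h 1 t) : LipschitzWith (K + K) (periodicClamp T h) := by
  have hx (t : ℝ) : LipschitzWith K fun x => periodicClamp T h (x, t) := by
    have h1 : LipschitzOnWith K (fun x => h x (max 0 (min t T))) (Icc 0 1) := fun x hx y hy => by
      have := hh (mk_mem_prod hx (clamp_mem_Icc hT t)) (mk_mem_prod hy (clamp_mem_Icc hT t))
      simpa [Prod.edist_eq] using this
    exact h1.lipschitzWith_comp_fract (h01 _ (clamp_mem_Icc hT t))
  have ht (x : ℝ) : LipschitzWith K fun t => periodicClamp T h (x, t) := by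
    have hf : Int.fract x ∈ Icc (0 : ℝ) 1 := ⟨Int.fract_nonneg x, (Int.fract_lt_one x).le⟩
    have h1 : LipschitzOnWith K (fun t => h (Int.fract x) t) (Icc 0 T) := fun s hs t ht => by
      have := hh (mk_mem_prod hf hs) (mk_mem_prod hf ht)
      simpa [Prod.edist_eq] using this
    have h2 : LipschitzWith 1 fun t : ℝ => max 0 (min t T) :=
      (LipschitzWith.id.min_const T).const_max 0
    simpa [periodicClamp] using h1.comp_lipschitzWith h2 fun t => clamp_mem_Icc hT t
  refine LipschitzWith.of_dist_le_mul fun z y => ?_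
  have h1 := (hx z.2).dist_le_mul z.1 y.1
  have h2 := (ht y.1).dist_le_mul z.2 y.2
  have h3 : dist z.1 y.1 ≤ dist z y := le_max_left _ _
  have h4 : dist z.2 y.2 ≤ dist z y := le_max_right _ _
  have hK : (0 : ℝ) ≤ K := K.2
  calc dist (periodicClamp T h z) (periodicClamp T h y)
      ≤ dist (periodicClamp T h (z.1, z.2)) (periodicClamp T h (y.1, z.2)) +
        dist (periodicClamp T h (y.1, z.2)) (periodicClamp T h (y.1, y.2)) := dist_triangle _ _ _
    _ ≤ K * dist z y + K * dist z y := add_le_add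
        (h1.trans (mul_le_mul_of_nonneg_left h3 hK)) (h2.trans (mul_le_mul_of_nonneg_left h4 hK))
    _ = ((K + K : ℝ≥0) : ℝ) * dist z y := by push_cast; ring

theorem periodicClamp_eventuallyEq_fst {x t : ℝ} (hx : x ∈ Ioo (0 : ℝ) 1) (ht : t ∈ Icc 0 T) :
    (fun y => periodicClamp T h (y, t)) =ᶠ[𝓝 x] fun y => h y t := by
  filter_upwards [isOpen_Ioo.mem_nhds hx] with y hy
  exact periodicClamp_apply hy ht

theorem periodicClamp_eventuallyEq_snd {x t : ℝ} (hx : x ∈ Ioo (0 : ℝ) 1) (ht : t ∈ Ioo 0 T) :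
    (fun s => periodicClamp T h (x, s)) =ᶠ[𝓝 t] fun s => h x s := by
  filter_upwards [isOpen_Ioo.mem_nhds ht] with s hs
  exact periodicClamp_apply hx (Ioo_subset_Icc_self hs)

theorem spaceDerivNorm_periodicClamp {t : ℝ} (ht : t ∈ Icc 0 T) :
    spaceDerivNorm (periodicClamp T h) t = supNormDx h t := by
  rw [spaceDerivNorm, supNormDx]
  congr 1
  refine eLpNorm_congr_ae ?_
  filter_upwards [ae_restrict_mem measurableSet_Ioo] with x hx
  exact (periodicClamp_eventuallyEq_fst hx ht).deriv_eq

/-- Before time T the extension agrees with h near interior points, and at points of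
differentiability the chain rule identifies the two forms of the residual. -/
theorem ae_quasilinearResidual_periodicClamp {U : Set (Vec d)} {f : Vec d → Vec d} {K : ℝ≥0}
    (hf : DifferentiableOn ℝ f U) (hh : LipschitzWith K (periodicClamp T h))
    (hU : ∀ z, periodicClamp T h z ∈ U) :
    ∀ᵐ t ∂(volume.restrict (Ioi (0 : ℝ))), t < T → ∀ᵐ x ∂(volume.restrict (Ioo (0 : ℝ) 1)),
      quasilinearResidual U f (periodicClamp T h) (x, t) = recResidual f h x t := by
  have hd : ∀ᵐ z ∂cylMeasure, DifferentiableAt ℝ (periodicClamp T h) z :=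
    cylMeasure_absolutelyContinuous.ae_le hh.ae_differentiableAt
  filter_upwards [ae_ae_of_ae_cylMeasure hd, ae_restrict_mem measurableSet_Ioi] with t h1 h2 h3
  filter_upwards [h1, ae_restrict_mem measurableSet_Ioo] with x hx hxm
  have ht : t ∈ Ioo 0 T := ⟨h2, h3⟩
  have e1 : deriv (fun s => h x s) t = fderiv ℝ (periodicClamp T h) (x, t) (0, 1) := by
    rw [← (periodicClamp_eventuallyEq_snd hxm ht).deriv_eq]
    exact hx.hasFDerivAt.hasDerivAt_snd.deriv
  have e2 : deriv (fun y => f (h y t)) x = fderivWithin ℝ f U (periodicClamp T h (x, t))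
      (fderiv ℝ (periodicClamp T h) (x, t) (1, 0)) := by
    have h4 : (fun y => f (periodicClamp T h (y, t))) =ᶠ[𝓝 x] fun y => f (h y t) :=
      (periodicClamp_eventuallyEq_fst hxm (Ioo_subset_Icc_self ht)).fun_comp f
    rw [← h4.deriv_eq]
    exact (hasFDerivAt_comp_of_differentiableOn hf hU hx).hasDerivAt_fst.deriv
  rw [recResidual, quasilinearResidual, e1, e2]

end Reconstruction

/-! ### The error estimate -/

theorem theorem5p5 {d N p : ℕ} (U D : Set (Vec d)) (f : Vec d → Vec d) (η q : Vec d → ℝ)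
    (Cf Clo Chi L T : ℝ) (M : Mesh N) (F w : Vec d → Vec d → Vec d)
    (u₀ : ℝ → Vec d) (u uh uhat : ℝ → ℝ → Vec d)
    (hU : Convex ℝ U) (hU_int : (interior U).Nonempty)
    (hD : IsCompact D) (hD_conv : Convex ℝ D) (hDU : D ⊆ U)
    (hf : ContDiffOn ℝ 2 f U) (hηq : IsEntropyPair U f η q)
    (hC : IsHessianBound U D f η Cf Clo Chi)
    (hu : IsEntropySolution U f η q u₀ u)
    (huD : ∀ᵐ z : ℝ × ℝ ∂(volume.restrict (Ioo (0 : ℝ) 1 ×ˢ Ioi (0 : ℝ))), u z.1 z.2 ∈ D)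
    (hT : 0 < T)
    (hF : IsAdmissibleFlux U f F w L)
    (huh : IsDGSolution M p U f F T uh)
    (hrec : ∀ t ∈ Icc 0 T, IsReconstruction M p w (fun x => uh x t) (fun x => uhat x t))
    (hlip : ∃ K, LipschitzOnWith K (fun z : ℝ × ℝ => uhat z.1 z.2) (Icc 0 1 ×ˢ Icc 0 T))
    (huhatD : ∀ x ∈ Icc (0 : ℝ) 1, ∀ t ∈ Icc 0 T, uhat x t ∈ D) :
    (∀ᵐ t ∂(volume.restrict (Icc 0 T)),
      l2NormSq (fun x => u x t - uh x t) ≤ errorBound M f L Cf Clo Chi u₀ uh uhat t) ∧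
    (∃ v, IsWeakStarContRep u v) ∧
    (∀ v, IsWeakStarContRep u v → ∀ t ∈ Icc 0 T,
      l2NormSq (fun x => v x t - uh x t) ≤ errorBound M f L Cf Clo Chi u₀ uh uhat t) := by
  obtain ⟨K, hK⟩ := hlip
  rw [← cylMeasure_eq] at huD
  have hfc : ContinuousOn f D := hf.continuousOn.mono hDU
  have hmono : ∀ t ∈ Icc 0 T, ContinuousOn (fun x => uhat x t) (Icc 0 1) := fun t ht =>
    hK.continuousOn.comp (f := fun x : ℝ => (x, t)) (by fun_prop) fun x hx => mk_mem_prod hx ht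
  -- The stability estimate needs a field on the whole plane; all its terms up to time t ≤ T see
  -- only `uhat`, as `e1` to `e4` show.
  set g := periodicClamp T uhat with hg
  have hgl : LipschitzWith (K + K) g := lipschitzWith_periodicClamp hT.le hK
    fun t ht => (hrec t ht).apply_zero_eq_apply_one (hmono t ht)
  have hgD (z : ℝ × ℝ) : g z ∈ D :=
    huhatD _ ⟨Int.fract_nonneg _, (Int.fract_lt_one _).le⟩ _ (clamp_mem_Icc hT.le _)
  have hper (x t : ℝ) : g (x + 1, t) = g (x, t) := by simp [hg, periodicClamp]
  have hres := ae_quasilinearResidual_periodicClamp (hf.differentiableOn (by norm_num)) hgl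
    fun z => hDU (hgD z)
  have hbound (v : ℝ → ℝ → Vec d) (hv : IsWeakStarContRep u v) (t : ℝ) (ht : t ∈ Icc 0 T) :
      l2NormSq (fun x => v x t - uh x t) ≤ errorBound M f L Cf Clo Chi u₀ uh uhat t := by
    have h1 := hv.stability hU hU_int hD hD_conv hDU hf hηq hC hu huD hgl hgD hper ht.1
    obtain ⟨h2i, h2⟩ := (hrec t ht).integral_norm_sub_sq_le hF (huh.mem_space t ht)
      (huh.leftTrace_mem t ht) (huh.rightTrace_mem t ht)
    have e1 : ∫ s in Ioo 0 t, ∫ x in Ioo (0 : ℝ) 1, ‖quasilinearResidual U f g (x, s)‖ ^ 2 =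
        ∫ s in Ioo 0 t, l2NormSq (fun x => recResidual f uhat x s) := by
      refine integral_congr_ae ?_
      filter_upwards [ae_mono (Measure.restrict_mono Ioo_subset_Ioi_self le_rfl) hres,
        ae_restrict_mem measurableSet_Ioo] with s hs hsm
      refine integral_congr_ae ?_
      filter_upwards [hs (hsm.2.trans_le ht.2)] with x hx
      rw [hx]
    have e2 : ∫ x in Ioo (0 : ℝ) 1, ‖u₀ x - g (x, 0)‖ ^ 2 = l2NormSq (fun x => u₀ x - uhat x 0) :=
      setIntegral_congr_fun measurableSet_Ioo fun x hx => by
        simp only [hg, periodicClamp_apply hx (left_mem_Icc.2 hT.le)]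
    have e3 : ∫ s in Ioo 0 t, (Chi * Cf * spaceDerivNorm g s + Chi ^ 2) / Clo =
        ∫ s in Ioo 0 t, (Chi * Cf * supNormDx uhat s + Chi ^ 2) / Clo :=
      setIntegral_congr_fun measurableSet_Ioo fun s hs => by
        simp only [hg, spaceDerivNorm_periodicClamp (h := uhat)
          (show s ∈ Icc 0 T from ⟨hs.1.le, hs.2.le.trans ht.2⟩)]
    have e4 : ∫ x in Ioo (0 : ℝ) 1, ‖v x t - g (x, t)‖ ^ 2 =
        ∫ x in Ioo (0 : ℝ) 1, ‖v x t - uhat x t‖ ^ 2 :=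
      setIntegral_congr_fun measurableSet_Ioo fun x hx => by
        simp only [hg, periodicClamp_apply hx ht]
    rw [e1, e2, e3, e4] at h1
    have hvi : IntegrableOn (fun x => ‖v x t - uhat x t‖ ^ 2) (Ioo 0 1) := by
      have hm : MemLp (fun x => v x t - g (x, t)) 2 (volume.restrict (Ioo (0 : ℝ) 1)) := by
        obtain ⟨CD, hCD⟩ := hD.exists_bound_of_continuousOn (f := id) continuousOn_id
        refine MemLp.mono_exponent ((hv.memLp t ht.1).sub (memLp_top_of_bound ?_ CD
          (Filter.Eventually.of_forall fun x => hCD _ (hgD _)))) le_top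
        exact (hgl.continuous.comp (Continuous.prodMk_left t)).aestronglyMeasurable
      refine IntegrableOn.congr_fun (hm.integrable_norm_pow (by norm_num)) (fun x hx => ?_)
        measurableSet_Ioo
      simp only [hg, periodicClamp_apply hx ht]
    -- (a + b)² ≤ 2a² + 2b² is the source of both factors 2 in the bound.
    have h3 : l2NormSq (fun x => v x t - uh x t) ≤
        2 * (∫ x in Ioo (0 : ℝ) 1, ‖v x t - uhat x t‖ ^ 2) +
          2 * l2NormSq (fun x => uhat x t - uh x t) := by
      rw [l2NormSq, l2NormSq, ← integral_const_mul, ← integral_const_mul,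
        ← integral_add (hvi.const_mul 2) (h2i.const_mul 2)]
      refine integral_mono_of_nonneg (Filter.Eventually.of_forall fun x => sq_nonneg _)
        ((hvi.const_mul 2).add (h2i.const_mul 2)) (Filter.Eventually.of_forall fun x => ?_)
      have h4 : ‖v x t - uh x t‖ ≤ ‖v x t - uhat x t‖ + ‖uhat x t - uh x t‖ :=
        norm_sub_le_norm_sub_add_norm_sub _ _ _
      have h5 := pow_le_pow_left₀ (norm_nonneg _) h4 2
      simp only []
      nlinarith [sq_nonneg (‖v x t - uhat x t‖ - ‖uhat x t - uh x t‖)]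
    rw [errorBound]
    linarith
  obtain ⟨v, hv⟩ := hu.exists_isWeakStarContRep hD hfc huD
  refine ⟨?_, ⟨v, hv⟩, hbound⟩
  have hvu : ∀ᵐ z ∂cylMeasure, v z.1 z.2 = u z.1 z.2 := by
    rw [cylMeasure_eq]; exact hv.ae_eq
  -- The time 0 is a null set; at almost every positive time u and its representative have the same
  -- slice by Fubini.
  rw [← restrict_Ioc_eq_restrict_Icc]
  filter_upwards [ae_mono (Measure.restrict_mono Ioc_subset_Ioi_self le_rfl)
    (ae_ae_of_ae_cylMeasure hvu), ae_restrict_mem measurableSet_Ioc] with t h1 h2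
  refine (integral_congr_ae ?_).trans_le (hbound v hv t (Ioc_subset_Icc_self h2))
  filter_upwards [h1] with x hx
  rw [hx]
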